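/- Let $\Lambda$ be a finitely generated subsemigroup (with $0$) of a lattice $M$ of finite rank that generates $M$ as a group, and suppose that the affine toric variety $Z^\Lambda=\operatorname{Spec}\mathbf C[\Lambda]$ has a zero-dimensional orbit $0$, i.e. $u,-u\in\Lambda$ implies $u=0$. Let $R$ be the analytic algebra of the algebroid germ $(Z^\Lambda,0)$, that is, the completion of $\mathbf C[\Lambda]$ at the maximal ideal generated by the $X^u$, $0\neq u\in\Lambda$; every $\phi\in R$ has a unique convergent expansion $\phi=\sum_{u\in\Lambda}c_uX^u$ with $c_u\in\mathbf C$. Let $K$ be the field of fractions of $R$, let $\bar R$ be the integral closure of $R$ in $K$, and let $B\to\operatorname{Spec}\bar R$ be the normalized blow-up centered at the closed point $0$. Let $D$ be an irreducible component of the exceptional divisor of $B$, and let $\nu_D$ be the associated divisorial valuation of $K$ (vanishing order along $D$). Put $\mathfrak p_k=\{\phi\in R:\nu_D(\phi)\ge k\}$, $$\mathrm{gr}_D(Z^\Lambda,0)=\bigoplus_{k\ge0}\mathfrak p_k/\mathfrak p_{k+1},\qquad \mathfrak m_D(Z^\Lambda,0)=\bigoplus_{k\ge1}\mathfrak p_k/\mathfrak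 p_{k+1}.$$ Let $N=\operatorname{Hom}(M,\mathbf Z)$, let $\rho\subset N_{\mathbf R}$ be the dual cone of $\mathbf R_{\ge0}\Lambda$, let $\bar\Lambda=\mathbf R_{\ge0}\Lambda\cap M$, and let $\Sigma$ be the dual Newton diagram of $\bar\Lambda\setminus\{0\}$, i.e. the subdivision of $\rho$ dual to the polyhedron $\mathrm{conv}\bigcup_{0\neq a\in\bar\Lambda}(a+\mathbf R_{\ge0}\Lambda)$. Then there is a unique primitive vector $n\in N$ spanning an edge $\tau$ of $\Sigma$, with relative interior contained in that of $\rho$, such that $D=D(\tau)$, i.e. the generic point of $D$ is mapped to the generic point of the orbit $\mathbf O_\tau$ of the toric chart $Z_\tau=\operatorname{Spec}\mathbf C[\tau^\vee\cap M]$. Moreover $\langle n,u\rangle\ge0$ for all $u\in\Lambda$, and if $H_k=\bigoplus_{u\in\Lambda,\langle n,u\rangle=k}\mathbf CX^u$, then $\mathfrak m_D(Z^\Lambda,0)$ is a maximal ideal and there is an isomorphism of graded $\mathbf C$-algebras $$\mathrm{gr}_D(Z^\Lambda,0)\;\longrightarrow\;\mathbf C[\Lambda]=\bigoplus_{k\ge0}H_k$$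 which maps $\mathfrak m_D(Z^\Lambda,0)$ onto $\bigoplus_{k\ge1}H_k$, and which maps the class modulo $\mathfrak p_{k+1}$ of each $\phi=\sum c_uX^u\in\mathfrak p_k\setminus\mathfrak p_{k+1}$ to its symbolic restriction $\phi_{|n}=\sum_{u\in\mathcal F}c_uX^u$, where $\mathcal F$ is the face determined by $n$ (on which $n$ is minimal) of the Newton polyhedron $\mathrm{conv}\bigcup_{c_u\ne0}(u+\mathbf R_{\ge0}\Lambda)$ of $\phi$. -/

import Mathlib

open scoped TensorProduct DirectSum WithZero

namespace ToricGerm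

section AssociatedGraded

/-- A decreasing multiplicative filtration `R = 𝔭₀ ⊇ 𝔭₁ ⊇ …` of a ring by ideals. -/
structure IdealFiltration (R : Type*) [CommRing R] where
  ideal : ℕ → Ideal R
  one_mem : 1 ∈ ideal 0
  succ_le : ∀ k, ideal (k + 1) ≤ ideal k
  mul_mem : ∀ {i j : ℕ} {a b : R}, a ∈ ideal i → b ∈ ideal j → a * b ∈ ideal (i + j)

variable {R : Type*} [CommRing R] (F : IdealFiltration R)

/-- The graded piece `𝔭ₖ / 𝔭ₖ₊₁`. -/
abbrev GradedPiece (k : ℕ) : Type _ := F.ideal k ⧸ (F.ideal (k + 1)).submoduleOf (F.ideal k)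

/-- The class modulo `𝔭ₖ₊₁` of an element of `𝔭ₖ`. -/
def pieceMk (k : ℕ) (a : R) (ha : a ∈ F.ideal k) : GradedPiece F k :=
  Submodule.Quotient.mk ⟨a, ha⟩

theorem pieceMk_eq_iff {k : ℕ} {a b : R} {ha : a ∈ F.ideal k} {hb : b ∈ F.ideal k} :
    pieceMk F k a ha = pieceMk F k b hb ↔ a - b ∈ F.ideal (k + 1) := by
  unfold pieceMk
  rw [Submodule.Quotient.eq]
  rfl

theorem pieceMk_surj {k : ℕ} (x : GradedPiece F k) : ∃ a ha, x = pieceMk F k a ha := by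
  induction x using Submodule.Quotient.induction_on with
  | _ y => exact ⟨y.1, y.2, rfl⟩

theorem pieceMk_congr {k l : ℕ} (h : k = l) {a b : R} (hab : a = b) (ha : a ∈ F.ideal k)
    (hb : b ∈ F.ideal l) :
    GradedMonoid.mk (A := GradedPiece F) k (pieceMk F k a ha) =
      GradedMonoid.mk l (pieceMk F l b hb) := by
  subst h; subst hab; rfl

/-- The product `𝔭ᵢ / 𝔭ᵢ₊₁ × 𝔭ⱼ / 𝔭ⱼ₊₁ → 𝔭ᵢ₊ⱼ / 𝔭ᵢ₊ⱼ₊₁` induced by the product of `R`. -/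
def pieceMul {i j : ℕ} (x : GradedPiece F i) (y : GradedPiece F j) : GradedPiece F (i + j) :=
  Quotient.liftOn₂' x y (fun a b => pieceMk F (i + j) (a.1 * b.1) (F.mul_mem a.2 b.2)) (by
    intro a b a' b' h h'
    rw [Submodule.quotientRel_def] at h h'
    have h₁ : a.1 - a'.1 ∈ F.ideal (i + 1) := h
    have h₂ : b.1 - b'.1 ∈ F.ideal (j + 1) := h'
    rw [pieceMk_eq_iff]
    have e : a.1 * b.1 - a'.1 * b'.1 = (a.1 - a'.1) * b.1 + a'.1 * (b.1 - b'.1) := by ring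
    rw [e]
    refine add_mem ?_ ?_
    · have := F.mul_mem h₁ b.2
      rwa [show i + 1 + j = i + j + 1 by ring] at this
    · have := F.mul_mem a'.2 h₂
      rwa [← add_assoc] at this)

theorem pieceMk_add {k : ℕ} {a b : R} (ha : a ∈ F.ideal k) (hb : b ∈ F.ideal k) :
    pieceMk F k a ha + pieceMk F k b hb = pieceMk F k (a + b) (add_mem ha hb) := rfl

theorem pieceMk_zero {k : ℕ} : (0 : GradedPiece F k) = pieceMk F k 0 (zero_mem _) := rfl

instance gradedPieceGMul : GradedMonoid.GMul (GradedPiece F) where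
  mul := fun x y => pieceMul F x y

theorem gmul_mk {i j : ℕ} {a b : R} (ha : a ∈ F.ideal i) (hb : b ∈ F.ideal j) :
    GradedMonoid.GMul.mul (pieceMk F i a ha) (pieceMk F j b hb) =
      pieceMk F (i + j) (a * b) (F.mul_mem ha hb) := rfl

instance gradedPieceGOne : GradedMonoid.GOne (GradedPiece F) where
  one := pieceMk F 0 1 F.one_mem

instance gradedPieceGMonoid : GradedMonoid.GMonoid (GradedPiece F) where
  one_mul := by
    rintro ⟨i, x⟩
    obtain ⟨a, ha, rfl⟩ := pieceMk_surj F x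
    exact pieceMk_congr F (zero_add i) (one_mul a) _ _
  mul_one := by
    rintro ⟨i, x⟩
    obtain ⟨a, ha, rfl⟩ := pieceMk_surj F x
    exact pieceMk_congr F (add_zero i) (mul_one a) _ _
  mul_assoc := by
    rintro ⟨i, x⟩ ⟨j, y⟩ ⟨k, z⟩
    obtain ⟨a, ha, rfl⟩ := pieceMk_surj F x
    obtain ⟨b, hb, rfl⟩ := pieceMk_surj F y
    obtain ⟨c, hc, rfl⟩ := pieceMk_surj F z
    exact pieceMk_congr F (add_assoc i j k) (mul_assoc a b c) _ _

instance gradedPieceGCommRing : DirectSum.GCommRing (GradedPiece F) where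
  __ := gradedPieceGMonoid F
  mul_zero := by
    intro i j x
    obtain ⟨a, ha, rfl⟩ := pieceMk_surj F x
    rw [pieceMk_zero, pieceMk_zero, gmul_mk, pieceMk_eq_iff]
    simp
  zero_mul := by
    intro i j x
    obtain ⟨a, ha, rfl⟩ := pieceMk_surj F x
    rw [pieceMk_zero, pieceMk_zero, gmul_mk, pieceMk_eq_iff]
    simp
  mul_add := by
    intro i j x y z
    obtain ⟨a, ha, rfl⟩ := pieceMk_surj F x
    obtain ⟨b, hb, rfl⟩ := pieceMk_surj F y
    obtain ⟨c, hc, rfl⟩ := pieceMk_surj F z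
    rw [pieceMk_add, gmul_mk, gmul_mk, gmul_mk, pieceMk_add, pieceMk_eq_iff]
    simp [mul_add]
  add_mul := by
    intro i j x y z
    obtain ⟨a, ha, rfl⟩ := pieceMk_surj F x
    obtain ⟨b, hb, rfl⟩ := pieceMk_surj F y
    obtain ⟨c, hc, rfl⟩ := pieceMk_surj F z
    rw [pieceMk_add, gmul_mk, gmul_mk, gmul_mk, pieceMk_add, pieceMk_eq_iff]
    simp [add_mul]
  mul_comm := by
    rintro ⟨i, x⟩ ⟨j, y⟩
    obtain ⟨a, ha, rfl⟩ := pieceMk_surj F x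
    obtain ⟨b, hb, rfl⟩ := pieceMk_surj F y
    exact pieceMk_congr F (add_comm i j) (mul_comm a b) _ _
  natCast := fun m => m • pieceMk F 0 1 F.one_mem
  natCast_zero := zero_smul _ _
  natCast_succ := fun m => succ_nsmul _ _
  intCast := fun m => m • pieceMk F 0 1 F.one_mem
  intCast_ofNat := fun m => natCast_zsmul _ _
  intCast_negSucc_ofNat := fun m => negSucc_zsmul _ _

instance gradedPieceGAlgebra (S : Type*) [CommRing S] [Algebra S R] :
    DirectSum.GAlgebra S (GradedPiece F) where
  toFun :=
    { toFun := fun s => pieceMk F 0 (algebraMap S R s) (by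
        simpa using (F.ideal 0).mul_mem_left (algebraMap S R s) F.one_mem)
      map_zero' := by rw [pieceMk_zero, pieceMk_eq_iff]; simp
      map_add' := fun s t => by rw [pieceMk_add, pieceMk_eq_iff]; simp }
  map_one := by
    change pieceMk F 0 _ _ = pieceMk F 0 _ _
    rw [pieceMk_eq_iff]; simp
  map_mul := fun s t => pieceMk_congr F (zero_add 0).symm (map_mul _ s t) _ _
  commutes := by
    rintro s ⟨i, x⟩
    obtain ⟨a, ha, rfl⟩ := pieceMk_surj F x
    exact pieceMk_congr F (add_comm 0 i) (mul_comm _ _) _ _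
  smul_def := by
    rintro s ⟨i, x⟩
    obtain ⟨a, ha, rfl⟩ := pieceMk_surj F x
    exact pieceMk_congr F (zero_add i).symm (Algebra.smul_def s a)
      ((F.ideal i).smul_of_tower_mem s ha) _

/-- The associated graded ring `⨁ₖ 𝔭ₖ / 𝔭ₖ₊₁`. -/
abbrev AssociatedGraded : Type _ := ⨁ k, GradedPiece F k

/-- The class of `a ∈ 𝔭ₖ` in the summand `𝔭ₖ / 𝔭ₖ₊₁` of the associated graded ring. -/
noncomputable def initialForm (k : ℕ) (a : R) (ha : a ∈ F.ideal k) : AssociatedGraded F :=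
  DirectSum.of (GradedPiece F) k (pieceMk F k a ha)

/-- The homogeneous component `𝔭ₖ / 𝔭ₖ₊₁`, as a subgroup of the associated graded ring. -/
noncomputable def gradedComponent (k : ℕ) : AddSubgroup (AssociatedGraded F) :=
  (DirectSum.of (GradedPiece F) k).range

/-- The ideal generated by the components of positive degree, i.e. `⨁_{k ≥ 1} 𝔭ₖ / 𝔭ₖ₊₁`. -/
noncomputable def positiveIdeal : Ideal (AssociatedGraded F) :=
  Ideal.span {x | ∃ k, 1 ≤ k ∧ x ∈ gradedComponent F k}

end AssociatedGraded

section Blowup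

/-! The blow-up is described on its affine charts. `R` is the local ring of the germ, `K` its field
of fractions, and all rings are realised inside `K`. -/

variable (R K : Type*) [CommRing R] [Field K] [Algebra R K]

/-- The integral closure `R̄` of `R` in `K`: the ring of the normalization. -/
abbrev NormalizationRing : Type _ := integralClosure R K

/-- The ideal of the closed point of `Spec R̄`, as the intersection of all maximal ideals
(`R̄` is local when `R` is the ring of an analytically irreducible germ). -/
def closedPointIdeal : Ideal (NormalizationRing R K) := Ring.jacobson (NormalizationRing R K)

/-- The chart `R̄[𝔪̄ / f]` of the blow-up of `Spec R̄` along the ideal `𝔪̄` of the closed point. -/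
def blowupChart (f : NormalizationRing R K) : Subalgebra (NormalizationRing R K) K :=
  Algebra.adjoin (NormalizationRing R K)
    {x | ∃ a ∈ closedPointIdeal R K, x = (a : K) / (f : K)}

/-- The corresponding chart of the normalized blow-up: the integral closure of `R̄[𝔪̄ / f]`
in `K`. -/
abbrev NormalizedChart (f : NormalizationRing R K) : Type _ :=
  integralClosure (blowupChart R K f) K

/-- The ideal `𝔪̄ 𝒪_B` of the exceptional divisor in a chart of the normalized blow-up. -/
def exceptionalIdeal (f : NormalizationRing R K) : Ideal (NormalizedChart R K f) :=
  Ideal.span {x | ∃ a ∈ closedPointIdeal R K, (x : K) = (a : K)}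

/-- An irreducible component `D` of the exceptional divisor of the normalized blow-up of `Spec R̄`
at its closed point, given in a chart that it meets by a minimal prime of the ideal of the
exceptional divisor. -/
structure ExceptionalComponent where
  f : NormalizationRing R K
  f_mem : f ∈ closedPointIdeal R K
  f_ne_zero : f ≠ 0
  prime : Ideal (NormalizedChart R K f)
  prime_mem : prime ∈ (exceptionalIdeal R K f).minimalPrimes

namespace ExceptionalComponent

variable {R K}
variable (D : ExceptionalComponent R K)

/-- The local ring `𝒪_{B,D}` of the normalized blow-up at the generic point of `D`, inside `K`. -/
def localRing : Set K :=
  {x | ∃ a s : NormalizedChart R K D.f, s ∉ D.prime ∧ x = (a : K) / (s : K)}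

/-- The maximal ideal of `𝒪_{B,D}`, inside `K`. -/
def localMaximalIdeal : Set K :=
  {x | ∃ a s : NormalizedChart R K D.f, a ∈ D.prime ∧ s ∉ D.prime ∧ x = (a : K) / (s : K)}

/-- `ν` is the divisorial valuation of `D`: the discrete valuation of `K` with value group `ℤ` and
with valuation ring `𝒪_{B,D}`. Values are written multiplicatively: vanishing to order `k` along
`D` means `ν x = exp (-k)`. -/
structure IsDivisorialValuation (ν : Valuation K ℤᵐ⁰) : Prop where
  surjective : Function.Surjective ν
  le_one_iff : ∀ x, ν x ≤ 1 ↔ x ∈ D.localRing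

variable {D}

theorem IsDivisorialValuation.algebraMap_le_one {ν : Valuation K ℤᵐ⁰}
    (hν : D.IsDivisorialValuation ν) (r : R) : ν (algebraMap R K r) ≤ 1 := by
  rw [hν.le_one_iff]
  have hp : D.prime.IsPrime := D.prime_mem.1.1
  refine ⟨algebraMap (blowupChart R K D.f) _
    (algebraMap (NormalizationRing R K) _ (algebraMap R _ r)), 1,
    fun h => hp.ne_top ((Ideal.eq_top_iff_one _).2 h), ?_⟩
  rw [OneMemClass.coe_one, div_one]
  rfl

/-- The filtration of `R` by the ideals `𝔭ₖ = {φ ∈ R | ν_D(φ) ≥ k}`. -/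
def IsDivisorialValuation.filtration {ν : Valuation K ℤᵐ⁰}
    (hν : D.IsDivisorialValuation ν) : IdealFiltration R where
  ideal k :=
    { carrier := {φ | ν (algebraMap R K φ) ≤ WithZero.exp (-(k : ℤ))}
      add_mem' := fun {a b} ha hb => by
        simp only [Set.mem_ofPred_eq] at *
        rw [map_add]
        exact ν.map_add_le ha hb
      zero_mem' := by simp
      smul_mem' := fun c a ha => by
        simp only [Set.mem_ofPred_eq, smul_eq_mul, map_mul] at *
        simpa using mul_le_mul' (hν.algebraMap_le_one c) ha }
  one_mem := by
    change ν (algebraMap R K 1) ≤ _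
    simp
  succ_le := fun k φ hφ => by
    change ν (algebraMap R K φ) ≤ _
    refine le_trans (show ν (algebraMap R K φ) ≤ WithZero.exp (-((k + 1 : ℕ) : ℤ)) from hφ) ?_
    rw [WithZero.exp_le_exp]
    push_cast
    linarith
  mul_mem := fun {i j a b} ha hb => by
    change ν (algebraMap R K (a * b)) ≤ _
    have ha' : ν (algebraMap R K a) ≤ WithZero.exp (-(i : ℤ)) := ha
    have hb' : ν (algebraMap R K b) ≤ WithZero.exp (-(j : ℤ)) := hb
    rw [map_mul, map_mul]
    have e : (-((i + j : ℕ) : ℤ)) = -(i : ℤ) + -(j : ℤ) := by push_cast; ring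
    rw [e, WithZero.exp_add]
    exact mul_le_mul' ha' hb'

end ExceptionalComponent

end Blowup

section Toric

variable {M : Type*} [AddCommGroup M] (Λ : AddSubmonoid M)

/-- The ideal `𝔪_Λ = (Λ - {0}) ℂ[Λ]` of the zero-dimensional orbit. -/
noncomputable def orbitMaximalIdeal : Ideal (AddMonoidAlgebra ℂ Λ) :=
  Ideal.span {p | ∃ u : Λ, u ≠ 0 ∧ p = AddMonoidAlgebra.single u 1}

/-- The analytic algebra of the algebroid germ `(Z^Λ, 0)`: the completion of `ℂ[Λ]` at `𝔪_Λ`. -/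
abbrev AnalyticAlgebra : Type _ := AdicCompletion (orbitMaximalIdeal Λ) (AddMonoidAlgebra ℂ Λ)

/-- `φ = ∑_{u ∈ Λ} c_u X^u`, the sum being convergent for the `𝔪_Λ`-adic topology. -/
def HasExpansion (φ : AnalyticAlgebra Λ) (c : Λ → ℂ) : Prop :=
  ∀ k : ℕ, ∃ s₀ : Finset Λ, ∀ s : Finset Λ, s₀ ⊆ s →
    AdicCompletion.evalₐ (orbitMaximalIdeal Λ) k φ =
      Ideal.Quotient.mk (orbitMaximalIdeal Λ ^ k) (∑ u ∈ s, AddMonoidAlgebra.single u (c u))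

/-- The point `u` of the lattice `M`, in the real vector space `M_ℝ`. -/
noncomputable def latticePoint (u : M) : ℝ ⊗[ℤ] M := 1 ⊗ₜ[ℤ] u

/-- The cone `ℝ_{≥0} Λ` in `M_ℝ`; it is the dual cone `ρ^∨` of `ρ`. -/
noncomputable def supportCone : PointedCone ℝ (ℝ ⊗[ℤ] M) := PointedCone.hull ℝ (latticePoint '' (Λ : Set M))

/-- The cone `ρ ⊆ N_ℝ` dual to `ℝ_{≥0} Λ`. -/
def dualConeRho : Set (Module.Dual ℝ (ℝ ⊗[ℤ] M)) := {η | ∀ v ∈ supportCone Λ, 0 ≤ η v}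

/-- The saturation `Λ̄ = ℝ_{≥0} Λ ∩ M`. -/
def saturation : Set M := {u | latticePoint u ∈ supportCone Λ}

/-- The Newton polyhedron `𝒩(I)`: the convex hull of `⋃_{a ∈ I} (a + ρ^∨)`. -/
def newtonPolyhedron (I : Set M) : Set (ℝ ⊗[ℤ] M) :=
  convexHull ℝ (⋃ a ∈ I, (fun v => latticePoint a + v) '' (supportCone Λ : Set (ℝ ⊗[ℤ] M)))

/-- The face of a polyhedron determined by `η`, on which `η` attains its minimum. -/
def faceOf (P : Set (ℝ ⊗[ℤ] M)) (η : Module.Dual ℝ (ℝ ⊗[ℤ] M)) : Set (ℝ ⊗[ℤ] M) :=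
  {v | v ∈ P ∧ ∀ v' ∈ P, η v ≤ η v'}

/-- The cone `σ(ℱ)` of those `η ∈ ρ` whose minimum on the polyhedron `P` is attained at every point
of `ℱ`. -/
def coneOfFace (P F : Set (ℝ ⊗[ℤ] M)) : Set (Module.Dual ℝ (ℝ ⊗[ℤ] M)) :=
  {η | η ∈ dualConeRho Λ ∧ ∀ v ∈ F, ∀ v' ∈ P, η v ≤ η v'}

/-- The dual Newton diagram `Σ(I)`: the set of the cones `σ(ℱ)`, for `ℱ` running through the
faces of `𝒩(I)`. -/
def dualNewtonDiagram (I : Set M) : Set (Set (Module.Dual ℝ (ℝ ⊗[ℤ] M))) :=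
  {C | ∃ η ∈ dualConeRho Λ,
    C = coneOfFace Λ (newtonPolyhedron Λ I) (faceOf (newtonPolyhedron Λ I) η)}

/-- The relative interior of a convex set `C`: the points `x ∈ C` such that every segment from a
point `y` of `C` to `x` can be prolonged beyond `x` within `C`. -/
def relInterior {V : Type*} [AddCommGroup V] [Module ℝ V] (C : Set V) : Set V :=
  {x | x ∈ C ∧ ∀ y ∈ C, ∃ ε : ℝ, 0 < ε ∧ x + ε • (x - y) ∈ C}

/-- The ray `τ = ℝ_{≥0} n` spanned by a vector `n` of the lattice `N = Hom(M, ℤ)`. -/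
def ray (n : Module.Dual ℤ M) : Set (Module.Dual ℝ (ℝ ⊗[ℤ] M)) :=
  {η | ∃ t : ℝ, 0 ≤ t ∧ η = t • n.baseChange ℝ}

/-- The semigroup `τ^∨ ∩ M`, for `τ` the ray spanned by `n`. -/
def dualRaySemigroup (n : Module.Dual ℤ M) : AddSubmonoid M where
  carrier := {w | 0 ≤ n w}
  add_mem' := fun {a b} ha hb => by
    simp only [Set.mem_ofPred_eq, map_add] at *
    exact add_nonneg ha hb
  zero_mem' := by simp

/-- The ideal `(X^w / w ∈ (τ^∨ - τ^⊥) ∩ M)` of `ℂ[τ^∨ ∩ M]`, which defines the orbit `𝐎_τ` in the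
toric variety `Z_τ`. -/
noncomputable def rayOrbitIdeal (n : Module.Dual ℤ M) : Ideal (AddMonoidAlgebra ℂ (dualRaySemigroup n)) :=
  Ideal.span {p | ∃ w : dualRaySemigroup n, 0 < n w ∧ p = AddMonoidAlgebra.single w 1}

variable {K : Type*} [Field K] [Algebra (AnalyticAlgebra Λ) K]

/-- `n` is the primitive ray vector of the exceptional component `D`: it is a primitive vector
that spans an edge `τ` of `Σ(Λ̄ - {0})` with relative interior inside that of `ρ`, and `D` is the
component `D(τ)`, that is, the generic point of `D` is mapped to the generic point of the orbit
`𝐎_τ ⊆ Z_τ`. The last condition says that the embedding of `ℂ[τ^∨ ∩ M]` in `K` which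
extends `ℂ[Λ] → K` has values in `𝒪_{B,D}` and that the maximal ideal of `𝒪_{B,D}` contracts to the
ideal of `𝐎_τ`. -/
structure IsPrimitiveRayVector (D : ExceptionalComponent (AnalyticAlgebra Λ) K)
    (n : Module.Dual ℤ M) : Prop where
  primitive : ∀ (k : ℤ) (m : Module.Dual ℤ M), n = k • m → IsUnit k
  edge : ray n ∈ dualNewtonDiagram Λ (saturation Λ \ {0})
  interior : relInterior (ray n) ⊆ relInterior (dualConeRho Λ)
  generic_point : ∃ χ : AddMonoidAlgebra ℂ (dualRaySemigroup n) →+* K,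
    (∀ (u : Λ) (hu : (u : M) ∈ dualRaySemigroup n) (z : ℂ),
      χ (AddMonoidAlgebra.single ⟨u, hu⟩ z) =
        algebraMap (AnalyticAlgebra Λ) K
          (AdicCompletion.of (orbitMaximalIdeal Λ) _ (AddMonoidAlgebra.single u z))) ∧
    (∀ p, χ p ∈ D.localRing) ∧ ∀ p, χ p ∈ D.localMaximalIdeal ↔ p ∈ rayOrbitIdeal n

/-- The symbolic restriction of the series `∑ c_u X^u` to the face determined by `η` of its Newton
polyhedron, as a family of coefficients. -/
noncomputable def symbolicRestriction (c : Λ → ℂ) (η : Module.Dual ℝ (ℝ ⊗[ℤ] M)) : Λ → ℂ :=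
  open Classical in fun u =>
    if latticePoint (u : M) ∈
        faceOf (newtonPolyhedron Λ {a | ∃ w : Λ, c w ≠ 0 ∧ a = (w : M)}) η
    then c u else 0

/-- The homogeneous component `H_k = ⨁_{u ∈ Λ, ⟨n, u⟩ = k} ℂ X^u` of `ℂ[Λ]`. -/
noncomputable def weightComponent (n : Module.Dual ℤ M) (k : ℕ) : Submodule ℂ (AddMonoidAlgebra ℂ Λ) :=
  Submodule.span ℂ {p | ∃ u : Λ, n u = (k : ℤ) ∧ p = AddMonoidAlgebra.single u 1}

/-- The ideal `⨁_{k ≥ 1} H_k` of `ℂ[Λ]`, generated by the components of positive degree. -/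
noncomputable def weightPositiveIdeal (n : Module.Dual ℤ M) : Ideal (AddMonoidAlgebra ℂ Λ) :=
  Ideal.span {p | ∃ k : ℕ, 1 ≤ k ∧ p ∈ weightComponent Λ n k}

end Toric

end ToricGerm

namespace ToricGerm

/-! ### Powers of the monomial maximal ideal of ℂ[Λ] -/

section MonomialIdeal

open AddMonoidAlgebra

variable {M : Type*} [AddCommGroup M] {Λ : AddSubmonoid M}

/-! Write v_D for the order along D and put n(w) = v_D(X^w) for the Laurent monomials X^w, w ∈ M.
The core is `exists_weight_eq_val`: on R the order along D is the monomial valuation of n, i.e.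
v_D(∑ c_u X^u) = min {n(u) : c_u ≠ 0}. Consequently 𝔭ₖ consists of the series all of whose exponents
have weight at least k (`mem_filtration_iff`). Taking the part of weight k identifies 𝔭ₖ/𝔭ₖ₊₁ with
H_k, compatibly with products. This part is a finite sum because n is positive on Λ - {0}, and for φ
∈ 𝔭ₖ outside 𝔭ₖ₊₁ it is the restriction of φ to the face on which n is minimal.

For the core, let μ be the monomial valuation of n, obtained by embedding K in a field of Hahn
series with exponents in a lexicographic product ℝ ×ₗ ℤ^r (`exists_monomialValuation`). Convergence
of expansions gives v_D ≥ μ on R̄. Let f be the denominator of the chart in which D is given. On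
that chart f generates the ideal of the closed point, so v_D(f) ≤ n(w) for every nonzero w in the
saturation Λ̄. As f has no constant term, it follows that v_D(f) = μ(f) = min n on Λ̄ - {0}
(`exists_exponent_of_equation`). Hence μ is non-negative on the chart. Every element of the chart is
carried into R̄ by a power of f, so v_D ≥ μ holds on the chart too. The centre of μ is then a prime
lying between the exceptional ideal and the prime of D, and minimality makes it the prime of D. So μ
> 0 wherever v_D > 0. Applied to φ/X^u and to its inverse, with u an exponent of φ of least weight,
this yields v_D(φ) = n(u).

That n spans an edge is a perturbation argument (`eq_zero_of_weight_eq_zero`). Suppose η is constant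
on the points of Λ̄ - {0} where n is minimal. For small ε the monomial valuations of n ± εη are
still non-negative on the chart. The two bounds together force the valuation of n + εη to vanish
outside the prime of D, hence on every X^w with n(w) = 0, so η is a multiple of n. Primitivity comes
from the surjectivity of ν. For uniqueness, the generic point condition on a vector n' says that
n'(w) > 0 implies n(w) > 0. So n' is a positive multiple of n, and primitivity makes it equal to n.
-/

theorem pointed_add_eq_zero (hzero : ∀ u ∈ Λ, -u ∈ Λ → u = 0) {u v : Λ} (h : u + v = 0) :
    u = 0 ∧ v = 0 := by
  have h' : (u : M) + v = 0 := congrArg Subtype.val h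
  have hu : (u : M) = 0 := hzero u u.2 (by rw [neg_eq_of_add_eq_zero_right h']; exact v.2)
  refine ⟨Subtype.ext hu, Subtype.ext ?_⟩
  simpa [hu] using h'

/-- The constant coefficient `ℂ[Λ] → ℂ`, a ring homomorphism when `Λ` is pointed. -/
noncomputable def constantCoeff (hzero : ∀ u ∈ Λ, -u ∈ Λ → u = 0) :
    AddMonoidAlgebra ℂ Λ →ₐ[ℂ] ℂ :=
  AddMonoidAlgebra.lift ℂ ℂ Λ
    { toFun := fun u => open Classical in if u.toAdd = 0 then 1 else 0
      map_one' := by simp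
      map_mul' := fun u v => by
        by_cases hu : u.toAdd = 0 <;> by_cases hv : v.toAdd = 0 <;>
          simp only [toAdd_mul, hu, hv, if_true, if_false, add_zero, zero_add, mul_one, mul_zero]
        rw [if_neg fun h => hu (pointed_add_eq_zero hzero h).1] }

theorem constantCoeff_single (hzero : ∀ u ∈ Λ, -u ∈ Λ → u = 0) (u : Λ) (z : ℂ) :
    constantCoeff hzero (single u z) = open Classical in if u = 0 then z else 0 := by
  simp [constantCoeff, AddMonoidAlgebra.lift_single]

theorem single_mem_orbitMaximalIdeal {u : Λ} (hu : u ≠ 0) (z : ℂ) :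
    single u z ∈ orbitMaximalIdeal Λ := by
  have : single u z = single 0 z * single u (1 : ℂ) := by simp
  rw [this]
  exact Ideal.mul_mem_left _ _ (Ideal.subset_span ⟨u, hu, rfl⟩)

theorem orbitMaximalIdeal_le_ker (hzero : ∀ u ∈ Λ, -u ∈ Λ → u = 0) :
    orbitMaximalIdeal Λ ≤ RingHom.ker (constantCoeff hzero) := by
  refine Ideal.span_le.2 ?_
  rintro _ ⟨u, hu, rfl⟩
  simp [RingHom.mem_ker, constantCoeff_single, hu]

theorem orbitMaximalIdeal_ne_top (hzero : ∀ u ∈ Λ, -u ∈ Λ → u = 0) : orbitMaximalIdeal Λ ≠ ⊤ := by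
  intro h
  have := orbitMaximalIdeal_le_ker hzero (h ▸ Submodule.mem_top (x := (1 : AddMonoidAlgebra ℂ Λ)))
  simp [RingHom.mem_ker] at this

theorem zero_notMem_support (hzero : ∀ u ∈ Λ, -u ∈ Λ → u = 0) {p : AddMonoidAlgebra ℂ Λ}
    (hp : p ∈ orbitMaximalIdeal Λ) : p.coeff 0 = 0 := by
  have h := orbitMaximalIdeal_le_ker hzero hp
  rw [RingHom.mem_ker] at h
  rw [← h]
  clear h hp
  induction p using AddMonoidAlgebra.induction_linear with
  | zero => simp
  | add p q hp hq => simp [hp, hq]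
  | single u z =>
    change _ = constantCoeff hzero (single u z)
    rw [constantCoeff_single]
    by_cases h : u = 0 <;> simp [h]

theorem single_mem_pow_add {k : ℕ} {u : Λ} (hu : single u (1 : ℂ) ∈ orbitMaximalIdeal Λ ^ k)
    (v : Λ) (z : ℂ) : single (v + u) z ∈ orbitMaximalIdeal Λ ^ k := by
  have : single (v + u) z = single v z * single u (1 : ℂ) := by simp
  rw [this]
  exact Ideal.mul_mem_left _ _ hu

theorem single_mem_pow_succ {k : ℕ} {u v : Λ} (hu : single u (1 : ℂ) ∈ orbitMaximalIdeal Λ ^ k)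
    (hv : v ≠ 0) : single (v + u) (1 : ℂ) ∈ orbitMaximalIdeal Λ ^ (k + 1) := by
  have : single (v + u) (1 : ℂ) = single v 1 * single u (1 : ℂ) := by simp
  rw [this, pow_succ']
  exact Ideal.mul_mem_mul (single_mem_orbitMaximalIdeal hv 1) hu

theorem mem_pow_of_support {k : ℕ} {p : AddMonoidAlgebra ℂ Λ}
    (hp : ∀ u, p.coeff u ≠ 0 → single u (1 : ℂ) ∈ orbitMaximalIdeal Λ ^ k) :
    p ∈ orbitMaximalIdeal Λ ^ k := by
  rw [← sum_coeff_single p]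
  refine sum_mem fun u hu => ?_
  simpa using single_mem_pow_add (hp u (by simpa using hu)) 0 (p.coeff u)

theorem exists_add_of_coeff_mul_ne_zero {p q : AddMonoidAlgebra ℂ Λ} {w : Λ}
    (h : (p * q).coeff w ≠ 0) : ∃ u v, u + v = w ∧ p.coeff u ≠ 0 ∧ q.coeff v ≠ 0 := by
  classical
  rw [AddMonoidAlgebra.coeff_mul] at h
  obtain ⟨u, hu, h⟩ := Finset.exists_ne_zero_of_sum_ne_zero h
  obtain ⟨v, hv, h⟩ := Finset.exists_ne_zero_of_sum_ne_zero h
  refine ⟨u, v, ?_, by simpa using hu, by simpa using hv⟩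
  by_contra hne
  simp [hne] at h

/-- The powers of 𝔪 are monomial ideals. A monomial of a product a * b with a ∈ 𝔪 and b ∈ 𝔪^k has
exponent u + v, where u ≠ 0 because a has no constant term and X^v ∈ 𝔪^k by induction. -/
theorem single_mem_pow_of_coeff_ne_zero (hzero : ∀ u ∈ Λ, -u ∈ Λ → u = 0) {k : ℕ}
    {p : AddMonoidAlgebra ℂ Λ} (hp : p ∈ orbitMaximalIdeal Λ ^ k) {u : Λ} (hu : p.coeff u ≠ 0) :
    single u (1 : ℂ) ∈ orbitMaximalIdeal Λ ^ k := by
  induction k generalizing p u with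
  | zero => simp
  | succ k ih =>
    rw [pow_succ'] at hp
    refine Submodule.mul_induction_on (C := fun p => ∀ u, p.coeff u ≠ 0 →
      single u (1 : ℂ) ∈ orbitMaximalIdeal Λ ^ (k + 1)) hp ?_ ?_ u hu
    · intro a ha b hb u hu
      obtain ⟨u, v, rfl, hu, hv⟩ := exists_add_of_coeff_mul_ne_zero hu
      refine single_mem_pow_succ (ih hb hv) ?_
      rintro rfl
      exact hu (zero_notMem_support hzero ha)
    · intro a b ha hb u hu
      by_cases h : a.coeff u = 0
      · exact hb u (by simpa [h] using hu)
      · exact ha u h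

theorem isNoetherianRing_algebra (hfg : Λ.FG) : IsNoetherianRing (AddMonoidAlgebra ℂ Λ) := by
  have : AddMonoid.FG Λ := (AddMonoid.fg_iff_addSubmonoid_fg _).2 hfg
  have : Algebra.FiniteType ℂ (AddMonoidAlgebra ℂ Λ) := inferInstance
  exact Algebra.FiniteType.isNoetherianRing ℂ _

/-- A nonzero exponent is s + v with s a nonzero generator, and X^(s+v) ∉ 𝔪^(k+1) forces X^v ∉ 𝔪^k.
So each step adds only finitely many exponents. -/
theorem finite_setOf_single_notMem_pow (hfg : Λ.FG) (k : ℕ) :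
    {u : Λ | single u (1 : ℂ) ∉ orbitMaximalIdeal Λ ^ k}.Finite := by
  have : AddMonoid.FG Λ := (AddMonoid.fg_iff_addSubmonoid_fg _).2 hfg
  obtain ⟨S, hS⟩ := AddMonoid.FG.fg_top (M := Λ)
  have hdec : ∀ u : Λ, u = 0 ∨ ∃ s ∈ S, s ≠ 0 ∧ ∃ v, u = s + v := by
    intro u
    have hu : u ∈ AddSubmonoid.closure (S : Set Λ) := hS ▸ AddSubmonoid.mem_top u
    induction hu using AddSubmonoid.closure_induction with
    | mem s hs =>
      by_cases h : s = 0
      · exact Or.inl h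
      · exact Or.inr ⟨s, hs, h, 0, by simp⟩
    | zero => exact Or.inl rfl
    | add x y _ _ hx hy =>
      rcases hx with rfl | ⟨s, hs, h, v, rfl⟩
      · simpa using hy
      · exact Or.inr ⟨s, hs, h, v + y, by abel⟩
  induction k with
  | zero => simp
  | succ k ih =>
    refine ((Set.finite_singleton (0 : Λ)).union (Set.Finite.image2 (· + ·) S.finite_toSet ih)).subset ?_
    intro u hu
    rcases hdec u with rfl | ⟨s, hs, h, v, rfl⟩
    · exact Or.inl rfl
    · exact Or.inr ⟨s, hs, v, fun hv => hu (single_mem_pow_succ hv h), rfl⟩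

/-- Krull's intersection theorem in the Noetherian domain ℂ[Λ]. It ensures that every coefficient of
a series can be read off modulo some power of 𝔪. -/
theorem exists_single_notMem_pow [Module.Free ℤ M] (hfg : Λ.FG)
    (hzero : ∀ u ∈ Λ, -u ∈ Λ → u = 0) (u : Λ) :
    ∃ k, single u (1 : ℂ) ∉ orbitMaximalIdeal Λ ^ k := by
  have := isNoetherianRing_algebra hfg
  have : IsAddTorsionFree M := Module.isTorsionFree_int_iff_isAddTorsionFree.1 inferInstance
  have : IsAddTorsionFree Λ := ⟨fun _ hn _ _ h =>
    Subtype.ext (IsAddTorsionFree.nsmul_right_injective hn (congrArg Subtype.val h))⟩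
  have : AddMonoid.FG Λ := (AddMonoid.fg_iff_addSubmonoid_fg _).2 hfg
  let _ : AddCancelCommMonoid Λ := { add_left_cancel := fun _ _ _ h => add_left_cancel h }
  have : IsDomain (AddMonoidAlgebra ℂ Λ) := NoZeroDivisors.to_isDomain _
  by_contra! h
  have h2 := Ideal.iInf_pow_eq_bot_of_isDomain _ (orbitMaximalIdeal_ne_top hzero)
  have h3 : single u (1 : ℂ) ∈ (⊥ : Ideal (AddMonoidAlgebra ℂ Λ)) := by
    rw [← h2]; simpa [Ideal.mem_iInf] using h
  simp at h3

end MonomialIdeal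

/-! ### Coefficients and expansions in the completion -/

section Coefficients

open AddMonoidAlgebra

variable {M : Type*} [AddCommGroup M] {Λ : AddSubmonoid M}

theorem coeff_eq_of_mk_eq (hzero : ∀ u ∈ Λ, -u ∈ Λ → u = 0) {k : ℕ} {p q : AddMonoidAlgebra ℂ Λ}
    (h : Ideal.Quotient.mk (orbitMaximalIdeal Λ ^ k) p = Ideal.Quotient.mk _ q) {u : Λ}
    (hu : single u (1 : ℂ) ∉ orbitMaximalIdeal Λ ^ k) : p.coeff u = q.coeff u := by
  rw [Ideal.Quotient.eq] at h
  by_contra hne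
  exact hu (single_mem_pow_of_coeff_ne_zero hzero h (by simpa [sub_eq_zero] using hne))

theorem evalₐ_eq_mk_of_le {j k : ℕ} (hjk : j ≤ k) {φ : AnalyticAlgebra Λ}
    {p : AddMonoidAlgebra ℂ Λ}
    (h : AdicCompletion.evalₐ (orbitMaximalIdeal Λ) k φ = Ideal.Quotient.mk _ p) :
    AdicCompletion.evalₐ (orbitMaximalIdeal Λ) j φ = Ideal.Quotient.mk _ p := by
  induction φ using AdicCompletion.induction_on with
  | _ f =>
    rw [AdicCompletion.evalₐ_mk] at h ⊢
    rw [← AdicCompletion.Ideal.mk_eq_mk _ hjk]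
    rw [Ideal.Quotient.eq] at h ⊢
    exact Ideal.pow_le_pow_right hjk h

theorem exists_evalₐ_eq_mk (k : ℕ) (φ : AnalyticAlgebra Λ) : ∃ p : AddMonoidAlgebra ℂ Λ,
    AdicCompletion.evalₐ (orbitMaximalIdeal Λ) k φ = Ideal.Quotient.mk _ p :=
  (Ideal.Quotient.mk_surjective _).imp fun _ h => h.symm

/-- The coefficient of `X^u` in the expansion of an element of the analytic algebra. -/
noncomputable def serCoeff (φ : AnalyticAlgebra Λ) (u : Λ) : ℂ :=
  open Classical in
  -- Any k with X^u ∉ 𝔪^k gives the same value when Λ is pointed. The value 0 is a default, not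
  -- reached under the standing hypotheses when M is free.
  if h : ∃ k, single u (1 : ℂ) ∉ orbitMaximalIdeal Λ ^ k then
    (exists_evalₐ_eq_mk (Nat.find h) φ).choose.coeff u
  else 0

/-- The standing hypotheses on the semigroup `Λ`. -/
structure IsGermSemigroup (Λ : AddSubmonoid M) : Prop where
  fg : Λ.FG
  closure_eq_top : AddSubgroup.closure (Λ : Set M) = ⊤
  pointed : ∀ u ∈ Λ, -u ∈ Λ → u = 0

/-- A polynomial representing φ modulo 𝔪^k also represents it modulo the smaller power used in the
definition, and congruent polynomials agree at exponents outside a monomial ideal. -/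
theorem serCoeff_eq (hΛ : IsGermSemigroup Λ) {k : ℕ} {u : Λ}
    (hu : single u (1 : ℂ) ∉ orbitMaximalIdeal Λ ^ k) {φ : AnalyticAlgebra Λ}
    {p : AddMonoidAlgebra ℂ Λ}
    (h : AdicCompletion.evalₐ (orbitMaximalIdeal Λ) k φ = Ideal.Quotient.mk _ p) :
    serCoeff φ u = p.coeff u := by
  classical
  have hex : ∃ k, single u (1 : ℂ) ∉ orbitMaximalIdeal Λ ^ k := ⟨k, hu⟩
  rw [serCoeff, dif_pos hex]
  refine coeff_eq_of_mk_eq hΛ.pointed ?_ (Nat.find_spec hex)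
  rw [← (exists_evalₐ_eq_mk (Nat.find hex) φ).choose_spec]
  exact evalₐ_eq_mk_of_le (Nat.find_min' hex hu) h

/-- The coefficient of `X^u` in a product only depends on the factors modulo a power of `𝔪_Λ`. -/
theorem serCoeff_mul_eq (hΛ : IsGermSemigroup Λ) {k : ℕ} {u : Λ}
    (hu : single u (1 : ℂ) ∉ orbitMaximalIdeal Λ ^ k) {φ ψ : AnalyticAlgebra Λ}
    {p q : AddMonoidAlgebra ℂ Λ}
    (hp : AdicCompletion.evalₐ (orbitMaximalIdeal Λ) k φ = Ideal.Quotient.mk _ p)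
    (hq : AdicCompletion.evalₐ (orbitMaximalIdeal Λ) k ψ = Ideal.Quotient.mk _ q) :
    serCoeff (φ * ψ) u = (p * q).coeff u :=
  serCoeff_eq hΛ hu (by rw [map_mul, hp, hq, map_mul])

theorem evalₐ_eq_mk_iff (hΛ : IsGermSemigroup Λ) {k : ℕ} {φ : AnalyticAlgebra Λ}
    {p : AddMonoidAlgebra ℂ Λ} :
    AdicCompletion.evalₐ (orbitMaximalIdeal Λ) k φ = Ideal.Quotient.mk _ p ↔
      ∀ u, single u (1 : ℂ) ∉ orbitMaximalIdeal Λ ^ k → p.coeff u = serCoeff φ u := by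
  refine ⟨fun h u hu => (serCoeff_eq hΛ hu h).symm, fun h => ?_⟩
  obtain ⟨q, hq⟩ := exists_evalₐ_eq_mk k φ
  rw [hq, Ideal.Quotient.eq]
  refine mem_pow_of_support fun u hu => ?_
  by_contra hmem
  rw [coeff_sub, Finsupp.sub_apply, h u hmem, serCoeff_eq hΛ hmem hq, sub_self] at hu
  exact hu rfl

theorem coeff_sum_single (s : Finset Λ) (c : Λ → ℂ) (u : Λ) :
    (∑ v ∈ s, single v (c v)).coeff u = open Classical in if u ∈ s then c u else 0 := by
  classical
  simp [Finsupp.finsetSum_apply, Finsupp.single_apply]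

/-- The monomial `X^u` of the analytic algebra. -/
noncomputable def monomial (u : Λ) : AnalyticAlgebra Λ :=
  AdicCompletion.of (orbitMaximalIdeal Λ) _ (single u 1)

theorem algebraMap_eq_of (p : AddMonoidAlgebra ℂ Λ) :
    algebraMap _ (AnalyticAlgebra Λ) p = AdicCompletion.of (orbitMaximalIdeal Λ) _ p := rfl

theorem monomial_add (u v : Λ) : (monomial (u + v) : AnalyticAlgebra Λ) = monomial u * monomial v := by
  simp only [monomial, ← algebraMap_eq_of, ← map_mul]
  simp

theorem monomial_zero : (monomial 0 : AnalyticAlgebra Λ) = 1 := by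
  simp only [monomial, ← algebraMap_eq_of]
  exact map_one _

theorem of_single_eq (u : Λ) (z : ℂ) :
    (AdicCompletion.of (orbitMaximalIdeal Λ) _ (single u z) : AnalyticAlgebra Λ) =
      algebraMap ℂ (AnalyticAlgebra Λ) z * monomial u := by
  rw [AdicCompletion.algebraMap_apply, monomial, ← algebraMap_eq_of, ← algebraMap_eq_of,
    ← algebraMap_eq_of, ← map_mul]
  simp

theorem serCoeff_ext (hΛ : IsGermSemigroup Λ) {φ ψ : AnalyticAlgebra Λ}
    (h : ∀ u, serCoeff φ u = serCoeff ψ u) : φ = ψ := by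
  refine AdicCompletion.ext_evalₐ fun k => ?_
  obtain ⟨q, hq⟩ := exists_evalₐ_eq_mk k ψ
  rw [hq, evalₐ_eq_mk_iff hΛ]
  intro u hu
  rw [h, serCoeff_eq hΛ hu hq]

/-- Since 𝔪 is finitely generated, the kernel of the projection of R to ℂ[Λ]/𝔪^k is 𝔪^k R. This
turns a truncation error into an algebraic membership that valuations can see. -/
theorem mem_map_pow_of_evalₐ_eq_zero (hΛ : IsGermSemigroup Λ) {k : ℕ} {φ : AnalyticAlgebra Λ}
    (h : AdicCompletion.evalₐ (orbitMaximalIdeal Λ) k φ = 0) :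
    φ ∈ (orbitMaximalIdeal Λ ^ k).map (algebraMap _ (AnalyticAlgebra Λ)) := by
  have := isNoetherianRing_algebra hΛ.fg
  have hk := AdicCompletion.pow_smul_top_eq_ker_eval (M := AddMonoidAlgebra ℂ Λ) (n := k)
    (IsNoetherian.noetherian (orbitMaximalIdeal Λ))
  have h2 : AdicCompletion.eval (orbitMaximalIdeal Λ) (AddMonoidAlgebra ℂ Λ) k φ = 0 := by
    rw [← AdicCompletion.factor_evalₐ_eq_eval _ φ (by simp), h, map_zero]
  have h3 : φ ∈ (orbitMaximalIdeal Λ ^ k • ⊤ : Submodule (AddMonoidAlgebra ℂ Λ)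
      (AnalyticAlgebra Λ)) := by
    rw [hk]; exact h2
  rw [Ideal.smul_top_eq_map] at h3
  exact h3

/-- R is complete for the 𝔪R-adic topology, so 𝔪R lies in its Jacobson radical. -/
theorem monomial_mem_jacobson (hΛ : IsGermSemigroup Λ) {u : Λ} (hu : u ≠ 0) :
    (monomial u : AnalyticAlgebra Λ) ∈ (⊥ : Ideal (AnalyticAlgebra Λ)).jacobson := by
  have := isNoetherianRing_algebra hΛ.fg
  have := AdicCompletion.isAdicComplete_self (orbitMaximalIdeal Λ)
    (IsNoetherian.noetherian (orbitMaximalIdeal Λ))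
  exact IsAdicComplete.le_jacobson_bot
    ((orbitMaximalIdeal Λ).map (algebraMap _ (AnalyticAlgebra Λ)))
    (Ideal.mem_map_of_mem _ (single_mem_orbitMaximalIdeal hu 1))

variable [Module.Free ℤ M]

theorem serCoeff_of (hΛ : IsGermSemigroup Λ) (p : AddMonoidAlgebra ℂ Λ) (u : Λ) :
    serCoeff (AdicCompletion.of (orbitMaximalIdeal Λ) _ p) u = p.coeff u := by
  obtain ⟨k, hk⟩ := exists_single_notMem_pow hΛ.fg hΛ.pointed u
  exact serCoeff_eq hΛ hk (by simp)

theorem serCoeff_add (hΛ : IsGermSemigroup Λ) (φ ψ : AnalyticAlgebra Λ) (u : Λ) :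
    serCoeff (φ + ψ) u = serCoeff φ u + serCoeff ψ u := by
  obtain ⟨k, hk⟩ := exists_single_notMem_pow hΛ.fg hΛ.pointed u
  obtain ⟨p, hp⟩ := exists_evalₐ_eq_mk k φ
  obtain ⟨q, hq⟩ := exists_evalₐ_eq_mk k ψ
  rw [serCoeff_eq hΛ hk hp, serCoeff_eq hΛ hk hq,
    serCoeff_eq hΛ hk (p := p + q) (by rw [map_add, hp, hq, map_add])]
  simp

theorem serCoeff_zero (hΛ : IsGermSemigroup Λ) (u : Λ) :
    serCoeff (0 : AnalyticAlgebra Λ) u = 0 := by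
  simpa using serCoeff_add hΛ 0 0 u

theorem serCoeff_sub (hΛ : IsGermSemigroup Λ) (φ ψ : AnalyticAlgebra Λ) (u : Λ) :
    serCoeff (φ - ψ) u = serCoeff φ u - serCoeff ψ u := by
  rw [eq_sub_iff_add_eq, ← serCoeff_add hΛ, sub_add_cancel]

theorem exists_serCoeff_eq (hΛ : IsGermSemigroup Λ) (c : Λ → ℂ) :
    ∃ φ : AnalyticAlgebra Λ, ∀ u, serCoeff φ u = c u := by
  classical
  -- The truncations of the formal sum to the finitely many exponents with X^u ∉ 𝔪^k form a Cauchy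
  -- sequence.
  let T : ℕ → Finset Λ := fun k => (finite_setOf_single_notMem_pow hΛ.fg k).toFinset
  have hT : ∀ k u, u ∈ T k ↔ single u (1 : ℂ) ∉ orbitMaximalIdeal Λ ^ k := fun k u => by
    simp [T]
  let f : AdicCompletion.AdicCauchySequence (orbitMaximalIdeal Λ) (AddMonoidAlgebra ℂ Λ) :=
    AdicCompletion.AdicCauchySequence.mk _ _ (fun k => ∑ v ∈ T k, single v (c v)) (by
      intro k
      rw [SModEq.sub_mem, smul_eq_mul, Ideal.mul_top]
      refine mem_pow_of_support fun u hu => ?_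
      by_contra hmem
      have h2 : single u (1 : ℂ) ∉ orbitMaximalIdeal Λ ^ (k + 1) := fun h =>
        hmem (Ideal.pow_le_pow_right k.le_succ h)
      rw [coeff_sub, Finsupp.sub_apply, coeff_sum_single, coeff_sum_single,
        if_pos ((hT _ _).2 hmem), if_pos ((hT _ _).2 h2), sub_self] at hu
      exact hu rfl)
  refine ⟨AdicCompletion.mk _ _ f, fun u => ?_⟩
  obtain ⟨k, hk⟩ := exists_single_notMem_pow hΛ.fg hΛ.pointed u
  rw [serCoeff_eq hΛ hk (AdicCompletion.evalₐ_mk _ k f)]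
  change (∑ v ∈ T k, single v (c v)).coeff u = _
  rw [coeff_sum_single, if_pos ((hT _ _).2 hk)]

theorem hasExpansion_iff (hΛ : IsGermSemigroup Λ) {φ : AnalyticAlgebra Λ} {c : Λ → ℂ} :
    HasExpansion Λ φ c ↔ ∀ u, c u = serCoeff φ u := by
  classical
  constructor
  · intro h u
    obtain ⟨k, hk⟩ := exists_single_notMem_pow hΛ.fg hΛ.pointed u
    obtain ⟨s₀, hs⟩ := h k
    rw [serCoeff_eq hΛ hk (hs (insert u s₀) (Finset.subset_insert _ _)), coeff_sum_single,
      if_pos (Finset.mem_insert_self _ _)]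
  · intro h k
    refine ⟨(finite_setOf_single_notMem_pow hΛ.fg k).toFinset, fun s hs => ?_⟩
    rw [evalₐ_eq_mk_iff hΛ]
    intro u hu
    rw [coeff_sum_single, if_pos (hs (by simpa using hu)), h]

theorem existsUnique_hasExpansion (hΛ : IsGermSemigroup Λ) (φ : AnalyticAlgebra Λ) :
    ∃! c : Λ → ℂ, HasExpansion Λ φ c :=
  ⟨serCoeff φ, (hasExpansion_iff hΛ).2 fun _ => rfl,
    fun _ hc => funext ((hasExpansion_iff hΛ).1 hc)⟩

theorem serCoeff_monomial (hΛ : IsGermSemigroup Λ) (u v : Λ) :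
    serCoeff (monomial u) v = open Classical in if u = v then 1 else 0 := by
  classical
  rw [monomial, serCoeff_of hΛ, coeff_single, Finsupp.single_apply]

theorem monomial_ne_zero (hΛ : IsGermSemigroup Λ) (u : Λ) : (monomial u : AnalyticAlgebra Λ) ≠ 0 := by
  intro h
  have := serCoeff_monomial hΛ u u
  rw [h, serCoeff_zero hΛ] at this
  simp at this

end Coefficients

/-! ### The saturation of Λ: multiples, conductor, closedness -/

section Saturation

variable {M : Type*} [AddCommGroup M] {Λ : AddSubmonoid M}

theorem latticePoint_zero : latticePoint (0 : M) = 0 := TensorProduct.tmul_zero _ _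

theorem latticePoint_add (u v : M) : latticePoint (u + v) = latticePoint u + latticePoint v :=
  TensorProduct.tmul_add _ _ _

theorem latticePoint_nsmul (k : ℕ) (u : M) : latticePoint (k • u) = (k : ℝ) • latticePoint u := by
  induction k with
  | zero => simp [latticePoint_zero]
  | succ k ih => rw [succ_nsmul, latticePoint_add, ih, Nat.cast_succ, add_smul, one_smul]

theorem latticePoint_neg (u : M) : latticePoint (-u) = -latticePoint u :=
  TensorProduct.tmul_neg _ _

theorem latticePoint_mem_supportCone {u : M} (hu : u ∈ Λ) : latticePoint u ∈ supportCone Λ :=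
  Submodule.subset_span ⟨u, hu, rfl⟩

theorem mem_saturation_of_mem {u : M} (hu : u ∈ Λ) : u ∈ saturation Λ :=
  latticePoint_mem_supportCone hu

theorem add_mem_saturation {u v : M} (hu : u ∈ saturation Λ) (hv : v ∈ saturation Λ) :
    u + v ∈ saturation Λ := by
  change latticePoint (u + v) ∈ supportCone Λ
  rw [latticePoint_add]
  exact add_mem hu hv

theorem mem_saturation_of_nsmul_mem {k : ℕ} (hk : 0 < k) {w : M} (hw : k • w ∈ Λ) :
    w ∈ saturation Λ := by
  have h := Submodule.smul_mem (supportCone Λ) (⟨(k : ℝ)⁻¹, by positivity⟩ : {c : ℝ // 0 ≤ c})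
    (latticePoint_mem_supportCone hw)
  rw [latticePoint_nsmul] at h
  change (k : ℝ)⁻¹ • (k : ℝ) • latticePoint w ∈ _ at h
  rwa [smul_smul, inv_mul_cancel₀ (by positivity), one_smul] at h

theorem mem_dualConeRho_iff {η : Module.Dual ℝ (ℝ ⊗[ℤ] M)} :
    η ∈ dualConeRho Λ ↔ ∀ u ∈ Λ, 0 ≤ η (latticePoint u) := by
  refine ⟨fun h u hu => h _ (latticePoint_mem_supportCone hu), fun h v hv => ?_⟩
  induction hv using Submodule.span_induction with
  | mem x hx => obtain ⟨u, hu, rfl⟩ := hx; exact h u hu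
  | zero => simp
  | add x y _ _ hx hy => rw [map_add]; exact add_nonneg hx hy
  | smul a x _ hx =>
    have : a • x = (a : ℝ) • x := rfl
    rw [this, map_smul]
    exact mul_nonneg a.2 hx

theorem exists_nsmul_sum_eq {S : Finset M} (hS : AddSubmonoid.closure (S : Set M) = Λ) {u : M}
    (hu : u ∈ Λ) : ∃ f : S → ℕ, u = ∑ s, f s • (s : M) := by
  rw [← hS, AddSubmonoid.mem_closure_finset] at hu
  obtain ⟨f, -, hf⟩ := hu
  exact ⟨fun s => f s, by rw [← hf, ← Finset.sum_coe_sort]⟩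

theorem nsmul_sum_mem {S : Finset M} (hS : AddSubmonoid.closure (S : Set M) = Λ) (f : S → ℕ) :
    ∑ s, f s • (s : M) ∈ Λ :=
  sum_mem fun s _ => nsmul_mem (hS ▸ AddSubmonoid.subset_closure s.2) _

/-- A consequence of Dickson's lemma. -/
theorem exists_nsmul_mem_of_forall_add_nsmul_mem (hfg : Λ.FG) {d w : M}
    (h : ∀ m : ℕ, d + m • w ∈ Λ) : ∃ k, 0 < k ∧ k • w ∈ Λ := by
  obtain ⟨S, hS⟩ := hfg
  choose f hf using fun m => exists_nsmul_sum_eq hS (h m)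
  -- By Dickson's lemma two of the vectors of generator multiplicities are comparable. Their
  -- difference is a non-negative combination of generators equal to (j - i)w.
  obtain ⟨i, j, hij, hle⟩ := wellQuasiOrdered_le (α := S → ℕ) f
  refine ⟨j - i, by omega, ?_⟩
  have e : (j - i) • w = ∑ s, (f j s - f i s) • (s : M) := by
    have h1 : j • w = (j - i) • w + i • w := by rw [← add_nsmul]; congr 1; omega
    have h2 : ∑ s, f j s • (s : M) = ∑ s, (f j s - f i s) • (s : M) + ∑ s, f i s • (s : M) := by
      rw [← Finset.sum_add_distrib]
      refine Finset.sum_congr rfl fun s _ => ?_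
      rw [← add_nsmul, Nat.sub_add_cancel (hle s)]
    rw [← hf i, ← hf j, h1, ← add_assoc] at h2
    refine add_left_cancel (a := d + i • w) ?_
    rw [add_comm (d + i • w) (∑ s, _), ← h2]
    abel
  rw [e]
  exact nsmul_sum_mem hS _

theorem exists_sub_eq (hgen : AddSubgroup.closure (Λ : Set M) = ⊤) (w : M) :
    ∃ u ∈ Λ, ∃ v ∈ Λ, w = u - v := by
  have hw : w ∈ AddSubgroup.closure (Λ : Set M) := hgen ▸ AddSubgroup.mem_top w
  induction hw using AddSubgroup.closure_induction with
  | mem x hx => exact ⟨x, hx, 0, zero_mem _, by simp⟩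
  | zero => exact ⟨0, zero_mem _, 0, zero_mem _, by simp⟩
  | add x y _ _ hx hy =>
    obtain ⟨u, hu, v, hv, rfl⟩ := hx
    obtain ⟨u', hu', v', hv', rfl⟩ := hy
    exact ⟨u + u', add_mem hu hu', v + v', add_mem hv hv', by abel⟩
  | neg x _ hx =>
    obtain ⟨u, hu, v, hv, rfl⟩ := hx
    exact ⟨v, hv, u, hu, by abel⟩

theorem exists_real_sum_eq {S : Finset M} (hS : AddSubmonoid.closure (S : Set M) = Λ) {w : M}
    (hw : w ∈ saturation Λ) :
    ∃ a : S → ℝ, (∀ s, 0 ≤ a s) ∧ latticePoint w = ∑ s, a s • latticePoint (s : M) := by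
  have key : ∀ v ∈ supportCone Λ,
      ∃ a : S → ℝ, (∀ s, 0 ≤ a s) ∧ v = ∑ s, a s • latticePoint (s : M) := by
    intro v hv
    induction hv using Submodule.span_induction with
    | mem x hx =>
      obtain ⟨u, hu, rfl⟩ := hx
      obtain ⟨f, rfl⟩ := exists_nsmul_sum_eq hS hu
      refine ⟨fun s => f s, fun s => Nat.cast_nonneg _, ?_⟩
      simp only [← latticePoint_nsmul]
      exact TensorProduct.tmul_sum _ _ _
    | zero => exact ⟨0, fun _ => le_rfl, by simp⟩
    | add x y _ _ hx hy =>
      obtain ⟨a, ha, rfl⟩ := hx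
      obtain ⟨b, hb, rfl⟩ := hy
      exact ⟨a + b, fun s => add_nonneg (ha s) (hb s), by
        simp [add_smul, Finset.sum_add_distrib]⟩
    | smul c x _ hx =>
      obtain ⟨a, ha, rfl⟩ := hx
      refine ⟨fun s => c * a s, fun s => mul_nonneg c.2 (ha s), ?_⟩
      change (c : ℝ) • (∑ s, a s • latticePoint (s : M)) = _
      simp [Finset.smul_sum, mul_smul]
  exact key _ hw

theorem baseChange_latticePoint (n : Module.Dual ℤ M) (u : M) :
    (n.baseChange ℝ) (latticePoint u) = n u := by
  simp [latticePoint, Module.Dual.baseChange]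

/-- Finitely many elements of the lattice can be translated into `Λ`. -/
theorem exists_add_mem (hΛ : IsGermSemigroup Λ) (s : Finset M) : ∃ e ∈ Λ, ∀ w ∈ s, e + w ∈ Λ := by
  classical
  induction s using Finset.induction_on with
  | empty => exact ⟨0, zero_mem _, by simp⟩
  | insert w s _ ih =>
    obtain ⟨e, he, h⟩ := ih
    obtain ⟨u, hu, v, hv, rfl⟩ := exists_sub_eq hΛ.closure_eq_top w
    refine ⟨e + v, add_mem he hv, fun x hx => ?_⟩
    rcases Finset.mem_insert.1 hx with rfl | hx
    · rw [show e + v + (u - v) = e + u by abel]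
      exact add_mem he hu
    · rw [add_right_comm]
      exact add_mem (h x hx) hv

variable [Module.Free ℤ M] [Module.Finite ℤ M]

/-- Every coordinate in a lattice basis is bounded by the sum of the absolute values of that
coordinate over the generators, which leaves finitely many lattice points. -/
theorem finite_latticePoint_box (S : Finset M) :
    {x : M | ∃ a : S → ℝ, (∀ s, 0 ≤ a s ∧ a s ≤ 1) ∧
      latticePoint x = ∑ s, a s • latticePoint (s : M)}.Finite := by
  let b := Module.finBasis ℤ M
  let B : Fin (Module.finrank ℤ M) → ℤ := fun i => ∑ s ∈ S, |b.equivFun s i|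
  refine ((Set.finite_Icc (-B) B).preimage b.equivFun.injective.injOn).subset ?_
  rintro x ⟨a, ha, hx⟩
  have hb : ∀ i, |b.equivFun x i| ≤ B i := by
    intro i
    have h := congrArg (Module.Dual.baseChange ℝ (b.coord i)) hx
    simp only [map_sum, map_smul, baseChange_latticePoint] at h
    have h2 : |((b.coord i x : ℤ) : ℝ)| ≤ ∑ s : S, |((b.coord i (s : M) : ℤ) : ℝ)| := by
      rw [h]
      refine (Finset.abs_sum_le_sum_abs _ _).trans (Finset.sum_le_sum fun s _ => ?_)
      rw [smul_eq_mul, abs_mul, abs_of_nonneg (ha s).1]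
      exact mul_le_of_le_one_left (abs_nonneg _) (ha s).2
    rw [Finset.sum_coe_sort S (fun s => |((b.coord i s : ℤ) : ℝ)|)] at h2
    exact_mod_cast h2
  exact ⟨fun i => (abs_le.1 (hb i)).1, fun i => (abs_le.1 (hb i)).2⟩

/-- The semigroup `Λ` contains a translate of its saturation. -/
theorem exists_conductor (hΛ : IsGermSemigroup Λ) :
    ∃ e ∈ Λ, ∀ w ∈ saturation Λ, e + w ∈ Λ := by
  classical
  obtain ⟨S, hS⟩ := hΛ.fg
  have hE := finite_latticePoint_box S
  set E := {x : M | ∃ a : S → ℝ, (∀ s, 0 ≤ a s ∧ a s ≤ 1) ∧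
      latticePoint x = ∑ s, a s • latticePoint (s : M)} with hEdef
  choose f hf g hg hfg using exists_sub_eq hΛ.closure_eq_top
  refine ⟨∑ x ∈ hE.toFinset, g x, sum_mem fun x _ => hg x, fun w hw => ?_⟩
  obtain ⟨a, ha, haw⟩ := exists_real_sum_eq hS hw
  -- Integer part of a real non-negative combination representing w. It lies in Λ, and w - l falls
  -- in the finite box, where the chosen differences f x - g x apply.
  let l : M := ∑ s, ⌊a s⌋₊ • (s : M)
  have hl : l ∈ Λ := nsmul_sum_mem hS _
  have hx : w - l ∈ E := by
    refine ⟨fun s => a s - ⌊a s⌋₊, fun s => ⟨sub_nonneg.2 (Nat.floor_le (ha s)), ?_⟩, ?_⟩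
    · linarith [Nat.lt_floor_add_one (a s)]
    · rw [sub_eq_add_neg, latticePoint_add, latticePoint_neg, haw]
      have : latticePoint l = ∑ s : S, ((⌊a s⌋₊ : ℕ) : ℝ) • latticePoint (s : M) := by
        simp only [← latticePoint_nsmul]
        exact TensorProduct.tmul_sum _ _ _
      rw [this, ← sub_eq_add_neg, ← Finset.sum_sub_distrib]
      simp only [sub_smul]
  rw [← Finset.sum_erase_add _ _ (hE.mem_toFinset.2 hx)]
  have e : ∑ x ∈ hE.toFinset.erase (w - l), g x + g (w - l) + w =
      ∑ x ∈ hE.toFinset.erase (w - l), g x + f (w - l) + l := by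
    have := hfg (w - l)
    rw [eq_sub_iff_add_eq] at this
    rw [← this]; abel
  rw [e]
  exact add_mem (add_mem (sum_mem fun x _ => hg x) (hf _)) hl

/-- All multiples of w stay in the saturation, so the conductor e gives e + mw ∈ Λ for every m, and
Dickson's lemma applies. -/
theorem exists_nsmul_mem_of_mem_saturation (hΛ : IsGermSemigroup Λ) {w : M}
    (hw : w ∈ saturation Λ) : ∃ k, 0 < k ∧ k • w ∈ Λ := by
  obtain ⟨e, -, h⟩ := exists_conductor hΛ
  refine exists_nsmul_mem_of_forall_add_nsmul_mem hΛ.fg (d := e) fun m => h _ ?_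
  induction m with
  | zero => simpa using mem_saturation_of_mem (zero_mem Λ)
  | succ m ih => rw [succ_nsmul]; exact add_mem_saturation ih hw

/-- An algebraic substitute for the closedness of the cone: translating by the conductor reduces it
to Dickson's lemma in Λ. It is the condition on exponents that makes a ring of Hahn series
completely integrally closed. -/
theorem mem_saturation_of_forall_add_nsmul_mem (hΛ : IsGermSemigroup Λ) {d w : M}
    (h : ∀ m : ℕ, d + m • w ∈ saturation Λ) : w ∈ saturation Λ := by
  obtain ⟨e, -, he⟩ := exists_conductor hΛ
  obtain ⟨k, hk, hkw⟩ := exists_nsmul_mem_of_forall_add_nsmul_mem hΛ.fg (d := e + d) (w := w)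
    fun m => by rw [add_assoc]; exact he _ (h m)
  exact mem_saturation_of_nsmul_mem hk hkw

end Saturation

/-! ### Hahn series supported on a submonoid, and complete integral closedness -/

section HahnSupport

variable {Γ : Type*} [AddCommGroup Γ] [LinearOrder Γ] [IsOrderedAddMonoid Γ]

theorem exists_add_of_hahn_coeff_mul_ne_zero {x y : HahnSeries Γ ℂ} {g : Γ}
    (h : (x * y).coeff g ≠ 0) : ∃ a b, a + b = g ∧ x.coeff a ≠ 0 ∧ y.coeff b ≠ 0 := by
  obtain ⟨a, ha, b, hb, e⟩ := HahnSeries.support_mul_subset (show g ∈ (x * y).support from h)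
  exact ⟨a, b, e, ha, hb⟩

/-- The ring of the Hahn series with support in a submonoid of the group of exponents. -/
def supportedOn (S : AddSubmonoid Γ) : Subring (HahnSeries Γ ℂ) where
  carrier := {x | ∀ g, x.coeff g ≠ 0 → g ∈ S}
  mul_mem' := fun hx hy g hg => by
    obtain ⟨a, b, rfl, ha, hb⟩ := exists_add_of_hahn_coeff_mul_ne_zero hg
    exact add_mem (hx a ha) (hy b hb)
  one_mem' := fun g hg => by
    rw [HahnSeries.coeff_one] at hg
    by_cases h : g = 0
    · exact h ▸ zero_mem S
    · simp [h] at hg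
  add_mem' := fun {x y} hx hy g hg => by
    by_cases h : x.coeff g = 0
    · exact hy g (by simpa [h] using hg)
    · exact hx g h
  zero_mem' := fun g hg => by simp at hg
  neg_mem' := fun {x} hx g hg => hx g (by simpa using hg)

/-- The support is well ordered, so there is a least exponent outside S. The terms before it are
supported on S, and y is the remaining tail. -/
theorem exists_sub_mem_supportedOn {S : AddSubmonoid Γ} {x : HahnSeries Γ ℂ}
    (hx : x ∉ supportedOn S) :
    ∃ y, x - y ∈ supportedOn S ∧ y ≠ 0 ∧ y.order ∉ S := by
  have hne : ({g | x.coeff g ≠ 0 ∧ g ∉ S} : Set Γ).Nonempty := by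
    by_contra h
    refine hx fun g hg => ?_
    by_contra hgS
    exact h ⟨g, hg, hgS⟩
  have hwf : ({g | x.coeff g ≠ 0 ∧ g ∉ S} : Set Γ).IsWF :=
    x.isWF_support.mono fun g hg => hg.1
  obtain ⟨hw, hwS⟩ := hwf.min_mem hne
  have hmin : ∀ g, x.coeff g ≠ 0 → g ∉ S → hwf.min hne ≤ g := fun g h h' =>
    hwf.min_le hne ⟨h, h'⟩
  generalize hwf.min hne = w at hw hwS hmin
  have hyw : (x - HahnSeries.truncLT w x).coeff w ≠ 0 := by
    simpa [HahnSeries.coeff_truncLT] using hw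
  have hy : x - HahnSeries.truncLT w x ≠ 0 := fun h => hyw (by rw [h]; rfl)
  refine ⟨x - HahnSeries.truncLT w x, ?_, hy, ?_⟩
  · rw [sub_sub_cancel]
    intro g hg
    rw [HahnSeries.coeff_truncLT] at hg
    by_cases h : g < w
    · rw [if_pos h] at hg
      by_contra hgS
      exact absurd (hmin g hg hgS) (not_le.2 h)
    · rw [if_neg h] at hg; exact absurd rfl hg
  · have : (x - HahnSeries.truncLT w x).order = w := by
      refine le_antisymm (HahnSeries.order_le_of_coeff_ne_zero hyw) (not_lt.1 fun h => ?_)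
      refine hy (HahnSeries.coeff_order_eq_zero.1 ?_)
      rw [HahnSeries.coeff_sub, HahnSeries.coeff_truncLT, if_pos h, sub_self]
    rwa [this]

/-- The ring of the Hahn series with support in a saturated submonoid is completely integrally
closed. -/
theorem mem_supportedOn_of_isAlmostIntegral {S : AddSubmonoid Γ}
    (hS : ∀ d w, (∀ m : ℕ, d + m • w ∈ S) → w ∈ S) {x : HahnSeries Γ ℂ}
    (hx : IsAlmostIntegral (supportedOn S) x) : x ∈ supportedOn S := by
  by_contra hxS
  obtain ⟨y, hxy, hy, hyS⟩ := exists_sub_mem_supportedOn hxS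
  -- The complete integral closure is a ring, so the tail y remains almost integral after the good
  -- part of x is removed.
  have h : y ∈ completeIntegralClosure (supportedOn S) (HahnSeries Γ ℂ) := by
    have := sub_mem (show x ∈ completeIntegralClosure (supportedOn S) _ from hx)
      (Subalgebra.algebraMap_mem _ (⟨x - y, hxy⟩ : supportedOn S))
    change x - (x - y) ∈ _ at this
    rwa [sub_sub_cancel] at this
  obtain ⟨r, hr, hry⟩ := h
  have hr0 : (r : HahnSeries Γ ℂ) ≠ 0 := fun h => nonZeroDivisors.ne_zero hr (Subtype.ext h)
  -- The series r * y ^ m are supported on S, so ord r + m ord y ∈ S for all m. The hypothesis on S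
  -- then puts ord y in S.
  refine hyS (hS (r : HahnSeries Γ ℂ).order _ fun m => ?_)
  obtain ⟨z, hz⟩ := hry m
  have hz' : (z : HahnSeries Γ ℂ) = r * y ^ m := hz
  have := z.2 (r * y ^ m : HahnSeries Γ ℂ).order (by
    rw [hz', ne_eq, HahnSeries.coeff_order_eq_zero]
    exact mul_ne_zero hr0 (pow_ne_zero _ hy))
  rwa [HahnSeries.order_mul hr0 (pow_ne_zero _ hy), HahnSeries.order_pow] at this

end HahnSupport

/-! ### The embedding of K in a field of Hahn series -/

section Embedding

open AddMonoidAlgebra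

variable {M : Type*} [AddCommGroup M] {Λ : AddSubmonoid M}
variable {Γ : Type*} [AddCommGroup Γ] [LinearOrder Γ] [IsOrderedAddMonoid Γ] {ι : M →+ Γ}

/-- An embedding of the lattice in a linearly ordered group, positive on `Λ - {0}`. -/
structure IsPositiveEmbedding (Λ : AddSubmonoid M) (ι : M →+ Γ) : Prop where
  injective : Function.Injective ι
  pos : ∀ u ∈ Λ, u ≠ 0 → 0 < ι u

/-- The image is generated by finitely many non-negative elements, and the submonoid generated by a
partially well ordered set of non-negative elements is partially well ordered. -/
theorem isPWO_range (hfg : Λ.FG) (hι : IsPositiveEmbedding Λ ι) :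
    (Set.range fun u : Λ => ι u).IsPWO := by
  obtain ⟨S, hS⟩ := hfg
  have h : (AddSubmonoid.closure (ι '' S) : Set Γ).IsPWO := by
    refine Set.IsPWO.addSubmonoid_closure ?_ (S.finite_toSet.image ι).isPWO
    rintro _ ⟨s, hs, rfl⟩
    by_cases h0 : s = 0
    · simp [h0]
    · exact (hι.pos s (hS ▸ AddSubmonoid.subset_closure hs) h0).le
  refine h.mono ?_
  rintro _ ⟨u, rfl⟩
  rw [← AddMonoidHom.map_mclosure, hS]
  exact ⟨u, u.2, rfl⟩

/-- The expansion of an element of the analytic algebra, as a Hahn series. -/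
noncomputable def hahnExpansion (hΛ : IsGermSemigroup Λ) (hι : IsPositiveEmbedding Λ ι)
    (φ : AnalyticAlgebra Λ) : HahnSeries Γ ℂ where
  coeff := Function.extend (fun u : Λ => ι u) (serCoeff φ) 0
  isPWO_support' := (isPWO_range hΛ.fg hι).mono fun g hg => by
    by_contra h
    exact hg (Function.extend_apply' _ _ _ h)

theorem exists_of_hahnExpansion_coeff_ne_zero (hΛ : IsGermSemigroup Λ)
    (hι : IsPositiveEmbedding Λ ι) {φ : AnalyticAlgebra Λ} {g : Γ}
    (h : (hahnExpansion hΛ hι φ).coeff g ≠ 0) : ∃ u : Λ, ι u = g := by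
  by_contra h'
  exact h (Function.extend_apply' _ _ _ h')

theorem hahnExpansion_coeff (hΛ : IsGermSemigroup Λ) (hι : IsPositiveEmbedding Λ ι)
    (φ : AnalyticAlgebra Λ) (u : Λ) : (hahnExpansion hΛ hι φ).coeff (ι u) = serCoeff φ u :=
  (hι.injective.comp Subtype.val_injective).extend_apply _ _ u

theorem eq_hahnExpansion (hΛ : IsGermSemigroup Λ) (hι : IsPositiveEmbedding Λ ι)
    {x : HahnSeries Γ ℂ} {φ : AnalyticAlgebra Λ} (h₁ : ∀ g, x.coeff g ≠ 0 → ∃ u : Λ, ι u = g)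
    (h₂ : ∀ u : Λ, x.coeff (ι u) = serCoeff φ u) : x = hahnExpansion hΛ hι φ := by
  ext g
  by_cases hg : ∃ u : Λ, ι u = g
  · obtain ⟨u, rfl⟩ := hg
    rw [h₂, hahnExpansion_coeff]
  · rw [not_imp_comm.1 (h₁ g) hg,
      not_imp_comm.1 (exists_of_hahnExpansion_coeff_ne_zero hΛ hι) hg]

variable [Module.Free ℤ M]

theorem hahnExpansion_add (hΛ : IsGermSemigroup Λ) (hι : IsPositiveEmbedding Λ ι)
    (φ ψ : AnalyticAlgebra Λ) :
    hahnExpansion hΛ hι (φ + ψ) = hahnExpansion hΛ hι φ + hahnExpansion hΛ hι ψ := by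
  refine (eq_hahnExpansion hΛ hι (fun g hg => ?_) fun u => ?_).symm
  · by_cases h : (hahnExpansion hΛ hι φ).coeff g = 0
    · rw [HahnSeries.coeff_add, h, zero_add] at hg
      exact exists_of_hahnExpansion_coeff_ne_zero hΛ hι hg
    · exact exists_of_hahnExpansion_coeff_ne_zero hΛ hι h
  · rw [HahnSeries.coeff_add, hahnExpansion_coeff, hahnExpansion_coeff, serCoeff_add hΛ]

theorem hahnExpansion_of_single (hΛ : IsGermSemigroup Λ) (hι : IsPositiveEmbedding Λ ι)
    (u : Λ) (z : ℂ) :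
    hahnExpansion hΛ hι (AdicCompletion.of (orbitMaximalIdeal Λ) _ (single u z)) =
      HahnSeries.single (ι u) z := by
  classical
  refine (eq_hahnExpansion hΛ hι (fun g hg => ⟨u, ?_⟩) fun v => ?_).symm
  · by_contra h
    exact hg (HahnSeries.coeff_single_of_ne (Ne.symm h))
  · rw [serCoeff_of hΛ, coeff_single, Finsupp.single_apply, HahnSeries.coeff_single]
    simp [hι.injective.eq_iff, eq_comm]

theorem hahnExpansion_zero (hΛ : IsGermSemigroup Λ) (hι : IsPositiveEmbedding Λ ι) :
    hahnExpansion hΛ hι (0 : AnalyticAlgebra Λ) = 0 := by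
  simpa using hahnExpansion_add hΛ hι 0 0

theorem hahnExpansion_of_mul (hΛ : IsGermSemigroup Λ) (hι : IsPositiveEmbedding Λ ι)
    (p q : AddMonoidAlgebra ℂ Λ) :
    hahnExpansion hΛ hι (AdicCompletion.of (orbitMaximalIdeal Λ) _ (p * q)) =
      hahnExpansion hΛ hι (AdicCompletion.of (orbitMaximalIdeal Λ) _ p) *
        hahnExpansion hΛ hι (AdicCompletion.of (orbitMaximalIdeal Λ) _ q) := by
  induction p using AddMonoidAlgebra.induction_linear with
  | zero => simp [hahnExpansion_zero]
  | add p p' hp hp' => rw [add_mul, map_add, map_add, hahnExpansion_add, hahnExpansion_add, hp, hp',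
      add_mul]
  | single u z =>
    induction q using AddMonoidAlgebra.induction_linear with
    | zero => simp [hahnExpansion_zero]
    | add p p' hp hp' => rw [mul_add, map_add, map_add, hahnExpansion_add, hahnExpansion_add, hp,
        hp', mul_add]
    | single v y =>
      rw [single_mul_single]
      simp only [hahnExpansion_of_single, HahnSeries.single_mul_single, AddSubmonoid.coe_add,
        map_add]

theorem hahnExpansion_mul (hΛ : IsGermSemigroup Λ) (hι : IsPositiveEmbedding Λ ι)
    (φ ψ : AnalyticAlgebra Λ) :
    hahnExpansion hΛ hι (φ * ψ) = hahnExpansion hΛ hι φ * hahnExpansion hΛ hι ψ := by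
  refine (eq_hahnExpansion hΛ hι (fun g hg => ?_) fun u => ?_).symm
  · obtain ⟨a, b, rfl, ha, hb⟩ := exists_add_of_hahn_coeff_mul_ne_zero hg
    obtain ⟨u, rfl⟩ := exists_of_hahnExpansion_coeff_ne_zero hΛ hι ha
    obtain ⟨v, rfl⟩ := exists_of_hahnExpansion_coeff_ne_zero hΛ hι hb
    exact ⟨u + v, map_add ι _ _⟩
  · obtain ⟨k, hk⟩ := exists_single_notMem_pow hΛ.fg hΛ.pointed u
    -- A factor may be replaced by a polynomial congruent to it modulo 𝔪^k. The exponents v of the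
    -- remainder have X^v ∈ 𝔪^k, so a contribution at u would put X^u in 𝔪^k.
    have key : ∀ {χ ω : AnalyticAlgebra Λ} {p : AddMonoidAlgebra ℂ Λ},
        AdicCompletion.evalₐ (orbitMaximalIdeal Λ) k χ = Ideal.Quotient.mk _ p →
        (hahnExpansion hΛ hι (χ - AdicCompletion.of _ _ p) * hahnExpansion hΛ hι ω).coeff (ι u)
          = 0 := by
      intro χ ω p hp
      by_contra hne
      obtain ⟨a, b, hab, ha, hb⟩ := exists_add_of_hahn_coeff_mul_ne_zero hne
      obtain ⟨v, rfl⟩ := exists_of_hahnExpansion_coeff_ne_zero hΛ hι ha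
      obtain ⟨w, rfl⟩ := exists_of_hahnExpansion_coeff_ne_zero hΛ hι hb
      rw [← map_add, hι.injective.eq_iff] at hab
      have hvw : w + v = u := Subtype.ext (by rw [add_comm]; exact hab)
      refine hk (hvw ▸ single_mem_pow_add ?_ w 1)
      by_contra hv
      refine ha ?_
      rw [hahnExpansion_coeff, serCoeff_sub hΛ, serCoeff_of hΛ, serCoeff_eq hΛ hv hp, sub_self]
    obtain ⟨p, hp⟩ := exists_evalₐ_eq_mk k φ
    obtain ⟨q, hq⟩ := exists_evalₐ_eq_mk k ψ
    have e₁ : hahnExpansion hΛ hι φ = hahnExpansion hΛ hι (AdicCompletion.of _ _ p) +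
        hahnExpansion hΛ hι (φ - AdicCompletion.of _ _ p) := by
      rw [← hahnExpansion_add, add_sub_cancel]
    have e₂ : hahnExpansion hΛ hι ψ = hahnExpansion hΛ hι (AdicCompletion.of _ _ q) +
        hahnExpansion hΛ hι (ψ - AdicCompletion.of _ _ q) := by
      rw [← hahnExpansion_add, add_sub_cancel]
    have e : hahnExpansion hΛ hι φ * hahnExpansion hΛ hι ψ =
        hahnExpansion hΛ hι (AdicCompletion.of _ _ (p * q)) +
        hahnExpansion hΛ hι (ψ - AdicCompletion.of _ _ q) *
          hahnExpansion hΛ hι (AdicCompletion.of _ _ p) +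
        hahnExpansion hΛ hι (φ - AdicCompletion.of _ _ p) * hahnExpansion hΛ hι ψ := by
      rw [hahnExpansion_of_mul, e₁, e₂]; ring
    rw [e, HahnSeries.coeff_add, HahnSeries.coeff_add, key hp, key hq, add_zero, add_zero,
      hahnExpansion_coeff, serCoeff_of hΛ, serCoeff_mul_eq hΛ hk hp hq]

/-- The expansion in Hahn series, as a ring homomorphism. -/
noncomputable def hahnExpansionHom (hΛ : IsGermSemigroup Λ) (hι : IsPositiveEmbedding Λ ι) :
    AnalyticAlgebra Λ →+* HahnSeries Γ ℂ where
  toFun := hahnExpansion hΛ hι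
  map_one' := by
    rw [← monomial_zero, monomial, hahnExpansion_of_single]
    simp
  map_mul' := hahnExpansion_mul hΛ hι
  map_zero' := hahnExpansion_zero hΛ hι
  map_add' := hahnExpansion_add hΛ hι

theorem hahnExpansionHom_injective (hΛ : IsGermSemigroup Λ) (hι : IsPositiveEmbedding Λ ι) :
    Function.Injective (hahnExpansionHom hΛ hι) := fun φ ψ h => serCoeff_ext hΛ fun u => by
  rw [← hahnExpansion_coeff hΛ hι, ← hahnExpansion_coeff hΛ hι]
  exact congrArg (fun x : HahnSeries Γ ℂ => x.coeff (ι u)) h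

variable {K : Type*} [Field K] [Algebra (AnalyticAlgebra Λ) K] [IsFractionRing (AnalyticAlgebra Λ) K]

/-- The embedding of the field of fractions of the analytic algebra in a field of Hahn series. -/
noncomputable def hahnEmbedding (K : Type*) [Field K] [Algebra (AnalyticAlgebra Λ) K]
    [IsFractionRing (AnalyticAlgebra Λ) K] (hΛ : IsGermSemigroup Λ)
    (hι : IsPositiveEmbedding Λ ι) : K →+* HahnSeries Γ ℂ :=
  IsFractionRing.lift (hahnExpansionHom_injective hΛ hι)

theorem hahnEmbedding_algebraMap (hΛ : IsGermSemigroup Λ) (hι : IsPositiveEmbedding Λ ι)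
    (φ : AnalyticAlgebra Λ) :
    hahnEmbedding K hΛ hι (algebraMap _ K φ) = hahnExpansion hΛ hι φ :=
  IsFractionRing.lift_algebraMap (hahnExpansionHom_injective hΛ hι) φ

end Embedding

/-! ### Laurent monomials and exponents of elements of R̄ -/

section Monomials

open AddMonoidAlgebra

variable {M : Type*} [AddCommGroup M] {Λ : AddSubmonoid M}
variable {Γ : Type*} [AddCommGroup Γ] [LinearOrder Γ] [IsOrderedAddMonoid Γ] {ι : M →+ Γ}
variable [Module.Free ℤ M]
variable (K : Type*) [Field K] [Algebra (AnalyticAlgebra Λ) K] [IsFractionRing (AnalyticAlgebra Λ) K]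

theorem algebraMap_monomial_ne_zero (hΛ : IsGermSemigroup Λ) (u : Λ) :
    algebraMap (AnalyticAlgebra Λ) K (monomial u) ≠ 0 := fun h =>
  monomial_ne_zero hΛ u (IsFractionRing.injective (AnalyticAlgebra Λ) K (h.trans (map_zero _).symm))

/-- The Laurent monomial `X^w`, for `w` in the lattice, in the field of fractions. -/
noncomputable def laurentMonomial (hΛ : IsGermSemigroup Λ) (w : M) : K :=
  algebraMap (AnalyticAlgebra Λ) K
    (monomial ⟨_, (exists_sub_eq hΛ.closure_eq_top w).choose_spec.1⟩) /
  algebraMap (AnalyticAlgebra Λ) K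
    (monomial ⟨_, (exists_sub_eq hΛ.closure_eq_top w).choose_spec.2.choose_spec.1⟩)

theorem laurentMonomial_eq (hΛ : IsGermSemigroup Λ) {w : M} (u v : Λ) (h : w = u - v) :
    laurentMonomial K hΛ w = algebraMap (AnalyticAlgebra Λ) K (monomial u) /
      algebraMap (AnalyticAlgebra Λ) K (monomial v) := by
  have h₀ := (exists_sub_eq hΛ.closure_eq_top w).choose_spec.2.choose_spec.2
  rw [laurentMonomial, div_eq_div_iff (algebraMap_monomial_ne_zero K hΛ _)
    (algebraMap_monomial_ne_zero K hΛ _), ← map_mul, ← map_mul, ← monomial_add, ← monomial_add]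
  congr 2
  refine Subtype.ext ?_
  have h₁ := h₀.symm.trans h
  rw [sub_eq_sub_iff_add_eq_add] at h₁
  exact h₁

theorem laurentMonomial_of_mem (hΛ : IsGermSemigroup Λ) (u : Λ) :
    laurentMonomial K hΛ (u : M) = algebraMap (AnalyticAlgebra Λ) K (monomial u) := by
  rw [laurentMonomial_eq K hΛ u 0 (by simp), monomial_zero, map_one, div_one]

theorem laurentMonomial_ne_zero (hΛ : IsGermSemigroup Λ) (w : M) : laurentMonomial K hΛ w ≠ 0 :=
  div_ne_zero (algebraMap_monomial_ne_zero K hΛ _) (algebraMap_monomial_ne_zero K hΛ _)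

theorem laurentMonomial_zero (hΛ : IsGermSemigroup Λ) : laurentMonomial K hΛ (0 : M) = 1 := by
  rw [laurentMonomial_eq K hΛ 0 0 (by simp), monomial_zero, map_one, div_one]

theorem laurentMonomial_add (hΛ : IsGermSemigroup Λ) (w w' : M) :
    laurentMonomial K hΛ (w + w') = laurentMonomial K hΛ w * laurentMonomial K hΛ w' := by
  obtain ⟨u, hu, v, hv, rfl⟩ := exists_sub_eq hΛ.closure_eq_top w
  obtain ⟨u', hu', v', hv', rfl⟩ := exists_sub_eq hΛ.closure_eq_top w'
  rw [laurentMonomial_eq K hΛ ⟨u, hu⟩ ⟨v, hv⟩ rfl, laurentMonomial_eq K hΛ ⟨u', hu'⟩ ⟨v', hv'⟩ rfl,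
    laurentMonomial_eq K hΛ (⟨u, hu⟩ + ⟨u', hu'⟩) (⟨v, hv⟩ + ⟨v', hv'⟩)
      (by simp only [AddSubmonoid.coe_add]; abel), monomial_add, monomial_add, map_mul, map_mul,
    div_mul_div_comm]

theorem laurentMonomial_nsmul (hΛ : IsGermSemigroup Λ) (k : ℕ) (w : M) :
    laurentMonomial K hΛ (k • w) = laurentMonomial K hΛ w ^ k := by
  induction k with
  | zero => simp [laurentMonomial_zero]
  | succ k ih => rw [succ_nsmul, laurentMonomial_add, ih, pow_succ]

theorem hahnEmbedding_laurentMonomial (hΛ : IsGermSemigroup Λ) (hι : IsPositiveEmbedding Λ ι)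
    (w : M) : hahnEmbedding K hΛ hι (laurentMonomial K hΛ w) = HahnSeries.single (ι w) 1 := by
  obtain ⟨u, hu, v, hv, rfl⟩ := exists_sub_eq hΛ.closure_eq_top w
  rw [laurentMonomial_eq K hΛ ⟨u, hu⟩ ⟨v, hv⟩ rfl, map_div₀, hahnEmbedding_algebraMap,
    hahnEmbedding_algebraMap, monomial, monomial, hahnExpansion_of_single, hahnExpansion_of_single,
    div_eq_mul_inv, HahnSeries.inv_single, HahnSeries.single_mul_single, ← map_neg, ← map_add]
  simp [sub_eq_add_neg]

variable {K}

/-- The exponents of the monomials in the expansion of an element of the field of fractions. -/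
def exponents (hΛ : IsGermSemigroup Λ) (hι : IsPositiveEmbedding Λ ι) (x : K) : Set M :=
  {w | (hahnEmbedding K hΛ hι x).coeff (ι w) ≠ 0}

theorem mem_exponents_algebraMap (hΛ : IsGermSemigroup Λ) (hι : IsPositiveEmbedding Λ ι)
    {φ : AnalyticAlgebra Λ} {w : M} :
    w ∈ exponents hΛ hι (algebraMap _ K φ) ↔ ∃ u : Λ, serCoeff φ u ≠ 0 ∧ (u : M) = w := by
  simp only [exponents, Set.mem_ofPred_eq, hahnEmbedding_algebraMap]
  constructor
  · intro h
    obtain ⟨u, hu⟩ := exists_of_hahnExpansion_coeff_ne_zero hΛ hι h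
    obtain rfl := hι.injective hu
    exact ⟨u, by rwa [hahnExpansion_coeff] at h, rfl⟩
  · rintro ⟨u, hu, rfl⟩
    rwa [hahnExpansion_coeff]

theorem mem_exponents_laurentMonomial_mul (hΛ : IsGermSemigroup Λ)
    (hι : IsPositiveEmbedding Λ ι) {x : K} {v w : M} :
    v + w ∈ exponents hΛ hι (laurentMonomial K hΛ v * x) ↔ w ∈ exponents hΛ hι x := by
  simp only [exponents, Set.mem_ofPred_eq, map_mul, hahnEmbedding_laurentMonomial]
  rw [map_add, add_comm, HahnSeries.coeff_single_mul_add, one_mul]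

/-- The saturation, as a submonoid of the lattice. -/
def saturationSubmonoid (Λ : AddSubmonoid M) : AddSubmonoid M where
  carrier := saturation Λ
  add_mem' := add_mem_saturation
  zero_mem' := mem_saturation_of_mem (zero_mem _)

variable [Module.Finite ℤ M]

/-- Integral elements over R are almost integral, and the ring of Hahn series supported on the
saturation contains R and is completely integrally closed. Thus elements of R̄ have their exponents
in the saturation. -/
theorem hahnEmbedding_mem_supportedOn (hΛ : IsGermSemigroup Λ) (hι : IsPositiveEmbedding Λ ι)
    {r : K} (hr : IsIntegral (AnalyticAlgebra Λ) r) :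
    hahnEmbedding K hΛ hι r ∈ supportedOn ((saturationSubmonoid Λ).map ι) := by
  have hR : ∀ φ : AnalyticAlgebra Λ, hahnEmbedding K hΛ hι (algebraMap _ K φ) ∈
      supportedOn ((saturationSubmonoid Λ).map ι) := fun φ g hg => by
    rw [hahnEmbedding_algebraMap] at hg
    obtain ⟨u, rfl⟩ := exists_of_hahnExpansion_coeff_ne_zero hΛ hι hg
    exact ⟨u, mem_saturation_of_mem u.2, rfl⟩
  refine mem_supportedOn_of_isAlmostIntegral ?_ ?_
  · intro d w h
    obtain ⟨d', hd', rfl⟩ : d ∈ (saturationSubmonoid Λ).map ι := by simpa using h 0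
    obtain ⟨x, hx, hxe⟩ : ι d' + w ∈ (saturationSubmonoid Λ).map ι := by simpa using h 1
    obtain rfl : ι (x - d') = w := by rw [map_sub, hxe, add_sub_cancel_left]
    refine ⟨x - d', mem_saturation_of_forall_add_nsmul_mem hΛ (d := d') fun m => ?_, rfl⟩
    obtain ⟨y, hy, hye⟩ := h m
    rw [← map_nsmul, ← map_add] at hye
    rwa [← hι.injective hye]
  · obtain ⟨c, hc, h⟩ := hr.isAlmostIntegral
    refine ⟨⟨_, hR c⟩, mem_nonZeroDivisors_of_ne_zero fun h0 => ?_, fun n => ?_⟩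
    · have h1 := congrArg Subtype.val h0
      have h2 : algebraMap (AnalyticAlgebra Λ) K c = 0 :=
        (map_eq_zero_iff _ (hahnEmbedding K hΛ hι).injective).1 h1
      have := (algebraMap (AnalyticAlgebra Λ) K).domain_nontrivial
      have h3 := (map_eq_zero_iff _ (IsFractionRing.injective (AnalyticAlgebra Λ) K)).1 h2
      exact nonZeroDivisors.ne_zero hc h3
    · obtain ⟨φ, hφ⟩ := h n
      refine ⟨⟨_, hR φ⟩, ?_⟩
      change hahnEmbedding K hΛ hι (algebraMap _ K φ) = _ * _
      rw [hφ, Algebra.smul_def, map_mul, map_pow]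

theorem exponents_subset_saturation (hΛ : IsGermSemigroup Λ) (hι : IsPositiveEmbedding Λ ι)
    {r : K} (hr : IsIntegral (AnalyticAlgebra Λ) r) : exponents hΛ hι r ⊆ saturation Λ := by
  intro w hw
  obtain ⟨v, hv, e⟩ := hahnEmbedding_mem_supportedOn hΛ hι hr _ hw
  rwa [← hι.injective e]

/-- An element of the normalization becomes an element of the analytic algebra after
multiplication by a monomial. -/
theorem exists_algebraMap_eq_laurentMonomial_mul (hΛ : IsGermSemigroup Λ)
    (hι : IsPositiveEmbedding Λ ι) {e : M} (he : ∀ w ∈ saturation Λ, e + w ∈ Λ)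
    {r : K} (hr : IsIntegral (AnalyticAlgebra Λ) r) :
    ∃ φ : AnalyticAlgebra Λ, algebraMap _ K φ = laurentMonomial K hΛ e * r := by
  obtain ⟨φ, hφ⟩ := exists_serCoeff_eq hΛ
    fun u : Λ => (hahnEmbedding K hΛ hι r).coeff (ι (u - e))
  refine ⟨φ, (hahnEmbedding K hΛ hι).injective ?_⟩
  rw [map_mul, hahnEmbedding_laurentMonomial, hahnEmbedding_algebraMap]
  refine (eq_hahnExpansion hΛ hι (fun g hg => ?_) fun u => ?_).symm
  · rw [HahnSeries.coeff_single_mul, one_mul] at hg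
    obtain ⟨v, hv, hve⟩ := hahnEmbedding_mem_supportedOn hΛ hι hr _ hg
    exact ⟨⟨e + v, he v hv⟩, by simp [hve]⟩
  · rw [HahnSeries.coeff_single_mul, one_mul, hφ, map_sub]

end Monomials

/-! ### Construction of monomial valuations -/

section MonomialValuation

variable {M : Type*} [AddCommGroup M] [Module.Free ℤ M] [Module.Finite ℤ M] {Λ : AddSubmonoid M}

/-- The embedding of the lattice in a lexicographic product which refines the preorder given by a
linear form. -/
noncomputable def lexEmbedding (θ : M →+ ℝ) : M →+ ℝ ×ₗ Lex (Fin (Module.finrank ℤ M) → ℤ) where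
  toFun w := toLex (θ w, toLex ((Module.finBasis ℤ M).equivFun w))
  map_zero' := by simp
  map_add' u v := by simp; rfl

theorem isPositiveEmbedding_lexEmbedding {θ : M →+ ℝ} (hθ : ∀ u ∈ Λ, u ≠ 0 → 0 < θ u) :
    IsPositiveEmbedding Λ (lexEmbedding θ) where
  injective u v h := (Module.finBasis ℤ M).equivFun.injective
    (toLex.injective (congrArg Prod.snd (toLex.injective h)))
  pos u hu h := by
    rw [Prod.Lex.lt_iff]
    exact Or.inl (hθ u hu h)

/-- The first projection of the lexicographic product. -/
noncomputable def lexFst (r : ℕ) : ℝ ×ₗ Lex (Fin r → ℤ) →+ ℝ where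
  toFun g := (ofLex g).1
  map_zero' := rfl
  map_add' _ _ := rfl

theorem lexFst_mono (r : ℕ) : Monotone (lexFst r) := fun a b h => Prod.Lex.monotone_fst a b h

variable (K : Type*) [Field K] [Algebra (AnalyticAlgebra Λ) K] [IsFractionRing (AnalyticAlgebra Λ) K]

/-- The monomial valuation with weights given by a linear form which is positive on `Λ - {0}`. -/
theorem exists_monomialValuation (hΛ : IsGermSemigroup Λ) {θ : M →+ ℝ}
    (hθ : ∀ u ∈ Λ, u ≠ 0 → 0 < θ u) : ∃ μ : AddValuation K (WithTop ℝ),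
      ∀ φ : AnalyticAlgebra Λ, φ ≠ 0 →
        (∃ u, serCoeff φ u ≠ 0 ∧ μ (algebraMap _ K φ) = (θ u : ℝ)) ∧
        ∀ u, serCoeff φ u ≠ 0 → μ (algebraMap _ K φ) ≤ (θ u : ℝ) := by
  have hι := isPositiveEmbedding_lexEmbedding hθ
  let π := lexFst (Module.finrank ℤ M)
  -- The order of the Hahn series, followed by projection to the first lexicographic coordinate. On
  -- the image of w that coordinate is θ(w), so the leading exponent realises the minimum of θ.
  let μ : AddValuation K (WithTop ℝ) := ((HahnSeries.addVal _ ℂ).map π.withTopMap rfl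
    (lexFst_mono _).withTop_map).comap (hahnEmbedding K hΛ hι)
  refine ⟨μ, fun φ hφ => ?_⟩
  have h0 : hahnExpansion hΛ hι φ ≠ 0 := fun h => hφ (hahnExpansionHom_injective hΛ hι
    (h.trans (map_zero (hahnExpansionHom hΛ hι)).symm))
  have hμ : μ (algebraMap _ K φ) = (π (hahnExpansion hΛ hι φ).order : ℝ) := by
    change π.withTopMap (HahnSeries.addVal _ ℂ (hahnEmbedding K hΛ hι (algebraMap _ K φ))) = _
    rw [hahnEmbedding_algebraMap, HahnSeries.addVal_apply_of_ne h0]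
    rfl
  rw [hμ]
  constructor
  · have hc : (hahnExpansion hΛ hι φ).coeff (hahnExpansion hΛ hι φ).order ≠ 0 := fun h =>
      h0 (HahnSeries.coeff_order_eq_zero.1 h)
    obtain ⟨u, hu⟩ := exists_of_hahnExpansion_coeff_ne_zero hΛ hι hc
    refine ⟨u, ?_, ?_⟩
    · rwa [← hu, hahnExpansion_coeff] at hc
    · rw [← hu]; rfl
  · intro u hu
    rw [← hahnExpansion_coeff hΛ hι] at hu
    exact WithTop.coe_le_coe.2 (lexFst_mono _ (HahnSeries.order_le_of_coeff_ne_zero hu))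

end MonomialValuation

/-! ### Valuations on the charts of the normalized blow-up -/

section Charts

variable {R K : Type*} [CommRing R] [Field K] [Algebra R K]

/-- Valuation rings are integrally closed. -/
theorem addValuation_nonneg_of_isIntegral {A : Type*} [CommRing A] [Algebra A K]
    (μ : AddValuation K (WithTop ℝ)) (hA : ∀ a, 0 ≤ μ (algebraMap A K a)) {x : K}
    (hx : IsIntegral A x) : 0 ≤ μ x := by
  let v := AddValuation.toValuation μ
  let f : A →+* v.integer := (algebraMap A K).codRestrict v.integer fun a => hA a
  have hx' : IsIntegral v.integer x := by
    obtain ⟨p, hp, h⟩ := hx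
    exact ⟨p.map f, hp.map f, by rw [Polynomial.eval₂_map]; exact h⟩
  exact (Valuation.integer.integers v).mem_of_integral hx'

/-- If f has the least value in the ideal of the closed point, the generators a/f of the chart have
non-negative value. Integral closedness of the valuation ring handles both R̄ over R and the
normalization of the chart. -/
theorem addValuation_nonneg_chart (μ : AddValuation K (WithTop ℝ))
    (hR : ∀ r, 0 ≤ μ (algebraMap R K r)) {f : NormalizationRing R K} (hf : f ≠ 0)
    (hμ : ∀ a ∈ closedPointIdeal R K, μ (f : K) ≤ μ (a : K)) (b : NormalizedChart R K f) :
    0 ≤ μ (b : K) := by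
  have hf' : (f : K) ≠ 0 := fun h => hf (Subtype.ext h)
  refine addValuation_nonneg_of_isIntegral μ (fun c => ?_) b.2
  obtain ⟨c, hc⟩ := c
  change 0 ≤ μ c
  induction hc using Algebra.adjoin_induction with
  | mem x hx =>
    obtain ⟨a, ha, rfl⟩ := hx
    have h := hμ a ha
    by_contra! hlt
    have e : (a : K) = (a : K) / f * f := by field_simp
    have hft : μ (f : K) ≠ ⊤ := (μ.ne_top_iff).2 hf'
    rw [e, μ.map_mul] at h
    have := WithTop.add_lt_add_right hft hlt
    rw [zero_add] at this
    exact absurd h (not_le.2 this)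
  | algebraMap r => exact addValuation_nonneg_of_isIntegral μ hR r.2
  | add x y _ _ hx hy => exact μ.map_le_add hx hy
  | mul x y _ _ hx hy => rw [μ.map_mul]; exact add_nonneg hx hy

/-- The chart lies in the localization of R̄ at f, so an element integral over it becomes integral
over R̄, hence over R, after clearing a power of f. -/
theorem exists_pow_mul_mem_normalization [IsFractionRing R K] {f : NormalizationRing R K}
    (hf : f ≠ 0) (b : NormalizedChart R K f) : ∃ k, IsIntegral R ((f : K) ^ k * (b : K)) := by
  have hS : Submonoid.powers f ≤ nonZeroDivisors (NormalizationRing R K) :=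
    powers_le_nonZeroDivisors_of_noZeroDivisors hf
  let L := Localization.subalgebra.ofField K (Submonoid.powers f) hS
  have hL : blowupChart R K f ≤ L := by
    refine Algebra.adjoin_le ?_
    rintro _ ⟨a, -, rfl⟩
    exact ⟨a, f, Submonoid.mem_powers f, div_eq_mul_inv _ _⟩
  have hb : IsIntegral L (b : K) := by
    obtain ⟨p, hp, h⟩ := b.2
    exact ⟨p.map (Subalgebra.inclusion hL).toRingHom, hp.map _, by
      rw [Polynomial.eval₂_map]; exact h⟩
  obtain ⟨⟨_, k, rfl⟩, h⟩ := hb.exists_multiple_integral_of_isLocalization (Submonoid.powers f) _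
  refine ⟨k, ?_⟩
  have h2 : IsIntegral R ((f ^ k : NormalizationRing R K) • (b : K)) := isIntegral_trans _ h
  simpa [Algebra.smul_def] using h2

variable {D : ExceptionalComponent R K} {ν : Valuation K ℤᵐ⁰}

theorem ExceptionalComponent.isPrime (D : ExceptionalComponent R K) : D.prime.IsPrime :=
  D.prime_mem.1.1

theorem val_chart_le_one (hν : D.IsDivisorialValuation ν) (b : NormalizedChart R K D.f) :
    ν (b : K) ≤ 1 := by
  rw [hν.le_one_iff]
  exact ⟨b, 1, fun h => D.isPrime.ne_top ((Ideal.eq_top_iff_one _).2 h), by simp⟩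

/-- The maximal ideal of 𝒪_{B,D} contracts to the prime of D. The description of the valuation ring
alone gives this, by deciding whether b⁻¹ belongs to it. -/
theorem val_chart_lt_one_iff (hν : D.IsDivisorialValuation ν) (b : NormalizedChart R K D.f) :
    ν (b : K) < 1 ↔ b ∈ D.prime := by
  constructor
  · intro h
    by_contra hb
    have h1 : ν (b : K)⁻¹ ≤ 1 := by
      rw [hν.le_one_iff]
      exact ⟨1, b, hb, by simp⟩
    have hb0 : (b : K) ≠ 0 := fun h => hb (by
      rw [show b = 0 from Subtype.ext h]; exact zero_mem _)
    rw [map_inv₀, inv_le_one₀ (by simpa [zero_lt_iff] using hb0)] at h1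
    exact absurd h (not_lt.2 h1)
  · intro hb
    by_contra h
    have h1 : ν (b : K)⁻¹ ≤ 1 := by
      rw [map_inv₀, (le_antisymm (val_chart_le_one hν b) (not_lt.1 h)), inv_one]
    rw [hν.le_one_iff] at h1
    obtain ⟨a, s, hs, h2⟩ := h1
    by_cases hb0 : (b : K) = 0
    · rw [hb0, map_zero] at h; exact h zero_lt_one
    have hs0 : (s : K) ≠ 0 := fun h => hs (by
      rw [show s = 0 from Subtype.ext h]; exact zero_mem _)
    -- From b⁻¹ = a / s one gets s = b * a, which lies in the prime: a contradiction.
    rw [inv_eq_iff_eq_inv, inv_div, eq_div_iff_mul_eq (fun h => by simp [h, hb0] at h2)] at h2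
    refine hs ?_
    rw [← (show b * a = s from Subtype.ext h2)]
    exact Ideal.mul_mem_right _ _ hb

theorem val_lt_one_of_mem_closedPointIdeal (hν : D.IsDivisorialValuation ν)
    {a : NormalizationRing R K} (ha : a ∈ closedPointIdeal R K) : ν (a : K) < 1 := by
  let b : NormalizedChart R K D.f := algebraMap (blowupChart R K D.f) _
    (algebraMap (NormalizationRing R K) _ a)
  exact (val_chart_lt_one_iff hν b).2 (D.prime_mem.1.2 (Ideal.subset_span ⟨a, ha, rfl⟩))

theorem val_le_val_of_mem_closedPointIdeal (hν : D.IsDivisorialValuation ν)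
    {a : NormalizationRing R K} (ha : a ∈ closedPointIdeal R K) : ν (a : K) ≤ ν (D.f : K) := by
  have hf : (D.f : K) ≠ 0 := fun h => D.f_ne_zero (Subtype.ext h)
  have h := val_chart_le_one hν (algebraMap (blowupChart R K D.f) (NormalizedChart R K D.f)
    ⟨(a : K) / D.f, Algebra.subset_adjoin ⟨a, ha, rfl⟩⟩)
  change ν ((a : K) / D.f) ≤ 1 at h
  rwa [map_div₀, div_le_one₀ (by simpa [zero_lt_iff] using hf)] at h

theorem mem_localMaximalIdeal_iff (hν : D.IsDivisorialValuation ν) {x : K} :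
    x ∈ D.localMaximalIdeal ↔ ν x < 1 := by
  have hs1 : ∀ s, s ∉ D.prime → ν (s : K) = 1 := fun s hs =>
    le_antisymm (val_chart_le_one hν s) (not_lt.1 fun h => hs ((val_chart_lt_one_iff hν s).1 h))
  constructor
  · rintro ⟨a, s, ha, hs, rfl⟩
    rw [map_div₀, hs1 s hs, div_one]
    exact (val_chart_lt_one_iff hν a).2 ha
  · intro h
    obtain ⟨a, s, hs, rfl⟩ := (hν.le_one_iff x).1 h.le
    rw [map_div₀, hs1 s hs, div_one, val_chart_lt_one_iff hν] at h
    exact ⟨a, s, h, hs, rfl⟩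

/-- A valuation which is non-negative on the chart and whose centre there contains the
exceptional divisor and is contained in `D` has centre `D`. -/
theorem addValuation_pos_iff_mem_prime (hν : D.IsDivisorialValuation ν)
    (μ : AddValuation K (WithTop ℝ)) (h₀ : ∀ b : NormalizedChart R K D.f, 0 ≤ μ (b : K))
    (h₁ : ∀ a ∈ closedPointIdeal R K, 0 < μ (a : K))
    (h₂ : ∀ b : NormalizedChart R K D.f, 0 < μ (b : K) → ν (b : K) < 1)
    (b : NormalizedChart R K D.f) : 0 < μ (b : K) ↔ b ∈ D.prime := by
  let q : Ideal (NormalizedChart R K D.f) :=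
    { carrier := {b | 0 < μ (b : K)}
      add_mem' := fun ha hb => μ.map_lt_add ha hb
      zero_mem' := by simp
      smul_mem' := fun c a ha => by
        change 0 < μ ((c : K) * a)
        rw [μ.map_mul]
        exact lt_of_lt_of_le ha (le_add_of_nonneg_left (h₀ c)) }
  have hq : q.IsPrime :=
    { ne_top' := fun h => by
        have : (1 : NormalizedChart R K D.f) ∈ q := h ▸ Submodule.mem_top
        change 0 < μ (1 : K) at this
        simp at this
      mem_or_mem' := fun {x y} hxy => by
        by_contra! h
        have hx : μ (x : K) = 0 := le_antisymm (not_lt.1 h.1) (h₀ x)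
        have hy : μ (y : K) = 0 := le_antisymm (not_lt.1 h.2) (h₀ y)
        change 0 < μ ((x : K) * y) at hxy
        rw [μ.map_mul, hx, hy, add_zero] at hxy
        exact lt_irrefl _ hxy }
  have hle : q ≤ D.prime := fun b hb => (val_chart_lt_one_iff hν b).1 (h₂ b hb)
  have hexc : exceptionalIdeal R K D.f ≤ q := by
    refine Ideal.span_le.2 ?_
    rintro x ⟨a, ha, hx⟩
    change 0 < μ (x : K)
    rw [hx]
    exact h₁ a ha
  -- The centre q of μ is a prime containing the exceptional ideal and contained in `D.prime`.
  -- Minimality of the latter gives the reverse inclusion.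
  exact ⟨fun h => hle h, fun h => D.prime_mem.2 ⟨hq, hexc⟩ hle h⟩

/-- An element of the maximal ideal of 𝒪_{B,D} is a / s with a in the prime of D and s outside it,
where μ(a) > 0 and μ(s) = 0. -/
theorem addValuation_pos_of_val_lt_one (hν : D.IsDivisorialValuation ν)
    (μ : AddValuation K (WithTop ℝ)) (h₀ : ∀ b : NormalizedChart R K D.f, 0 ≤ μ (b : K))
    (h : ∀ b : NormalizedChart R K D.f, 0 < μ (b : K) ↔ b ∈ D.prime) {x : K} (hx : ν x < 1) :
    0 < μ x := by
  obtain ⟨a, s, ha, hs, rfl⟩ := (mem_localMaximalIdeal_iff hν).2 hx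
  have hs0 : (s : K) ≠ 0 := fun h => hs (by
    rw [show s = 0 from Subtype.ext h]; exact zero_mem _)
  have hs1 : μ (s : K) = 0 := le_antisymm (not_lt.1 fun h' => hs ((h s).1 h')) (h₀ s)
  have e : μ (a : K) = μ ((a : K) / s) + μ (s : K) := by rw [← μ.map_mul]; congr 1; field_simp
  rw [hs1, add_zero] at e
  rw [← e]
  exact (h a).2 ha

theorem mem_filtration_iff_val (hν : D.IsDivisorialValuation ν) {k : ℕ} {φ : R} :
    φ ∈ hν.filtration.ideal k ↔ ν (algebraMap R K φ) ≤ WithZero.exp (-(k : ℤ)) := Iff.rfl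

end Charts

/-! ### The weight of a Laurent monomial, and the ideal of the closed point -/

section Weight

open AddMonoidAlgebra

variable {M : Type*} [AddCommGroup M] [Module.Free ℤ M] {Λ : AddSubmonoid M}
variable {K : Type*} [Field K] [Algebra (AnalyticAlgebra Λ) K] [IsFractionRing (AnalyticAlgebra Λ) K]

/-- The linear form `w ↦ ν(X^w)` on the lattice, written additively. -/
noncomputable def weight (hΛ : IsGermSemigroup Λ) (ν : Valuation K ℤᵐ⁰) : Module.Dual ℤ M :=
  AddMonoidHom.toIntLinearMap
    { toFun := fun w => -WithZero.log (ν (laurentMonomial K hΛ w))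
      map_zero' := by simp [laurentMonomial_zero]
      map_add' := fun u v => by
        rw [laurentMonomial_add, map_mul, WithZero.log_mul
          ((ν.ne_zero_iff).2 (laurentMonomial_ne_zero K hΛ u))
          ((ν.ne_zero_iff).2 (laurentMonomial_ne_zero K hΛ v)), neg_add] }

theorem val_laurentMonomial (hΛ : IsGermSemigroup Λ) (ν : Valuation K ℤᵐ⁰) (w : M) :
    ν (laurentMonomial K hΛ w) = WithZero.exp (-weight hΛ ν w) := by
  change _ = WithZero.exp (- -WithZero.log (ν (laurentMonomial K hΛ w)))
  rw [neg_neg, WithZero.exp_log ((ν.ne_zero_iff).2 (laurentMonomial_ne_zero K hΛ w))]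

variable [Module.Finite ℤ M]

theorem isIntegral_laurentMonomial (hΛ : IsGermSemigroup Λ) {w : M} (hw : w ∈ saturation Λ) :
    IsIntegral (AnalyticAlgebra Λ) (laurentMonomial K hΛ w) := by
  obtain ⟨k, hk, hkw⟩ := exists_nsmul_mem_of_mem_saturation hΛ hw
  refine IsIntegral.of_pow hk ?_
  rw [← laurentMonomial_nsmul, ← laurentMonomial_of_mem K hΛ ⟨_, hkw⟩ |>.symm]
  exact isIntegral_algebraMap

/-- A power of X^w is a non-constant monomial of R, hence in the Jacobson radical of R. Maximal
ideals of the integral extension R̄ contract to maximal ideals of R, so each of them contains that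
power and therefore X^w. -/
theorem laurentMonomial_mem_closedPointIdeal (hΛ : IsGermSemigroup Λ) {w : M}
    (hw : w ∈ saturation Λ) (hw0 : w ≠ 0) :
    (⟨laurentMonomial K hΛ w, isIntegral_laurentMonomial hΛ hw⟩ :
      NormalizationRing (AnalyticAlgebra Λ) K) ∈ closedPointIdeal (AnalyticAlgebra Λ) K := by
  have : IsAddTorsionFree M := Module.isTorsionFree_int_iff_isAddTorsionFree.1 inferInstance
  obtain ⟨k, hk, hkw⟩ := exists_nsmul_mem_of_mem_saturation hΛ hw
  rw [closedPointIdeal, ← Ideal.jacobson_bot, Ideal.jacobson, Submodule.mem_sInf]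
  rintro J ⟨-, hJ⟩
  have hJ' : (Ideal.comap (algebraMap (AnalyticAlgebra Λ) (NormalizationRing (AnalyticAlgebra Λ) K))
      J).IsMaximal :=
    Ideal.isMaximal_comap_of_isIntegral_of_isMaximal J
  have hu : (⟨k • w, hkw⟩ : Λ) ≠ 0 := fun h =>
    hw0 ((smul_eq_zero.1 (congrArg Subtype.val h)).resolve_left hk.ne')
  have h := (Submodule.mem_sInf.1 (monomial_mem_jacobson hΛ hu)) _ ⟨bot_le, hJ'⟩
  refine hJ.isPrime.mem_of_pow_mem k ?_
  convert Ideal.mem_comap.1 h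
  refine Subtype.ext ?_
  change laurentMonomial K hΛ w ^ k = algebraMap _ K _
  rw [← laurentMonomial_of_mem K hΛ, ← laurentMonomial_nsmul]

variable {Γ : Type*} [AddCommGroup Γ] [LinearOrder Γ] [IsOrderedAddMonoid Γ] {ι : M →+ Γ}

theorem eq_zero_of_mem_saturation_of_neg_mem (hΛ : IsGermSemigroup Λ) {w : M}
    (hw : w ∈ saturation Λ) (hw' : -w ∈ saturation Λ) : w = 0 := by
  have : IsAddTorsionFree M := Module.isTorsionFree_int_iff_isAddTorsionFree.1 inferInstance
  obtain ⟨k, hk, h⟩ := exists_nsmul_mem_of_mem_saturation hΛ hw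
  obtain ⟨l, hl, h'⟩ := exists_nsmul_mem_of_mem_saturation hΛ hw'
  have h1 : (l * k) • w ∈ Λ := by rw [mul_nsmul']; exact nsmul_mem h l
  have h2 : -((l * k) • w) ∈ Λ := by
    rw [← smul_neg, mul_comm, mul_nsmul']; exact nsmul_mem h' k
  exact (smul_eq_zero.1 (hΛ.pointed _ h1 h2)).resolve_left (by positivity)

/-- The elements of the ideal of the closed point have no constant term. -/
theorem zero_notMem_exponents (hΛ : IsGermSemigroup Λ) (hι : IsPositiveEmbedding Λ ι)
    {a : NormalizationRing (AnalyticAlgebra Λ) K}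
    (ha : a ∈ closedPointIdeal (AnalyticAlgebra Λ) K) : 0 ∉ exponents hΛ hι (a : K) := by
  intro h0
  set c := (hahnEmbedding K hΛ hι (a : K)).coeff (ι 0) with hc
  have hc0 : c ≠ 0 := h0
  -- The constant z = -1/c kills the constant term: az + 1 has none, yet it is a unit because a lies
  -- in the Jacobson radical.
  let z : NormalizationRing (AnalyticAlgebra Λ) K :=
    algebraMap (AnalyticAlgebra Λ) _ (algebraMap ℂ (AnalyticAlgebra Λ) (-c⁻¹))
  have hz : hahnEmbedding K hΛ hι (z : K) = HahnSeries.single 0 (-c⁻¹) := by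
    change hahnEmbedding K hΛ hι (algebraMap _ K _) = _
    have := of_single_eq (Λ := Λ) 0 (-c⁻¹)
    rw [monomial_zero, mul_one] at this
    rw [hahnEmbedding_algebraMap, ← this, hahnExpansion_of_single]
    simp
  rw [closedPointIdeal, ← Ideal.jacobson_bot, Ideal.mem_jacobson_bot] at ha
  obtain ⟨b, hb⟩ := (ha z).exists_right_inv
  have hK : ((a : K) * z + 1) * b = 1 := congrArg Subtype.val hb
  have hH := congrArg (hahnEmbedding K hΛ hι) hK
  rw [map_mul, map_add, map_mul, hz, map_one] at hH
  have h1 : ((hahnEmbedding K hΛ hι (a : K) * HahnSeries.single 0 (-c⁻¹) + 1) *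
      hahnEmbedding K hΛ hι (b : K)).coeff 0 ≠ 0 := by
    rw [hH]; simp
  obtain ⟨g, g', hgg, hg, hg'⟩ := exists_add_of_hahn_coeff_mul_ne_zero h1
  have hga : g ≠ 0 → (hahnEmbedding K hΛ hι (a : K)).coeff g ≠ 0 := by
    intro hg0 h
    rw [HahnSeries.coeff_add, HahnSeries.coeff_mul_single_zero, h, HahnSeries.coeff_one,
      if_neg hg0] at hg
    simp at hg
  have hg0 : g ≠ 0 := by
    rintro rfl
    rw [map_zero] at hc
    rw [HahnSeries.coeff_add, HahnSeries.coeff_mul_single_zero, ← hc, HahnSeries.coeff_one] at hg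
    simp [hc0] at hg
  obtain ⟨w, hw, rfl⟩ := hahnEmbedding_mem_supportedOn hΛ hι a.2 _ (hga hg0)
  obtain ⟨w', hw', rfl⟩ := hahnEmbedding_mem_supportedOn hΛ hι b.2 _ hg'
  -- The constant term of (az + 1)b = 1 comes from exponents w + w' = 0 in the saturation.
  -- Pointedness forces w = 0, which is not an exponent of az + 1.
  rw [← map_add] at hgg
  have hww : w + w' = 0 := hι.injective (hgg.trans (map_zero ι).symm)
  obtain rfl := neg_eq_of_add_eq_zero_right hww
  exact hg0 (by rw [eq_zero_of_mem_saturation_of_neg_mem hΛ hw hw', map_zero])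

end Weight

/-! ### Convergent expansions bound the order along D from below -/

section Divisorial

open AddMonoidAlgebra

variable {M : Type*} [AddCommGroup M] [Module.Free ℤ M] [Module.Finite ℤ M] {Λ : AddSubmonoid M}
variable {K : Type*} [Field K] [Algebra (AnalyticAlgebra Λ) K] [IsFractionRing (AnalyticAlgebra Λ) K]
variable {D : ExceptionalComponent (AnalyticAlgebra Λ) K} {ν : Valuation K ℤᵐ⁰}

theorem weight_pos (hΛ : IsGermSemigroup Λ) (hν : D.IsDivisorialValuation ν) {w : M}
    (hw : w ∈ saturation Λ) (hw0 : w ≠ 0) : 0 < weight hΛ ν w := by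
  have h := val_lt_one_of_mem_closedPointIdeal hν (laurentMonomial_mem_closedPointIdeal hΛ hw hw0)
  change ν (laurentMonomial K hΛ w) < 1 at h
  rw [val_laurentMonomial, ← WithZero.exp_zero, WithZero.exp_lt_exp] at h
  omega

theorem weight_nonneg (hΛ : IsGermSemigroup Λ) (hν : D.IsDivisorialValuation ν) {w : M}
    (hw : w ∈ saturation Λ) : 0 ≤ weight hΛ ν w := by
  by_cases h : w = 0
  · simp [h]
  · exact (weight_pos hΛ hν hw h).le

/-- Each non-constant monomial has integral positive weight, so at least 1. Thus the 𝔪-adic tails of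
a series vanish along D to arbitrarily high order. -/
theorem map_pow_le_filtration (hΛ : IsGermSemigroup Λ) (hν : D.IsDivisorialValuation ν) (k : ℕ) :
    (orbitMaximalIdeal Λ ^ k).map (algebraMap _ (AnalyticAlgebra Λ)) ≤ hν.filtration.ideal k := by
  induction k with
  | zero =>
    intro φ _
    rw [mem_filtration_iff_val]
    simpa using hν.algebraMap_le_one φ
  | succ k ih =>
    rw [pow_succ, Ideal.map_mul]
    refine Ideal.mul_le.2 fun a ha b hb => hν.filtration.mul_mem (ih ha) ?_
    refine (Ideal.map_le_iff_le_comap.2 (Ideal.span_le.2 ?_)) hb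
    rintro _ ⟨u, hu, rfl⟩
    change algebraMap _ (AnalyticAlgebra Λ) _ ∈ hν.filtration.ideal 1
    rw [mem_filtration_iff_val]
    change ν (algebraMap _ K (monomial u)) ≤ _
    rw [← laurentMonomial_of_mem K hΛ, val_laurentMonomial, WithZero.exp_le_exp]
    have := weight_pos hΛ hν (mem_saturation_of_mem u.2) (fun h => hu (Subtype.ext h))
    push_cast
    omega

/-- Cut the series modulo 𝔪^k: the tail lies in 𝔪^k R and so has order at least k, and the rest is a
finite sum of monomials to which the ultrametric inequality applies. -/
theorem val_le_of_forall_le_weight (hΛ : IsGermSemigroup Λ) (hν : D.IsDivisorialValuation ν)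
    {φ : AnalyticAlgebra Λ} {k : ℤ} (h : ∀ u : Λ, serCoeff φ u ≠ 0 → k ≤ weight hΛ ν u) :
    ν (algebraMap _ K φ) ≤ WithZero.exp (-k) := by
  let p : AddMonoidAlgebra ℂ Λ := ∑ u ∈ (finite_setOf_single_notMem_pow hΛ.fg k.toNat).toFinset,
    single u (serCoeff φ u)
  have hp : AdicCompletion.evalₐ (orbitMaximalIdeal Λ) k.toNat φ = Ideal.Quotient.mk _ p := by
    rw [evalₐ_eq_mk_iff hΛ]
    intro u hu
    rw [coeff_sum_single, if_pos (by simpa using hu)]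
  have h₁ : ν (algebraMap _ K (φ - algebraMap _ _ p)) ≤ WithZero.exp (-k) := by
    have h₂ : φ - algebraMap _ _ p ∈ hν.filtration.ideal k.toNat := by
      refine map_pow_le_filtration hΛ hν _ (mem_map_pow_of_evalₐ_eq_zero hΛ ?_)
      rw [map_sub, hp, algebraMap_eq_of, AdicCompletion.evalₐ_of, sub_self]
    refine le_trans ((mem_filtration_iff_val hν).1 h₂) ?_
    rw [WithZero.exp_le_exp]
    have := Int.self_le_toNat k
    omega
  have h₂ : ν (algebraMap _ K (algebraMap _ (AnalyticAlgebra Λ) p)) ≤ WithZero.exp (-k) := by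
    simp only [p, map_sum]
    refine ν.map_sum_le fun u _ => ?_
    by_cases hu : serCoeff φ u = 0
    · simp [hu]
    rw [algebraMap_eq_of, of_single_eq, map_mul, map_mul, ← laurentMonomial_of_mem K hΛ,
      val_laurentMonomial]
    refine le_trans (mul_le_of_le_one_left' (hν.algebraMap_le_one _)) ?_
    rw [WithZero.exp_le_exp]
    have := h u hu
    omega
  have e : φ = (φ - algebraMap _ _ p) + algebraMap _ _ p := by ring
  rw [e, map_add]
  exact ν.map_add_le h₁ h₂

end Divisorial

/-! ### Monomial valuations on Laurent monomials -/

section MonomialValuation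

variable {M : Type*} [AddCommGroup M] {Λ : AddSubmonoid M}
variable {K : Type*} [Field K] [Algebra (AnalyticAlgebra Λ) K]

/-- `μ` is the monomial valuation with weights `θ`. -/
def IsMonomialValuation (θ : M →+ ℝ) (μ : AddValuation K (WithTop ℝ)) : Prop :=
  ∀ φ : AnalyticAlgebra Λ, φ ≠ 0 →
    (∃ u, serCoeff φ u ≠ 0 ∧ μ (algebraMap _ K φ) = (θ u : ℝ)) ∧
    ∀ u, serCoeff φ u ≠ 0 → μ (algebraMap _ K φ) ≤ (θ u : ℝ)

theorem IsMonomialValuation.nonneg {θ : M →+ ℝ} {μ : AddValuation K (WithTop ℝ)}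
    (hμ : IsMonomialValuation (Λ := Λ) θ μ) (hθ : ∀ u ∈ Λ, 0 ≤ θ u) (φ : AnalyticAlgebra Λ) :
    0 ≤ μ (algebraMap _ K φ) := by
  by_cases h : φ = 0
  · simp [h]
  · obtain ⟨u, -, hu⟩ := (hμ φ h).1
    rw [hu]
    exact WithTop.coe_le_coe.2 (hθ u u.2)

variable [Module.Free ℤ M] [IsFractionRing (AnalyticAlgebra Λ) K]

theorem IsMonomialValuation.laurentMonomial {θ : M →+ ℝ} {μ : AddValuation K (WithTop ℝ)}
    (hμ : IsMonomialValuation (Λ := Λ) θ μ) (hΛ : IsGermSemigroup Λ) (w : M) :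
    μ (laurentMonomial K hΛ w) = (θ w : ℝ) := by
  have h : ∀ u : Λ, μ (algebraMap _ K (monomial u)) = (θ u : ℝ) := fun u => by
    obtain ⟨v, hv, h⟩ := (hμ _ (monomial_ne_zero hΛ u)).1
    rw [serCoeff_monomial hΛ] at hv
    by_cases e : u = v
    · rw [h, e]
    · simp [e] at hv
  obtain ⟨u, hu, v, hv, rfl⟩ := exists_sub_eq hΛ.closure_eq_top w
  rw [laurentMonomial_eq K hΛ ⟨u, hu⟩ ⟨v, hv⟩ rfl, μ.map_div, h, h, map_sub]
  rfl

/-- The weight as a real linear form. -/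
noncomputable def realWeight (hΛ : IsGermSemigroup Λ) (ν : Valuation K ℤᵐ⁰) : M →+ ℝ :=
  (Int.castAddHom ℝ).comp (weight hΛ ν).toAddMonoidHom

theorem realWeight_apply (hΛ : IsGermSemigroup Λ) (ν : Valuation K ℤᵐ⁰) (w : M) :
    realWeight hΛ ν w = weight hΛ ν w := rfl

end MonomialValuation

/-! ### The divisorial valuation is monomial -/

section Comparison

variable {M : Type*} [AddCommGroup M] [Module.Free ℤ M] [Module.Finite ℤ M] {Λ : AddSubmonoid M}
variable {K : Type*} [Field K] [Algebra (AnalyticAlgebra Λ) K] [IsFractionRing (AnalyticAlgebra Λ) K]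
variable {Γ : Type*} [AddCommGroup Γ] [LinearOrder Γ] [IsOrderedAddMonoid Γ] {ι : M →+ Γ}

/-- Multiplication by X^e, with e a conductor, carries an element of R̄ into R and shifts both
exponents and value by e. This extends the minimum formula from R to R̄. -/
theorem IsMonomialValuation.exponents {θ : M →+ ℝ} {μ : AddValuation K (WithTop ℝ)}
    (hμ : IsMonomialValuation (Λ := Λ) θ μ) (hΛ : IsGermSemigroup Λ)
    (hι : IsPositiveEmbedding Λ ι) {r : K} (hr : IsIntegral (AnalyticAlgebra Λ) r) (hr0 : r ≠ 0) :
    (∃ w ∈ exponents hΛ hι r, μ r = (θ w : ℝ)) ∧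
      ∀ w ∈ exponents hΛ hι r, μ r ≤ (θ w : ℝ) := by
  obtain ⟨e, he, hcond⟩ := exists_conductor hΛ
  obtain ⟨φ, hφ⟩ := exists_algebraMap_eq_laurentMonomial_mul hΛ hι hcond hr
  have hφ0 : φ ≠ 0 := by
    rintro rfl
    rw [map_zero] at hφ
    exact mul_ne_zero (laurentMonomial_ne_zero K hΛ e) hr0 hφ.symm
  obtain ⟨m, hm⟩ := WithTop.ne_top_iff_exists.1 ((μ.ne_top_iff).2 hr0)
  have hμφ : μ (algebraMap _ K φ) = ((θ e + m : ℝ) : WithTop ℝ) := by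
    rw [hφ, μ.map_mul, hμ.laurentMonomial hΛ, ← hm]; rfl
  obtain ⟨⟨u, hu, h₁⟩, h₂⟩ := hμ φ hφ0
  rw [hμφ] at h₁ h₂
  simp only [WithTop.coe_eq_coe, WithTop.coe_le_coe] at h₁ h₂
  rw [← hm]
  refine ⟨⟨u - e, ?_, ?_⟩, fun w hw => ?_⟩
  · rw [← mem_exponents_laurentMonomial_mul (v := e), ← hφ, mem_exponents_algebraMap]
    exact ⟨u, hu, by abel⟩
  · rw [map_sub, ← h₁, add_sub_cancel_left]
  · rw [← mem_exponents_laurentMonomial_mul (v := e), ← hφ, mem_exponents_algebraMap] at hw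
    obtain ⟨v, hv, hve⟩ := hw
    have := h₂ v hv
    rw [hve, map_add] at this
    exact WithTop.coe_le_coe.2 (by linarith)

variable {D : ExceptionalComponent (AnalyticAlgebra Λ) K} {ν : Valuation K ℤᵐ⁰}

/-- Elements of the closed point ideal have no constant term, so their value is at least the minimum
θ(w₀), and f attains it. As θ need not be the weight, this also serves its perturbations. -/
theorem IsMonomialValuation.nonneg_chart {θ : M →+ ℝ} {μ : AddValuation K (WithTop ℝ)}
    (hμ : IsMonomialValuation (Λ := Λ) θ μ) (hΛ : IsGermSemigroup Λ)
    (hι : IsPositiveEmbedding Λ ι) (hθ : ∀ u ∈ Λ, 0 ≤ θ u) {w₀ : M}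
    (hw₀ : w₀ ∈ ToricGerm.exponents hΛ hι (D.f : K))
    (hmin : ∀ w ∈ saturation Λ, w ≠ 0 → θ w₀ ≤ θ w) :
    (∀ b : NormalizedChart (AnalyticAlgebra Λ) K D.f, 0 ≤ μ (b : K)) ∧
      μ (D.f : K) = (θ w₀ : ℝ) := by
  have hf : (D.f : K) ≠ 0 := fun h => D.f_ne_zero (Subtype.ext h)
  have h₁ : μ (D.f : K) ≤ (θ w₀ : ℝ) := (hμ.exponents hΛ hι D.f.2 hf).2 _ hw₀
  have h₂ : ∀ a ∈ closedPointIdeal (AnalyticAlgebra Λ) K, ((θ w₀ : ℝ) : WithTop ℝ) ≤ μ (a : K) := by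
    intro a ha
    by_cases ha0 : (a : K) = 0
    · simp [ha0]
    obtain ⟨w, hw, e⟩ := (hμ.exponents hΛ hι a.2 ha0).1
    rw [e]
    refine WithTop.coe_le_coe.2 (hmin w (exponents_subset_saturation hΛ hι a.2 hw) ?_)
    rintro rfl
    exact zero_notMem_exponents hΛ hι ha hw
  exact ⟨addValuation_nonneg_chart μ (hμ.nonneg hθ) D.f_ne_zero fun a ha => h₁.trans (h₂ a ha),
    le_antisymm h₁ (h₂ _ D.f_mem)⟩

/-- The inequality v_D ≥ μ on R̄, reduced to R by a conductor monomial. -/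
theorem val_le_of_forall_exponents (hΛ : IsGermSemigroup Λ) (hν : D.IsDivisorialValuation ν)
    (hι : IsPositiveEmbedding Λ ι) {r : K} (hr : IsIntegral (AnalyticAlgebra Λ) r) {k : ℤ}
    (h : ∀ w ∈ exponents hΛ hι r, k ≤ weight hΛ ν w) : ν r ≤ WithZero.exp (-k) := by
  obtain ⟨e, he, hcond⟩ := exists_conductor hΛ
  obtain ⟨φ, hφ⟩ := exists_algebraMap_eq_laurentMonomial_mul hΛ hι hcond hr
  have h₁ : ν (algebraMap _ K φ) ≤ WithZero.exp (-(weight hΛ ν e + k)) := by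
    refine val_le_of_forall_le_weight hΛ hν fun u hu => ?_
    have h₂ : (u : M) ∈ exponents hΛ hι (algebraMap _ K φ) :=
      (mem_exponents_algebraMap hΛ hι).2 ⟨u, hu, rfl⟩
    rw [hφ, show (u : M) = e + (u - e) by abel, mem_exponents_laurentMonomial_mul] at h₂
    have := h _ h₂
    rw [map_sub] at this
    linarith
  rw [hφ, map_mul, val_laurentMonomial, neg_add, WithZero.exp_add] at h₁
  exact (mul_le_mul_iff_right₀ (zero_lt_iff.2 (WithZero.exp_ne_zero))).1 h₁

theorem isPositiveEmbedding_weight (hΛ : IsGermSemigroup Λ) (hν : D.IsDivisorialValuation ν) :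
    IsPositiveEmbedding Λ (lexEmbedding (realWeight hΛ ν)) :=
  isPositiveEmbedding_lexEmbedding fun u hu h => by
    rw [realWeight_apply]
    exact_mod_cast weight_pos hΛ hν (mem_saturation_of_mem hu) h

/-- The order of vanishing of the equation of the exceptional divisor along `D` is the least weight
of a nonzero element of the saturation. -/
theorem exists_exponent_of_equation (hΛ : IsGermSemigroup Λ) (hν : D.IsDivisorialValuation ν)
    (hι : IsPositiveEmbedding Λ ι) :
    ∃ w₀ ∈ saturation Λ, w₀ ≠ 0 ∧ w₀ ∈ exponents hΛ hι (D.f : K) ∧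
      ν (D.f : K) = WithZero.exp (-weight hΛ ν w₀) ∧
      ∀ w ∈ saturation Λ, w ≠ 0 → weight hΛ ν w₀ ≤ weight hΛ ν w := by
  have hf : (D.f : K) ≠ 0 := fun h => D.f_ne_zero (Subtype.ext h)
  obtain ⟨μ, hμ⟩ := exists_monomialValuation K hΛ (θ := realWeight hΛ ν) fun u hu h => by
    rw [realWeight_apply]
    exact_mod_cast weight_pos hΛ hν (mem_saturation_of_mem hu) h
  replace hμ : IsMonomialValuation _ μ := hμ
  obtain ⟨⟨w₀, hw₀, h₁⟩, h₂⟩ := hμ.exponents hΛ hι D.f.2 hf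
  have hsat := exponents_subset_saturation hΛ hι D.f.2 hw₀
  have hne : w₀ ≠ 0 := by
    rintro rfl
    exact zero_notMem_exponents hΛ hι D.f_mem hw₀
  -- One bound comes from the expansion of f, in which w₀ has least weight. The other, `h₄`, holds
  -- because f divides every X^w of the closed point ideal on the chart.
  have h₃ : ν (D.f : K) ≤ WithZero.exp (-weight hΛ ν w₀) := by
    refine val_le_of_forall_exponents hΛ hν hι D.f.2 fun w hw => ?_
    have := h₂ w hw
    rw [h₁, WithTop.coe_le_coe, realWeight_apply, realWeight_apply] at this
    exact_mod_cast this
  have h₄ : ∀ w ∈ saturation Λ, w ≠ 0 → WithZero.exp (-weight hΛ ν w) ≤ ν (D.f : K) := by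
    intro w hw hw0
    rw [← val_laurentMonomial]
    exact val_le_val_of_mem_closedPointIdeal hν (laurentMonomial_mem_closedPointIdeal hΛ hw hw0)
  refine ⟨w₀, hsat, hne, hw₀, le_antisymm h₃ (h₄ w₀ hsat hne), fun w hw hw0 => ?_⟩
  have := (h₄ w hw hw0).trans h₃
  rw [WithZero.exp_le_exp] at this
  omega

/-- The monomial valuation of the weight is non-negative on the chart, and its centre is `D`. -/
theorem exists_monomialValuation_weight (hΛ : IsGermSemigroup Λ)
    (hν : D.IsDivisorialValuation ν) : ∃ μ : AddValuation K (WithTop ℝ),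
      IsMonomialValuation (Λ := Λ) (realWeight hΛ ν) μ ∧
      (∀ b : NormalizedChart (AnalyticAlgebra Λ) K D.f, 0 ≤ μ (b : K)) ∧
      ∀ b : NormalizedChart (AnalyticAlgebra Λ) K D.f, 0 < μ (b : K) ↔ b ∈ D.prime := by
  have hf : (D.f : K) ≠ 0 := fun h => D.f_ne_zero (Subtype.ext h)
  have hpos : ∀ u ∈ saturation Λ, u ≠ 0 → 0 < realWeight hΛ ν u := fun u hu h => by
    rw [realWeight_apply]
    exact_mod_cast weight_pos hΛ hν hu h
  obtain ⟨μ, hμ⟩ := exists_monomialValuation K hΛ fun u hu h =>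
    hpos u (mem_saturation_of_mem hu) h
  replace hμ : IsMonomialValuation _ μ := hμ
  have hι := isPositiveEmbedding_weight hΛ hν
  obtain ⟨w₀, hsat, hne, hw₀, hνf, hmin⟩ := exists_exponent_of_equation hΛ hν hι
  obtain ⟨h₀, hμf⟩ := hμ.nonneg_chart hΛ hι (fun u hu => by
    rw [realWeight_apply]
    exact_mod_cast weight_nonneg hΛ hν (mem_saturation_of_mem hu)) hw₀ fun w hw hw0 => by
      rw [realWeight_apply, realWeight_apply]
      exact_mod_cast hmin w hw hw0
  refine ⟨μ, hμ, h₀, addValuation_pos_iff_mem_prime hν μ h₀ (fun a ha => ?_) fun b hb => ?_⟩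
  · by_cases ha0 : (a : K) = 0
    · simp [ha0]
    obtain ⟨w, hw, e⟩ := (hμ.exponents hΛ hι a.2 ha0).1
    rw [e]
    refine WithTop.coe_lt_coe.2 (hpos w (exponents_subset_saturation hΛ hι a.2 hw) ?_)
    rintro rfl
    exact zero_notMem_exponents hΛ hι ha hw
  · by_cases hb0 : (b : K) = 0
    · simp [hb0]
    -- For f^k b ∈ R̄ the order along D is at least its μ-value, and f has the same value for both.
    -- So μ(b) > 0 makes the order of b along D positive.
    obtain ⟨k, hk⟩ := exists_pow_mul_mem_normalization D.f_ne_zero b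
    obtain ⟨⟨w, hw, h₁⟩, h₂⟩ := hμ.exponents hΛ hι hk (mul_ne_zero (pow_ne_zero k hf) hb0)
    rw [h₁] at h₂
    have h₃ := val_le_of_forall_exponents hΛ hν hι hk (k := weight hΛ ν w) fun w' hw' => by
      have := WithTop.coe_le_coe.1 (h₂ w' hw')
      rw [realWeight_apply, realWeight_apply] at this
      exact_mod_cast this
    obtain ⟨m, hm⟩ := WithTop.ne_top_iff_exists.1 ((μ.ne_top_iff).2 hb0)
    rw [μ.map_mul, μ.map_pow, hμf, ← hm] at h₁
    rw [← hm] at hb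
    have hb' : 0 < m := WithTop.coe_lt_coe.1 hb
    have h₁' : k * (weight hΛ ν w₀ : ℝ) + m = weight hΛ ν w := by
      rw [← WithTop.coe_nsmul, ← WithTop.coe_add, WithTop.coe_eq_coe, nsmul_eq_mul] at h₁
      exact h₁
    have h₄ : (k : ℤ) * weight hΛ ν w₀ < weight hΛ ν w := by
      have : (k : ℝ) * (weight hΛ ν w₀ : ℝ) < weight hΛ ν w := by linarith
      exact_mod_cast this
    rw [map_mul, map_pow, hνf, ← WithZero.exp_nsmul] at h₃
    by_contra hlt
    have h₅ : WithZero.exp (k • -weight hΛ ν w₀) ≤ WithZero.exp (-weight hΛ ν w) :=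
      le_trans (le_mul_of_one_le_right' (not_lt.1 hlt)) h₃
    rw [WithZero.exp_le_exp, nsmul_eq_mul] at h₅
    linarith

/-- The divisorial valuation is the monomial valuation of the weight. -/
theorem exists_weight_eq_val (hΛ : IsGermSemigroup Λ) (hν : D.IsDivisorialValuation ν)
    {φ : AnalyticAlgebra Λ} (hφ : φ ≠ 0) : ∃ u : Λ, serCoeff φ u ≠ 0 ∧
      ν (algebraMap _ K φ) = WithZero.exp (-weight hΛ ν u) ∧
      ∀ v : Λ, serCoeff φ v ≠ 0 → weight hΛ ν u ≤ weight hΛ ν v := by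
  obtain ⟨μ, hμ, h₀, h⟩ := exists_monomialValuation_weight hΛ hν
  obtain ⟨⟨u, hu, h₁⟩, h₂⟩ := hμ φ hφ
  have hφK : algebraMap _ K φ ≠ 0 := fun h' =>
    hφ (IsFractionRing.injective (AnalyticAlgebra Λ) K (h'.trans (map_zero _).symm))
  refine ⟨u, hu, ?_, fun v hv => ?_⟩
  · have hX := laurentMonomial_ne_zero K hΛ (u : M)
    -- The quotient φ/X^u and its inverse both have μ-value 0, so neither has positive order along
    -- D. Hence φ and X^u have equal order.
    have hμ0 : μ (algebraMap _ K φ / laurentMonomial K hΛ (u : M)) = 0 := by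
      rw [μ.map_div, h₁, hμ.laurentMonomial hΛ]
      exact WithTop.coe_eq_coe.2 (sub_self _)
    have hμ1 : μ (algebraMap _ K φ / laurentMonomial K hΛ (u : M))⁻¹ = 0 := by
      rw [μ.map_inv, hμ0, neg_zero]
    have e₁ : 1 ≤ ν (algebraMap _ K φ / laurentMonomial K hΛ (u : M)) := not_lt.1 fun hlt =>
      (addValuation_pos_of_val_lt_one hν μ h₀ h hlt).ne' hμ0
    have e₂ : 1 ≤ ν (algebraMap _ K φ / laurentMonomial K hΛ (u : M))⁻¹ := not_lt.1 fun hlt =>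
      (addValuation_pos_of_val_lt_one hν μ h₀ h hlt).ne' hμ1
    rw [map_inv₀, one_le_inv₀ (lt_of_lt_of_le zero_lt_one e₁)] at e₂
    have e₃ := le_antisymm e₂ e₁
    rw [map_div₀, div_eq_one_iff_eq ((ν.ne_zero_iff).2 hX), val_laurentMonomial] at e₃
    exact e₃
  · have := h₂ v hv
    rw [h₁, WithTop.coe_le_coe, realWeight_apply, realWeight_apply] at this
    exact_mod_cast this

end Comparison

/-! ### Small perturbations of a positive form -/

section Perturbation

variable {M : Type*} [AddCommGroup M] [Module.Free ℤ M] [Module.Finite ℤ M] {Λ : AddSubmonoid M}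

/-- A linear form is dominated on the saturation by any form which is positive on `Λ - {0}`. -/
theorem exists_abs_le_mul (hΛ : IsGermSemigroup Λ) {N : Module.Dual ℤ M}
    (hN : ∀ u ∈ Λ, u ≠ 0 → 0 < N u) (η : M →+ ℝ) :
    ∃ C : ℝ, 0 < C ∧ ∀ w ∈ saturation Λ, |η w| ≤ C * N w := by
  obtain ⟨S, hS⟩ := hΛ.fg
  have hSΛ : ∀ s ∈ S, s ∈ Λ := fun s hs => hS ▸ AddSubmonoid.subset_closure hs
  have hC : ∀ u ∈ Λ, |η u| ≤ (∑ s ∈ S, |η s| + 1) * N u := by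
    intro u hu
    rw [← hS] at hu
    induction hu using AddSubmonoid.closure_induction with
    | mem s hs =>
      by_cases h0 : s = 0
      · simp [h0]
      -- N takes integral values, so each nonzero generator has N at least 1 and one constant bounds
      -- η on all generators at once.
      have h1 : (1 : ℝ) ≤ N s := by exact_mod_cast hN s (hSΛ s hs) h0
      have h2 : |η s| ≤ ∑ s ∈ S, |η s| :=
        Finset.single_le_sum (f := fun s => |η s|) (fun _ _ => abs_nonneg _) hs
      nlinarith [abs_nonneg (η s)]
    | zero => simp
    | add x y _ _ hx hy =>
      rw [map_add, map_add, Int.cast_add, mul_add]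
      exact (abs_add_le _ _).trans (add_le_add hx hy)
  refine ⟨∑ s ∈ S, |η s| + 1, by positivity, fun w hw => ?_⟩
  obtain ⟨k, hk, hkw⟩ := exists_nsmul_mem_of_mem_saturation hΛ hw
  have h := hC _ hkw
  have hk' : (0 : ℝ) < k := by exact_mod_cast hk
  rw [map_nsmul, map_nsmul, nsmul_eq_mul, nsmul_eq_mul, abs_mul, Nat.abs_cast] at h
  push_cast at h
  refine le_of_mul_le_mul_left ?_ hk'
  linarith

/-- A small perturbation of a positive form `N` by a form which is constant where `N` is minimal
is still positive, with the same minimum. -/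
theorem exists_perturbation (hΛ : IsGermSemigroup Λ) {N : Module.Dual ℤ M}
    (hN : ∀ u ∈ saturation Λ, u ≠ 0 → 0 < N u) (η : M →+ ℝ) {w₀ : M} (hw₀ : w₀ ∈ saturation Λ)
    (hne : w₀ ≠ 0) (hmin : ∀ w ∈ saturation Λ, w ≠ 0 → N w₀ ≤ N w)
    (hη : ∀ w ∈ saturation Λ, w ≠ 0 → N w = N w₀ → η w = η w₀) :
    ∃ ε : ℝ, 0 < ε ∧ ∀ σ : ℝ, |σ| = ε → (∀ w ∈ saturation Λ, w ≠ 0 → 0 < N w + σ * η w) ∧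
      ∀ w ∈ saturation Λ, w ≠ 0 → N w₀ + σ * η w₀ ≤ N w + σ * η w := by
  obtain ⟨C, hC, hCη⟩ := exists_abs_le_mul hΛ (fun u hu => hN u (mem_saturation_of_mem hu)) η
  have hd : (0 : ℝ) < N w₀ := by exact_mod_cast hN w₀ hw₀ hne
  -- Off the minimal set, integrality gives N w ≥ N w₀ + 1. The perturbation changes N w and N w₀ by
  -- at most a factor δ, and (1 - δ)(N w₀ + 1) = (1 + δ) N w₀ for exactly this δ.
  set δ : ℝ := 1 / (2 * N w₀ + 1) with hδ
  have hδ0 : 0 < δ := by positivity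
  have hδ1 : δ * (2 * N w₀ + 1) = 1 := by rw [hδ]; field_simp
  have hδ2 : δ < 1 := by nlinarith
  refine ⟨δ / C, by positivity, fun σ hσ => ?_⟩
  have hb : ∀ w ∈ saturation Λ, |σ * η w| ≤ δ * N w := by
    intro w hw
    rw [abs_mul, hσ]
    calc δ / C * |η w| ≤ δ / C * (C * N w) := by gcongr; exact hCη w hw
      _ = δ * N w := by field_simp
  refine ⟨fun w hw hw0 => ?_, fun w hw hw0 => ?_⟩
  · have h1 : (0 : ℝ) < N w := by exact_mod_cast hN w hw hw0
    have := (abs_le.1 (hb w hw)).1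
    nlinarith
  · rcases (hmin w hw hw0).eq_or_lt with h | h
    · rw [hη w hw hw0 h.symm, h]
    · have h1 : (N w₀ : ℝ) + 1 ≤ N w := by exact_mod_cast h
      have h2 := (abs_le.1 (hb w hw)).1
      have h3 := (abs_le.1 (hb w₀ hw₀)).2
      nlinarith

end Perturbation

/-! ### Rigidity of the weight: its cone in the dual Newton diagram is a ray -/

section RayVector

variable {M : Type*} [AddCommGroup M] [Module.Free ℤ M] [Module.Finite ℤ M] {Λ : AddSubmonoid M}
variable {K : Type*} [Field K] [Algebra (AnalyticAlgebra Λ) K] [IsFractionRing (AnalyticAlgebra Λ) K]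
variable {D : ExceptionalComponent (AnalyticAlgebra Λ) K} {ν : Valuation K ℤᵐ⁰}

/-- A linear form which is constant on the nonzero elements of the saturation of least weight is
proportional to the weight. -/
theorem eq_zero_of_weight_eq_zero (hΛ : IsGermSemigroup Λ) (hν : D.IsDivisorialValuation ν)
    {η : M →+ ℝ} (hη : ∀ u ∈ saturation Λ, u ≠ 0 →
      (∀ w ∈ saturation Λ, w ≠ 0 → weight hΛ ν u ≤ weight hΛ ν w) →
      ∀ v ∈ saturation Λ, v ≠ 0 → weight hΛ ν v = weight hΛ ν u → η v = η u)
    {w : M} (hw : weight hΛ ν w = 0) : η w = 0 := by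
  have hf : (D.f : K) ≠ 0 := fun h => D.f_ne_zero (Subtype.ext h)
  have hι := isPositiveEmbedding_weight hΛ hν
  obtain ⟨w₀, hsat, hne, hw₀, hνf, hmin⟩ := exists_exponent_of_equation hΛ hν hι
  obtain ⟨ε, hε, hpert⟩ := exists_perturbation hΛ (fun u hu h => weight_pos hΛ hν hu h) η hsat hne
    hmin (hη w₀ hsat hne hmin)
  obtain ⟨μ, hμ, h₀, hprime⟩ := exists_monomialValuation_weight hΛ hν
  have hμf : μ (D.f : K) = ((weight hΛ ν w₀ : ℝ) : WithTop ℝ) :=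
    (hμ.nonneg_chart hΛ hι (fun u hu => by
      rw [realWeight_apply]
      exact_mod_cast weight_nonneg hΛ hν (mem_saturation_of_mem hu)) hw₀ fun w hw hw0 => by
        rw [realWeight_apply, realWeight_apply]
        exact_mod_cast hmin w hw hw0).2
  -- The same exponent w₀ of f minimises both perturbed forms, so both of their valuations are
  -- non-negative on the chart of D.
  have key : ∀ σ : ℝ, |σ| = ε → ∃ μ' : AddValuation K (WithTop ℝ),
      IsMonomialValuation (Λ := Λ) (realWeight hΛ ν + σ • η) μ' ∧
      (∀ b : NormalizedChart (AnalyticAlgebra Λ) K D.f, 0 ≤ μ' (b : K)) ∧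
      μ' (D.f : K) = ((weight hΛ ν w₀ + σ * η w₀ : ℝ) : WithTop ℝ) := by
    intro σ hσ
    obtain ⟨h₁, h₂⟩ := hpert σ hσ
    obtain ⟨μ', hμ'⟩ := exists_monomialValuation K hΛ (θ := realWeight hΛ ν + σ • η)
      fun u hu h => h₁ u (mem_saturation_of_mem hu) h
    obtain ⟨h₃, h₄⟩ := IsMonomialValuation.nonneg_chart (Λ := Λ) (μ := μ') (D := D) hμ' hΛ hι
      (fun u hu => by
        by_cases h : u = 0
        · rw [h, map_zero]
        · exact (h₁ u (mem_saturation_of_mem hu) h).le) hw₀ h₂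
    exact ⟨μ', hμ', h₃, h₄⟩
  obtain ⟨μp, hμp, hp0, hpf⟩ := key ε (abs_of_pos hε)
  obtain ⟨μm, hμm, hm0, hmf⟩ := key (-ε) (by rw [abs_neg, abs_of_pos hε])
  have bound : ∀ (σ : ℝ) (μ' : AddValuation K (WithTop ℝ)),
      IsMonomialValuation (Λ := Λ) (realWeight hΛ ν + σ • η) μ' →
      (∀ b : NormalizedChart (AnalyticAlgebra Λ) K D.f, 0 ≤ μ' (b : K)) →
      μ' (D.f : K) = ((weight hΛ ν w₀ + σ * η w₀ : ℝ) : WithTop ℝ) →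
      ∀ (b : NormalizedChart (AnalyticAlgebra Λ) K D.f), (b : K) ≠ 0 → ∀ k : ℕ,
      IsIntegral (AnalyticAlgebra Λ) ((D.f : K) ^ k * (b : K)) →
      ∃ m : ℝ, μ' (b : K) = (m : WithTop ℝ) ∧ 0 ≤ m ∧
      ∀ v ∈ exponents hΛ hι ((D.f : K) ^ k * (b : K)),
        k * (weight hΛ ν w₀ + σ * η w₀) + m ≤ weight hΛ ν v + σ * η v := by
    intro σ μ' hμ' hb' hf' b hb0 k hk
    obtain ⟨m, hm⟩ := WithTop.ne_top_iff_exists.1 ((μ'.ne_top_iff).2 hb0)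
    refine ⟨m, hm.symm, WithTop.coe_le_coe.1 (hm ▸ hb' b), fun v hv => ?_⟩
    have h := (hμ'.exponents hΛ hι hk (mul_ne_zero (pow_ne_zero k hf) hb0)).2 v hv
    rw [μ'.map_mul, μ'.map_pow, hf', ← hm, ← WithTop.coe_nsmul, ← WithTop.coe_add,
      WithTop.coe_le_coe, nsmul_eq_mul] at h
    exact h
  -- Outside the prime μ(b) = 0, so some exponent v of f^k b has weight exactly k times that of w₀.
  have unit : ∀ b : NormalizedChart (AnalyticAlgebra Λ) K D.f, b ∉ D.prime → μp (b : K) = 0 := by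
    intro b hb
    have hb0 : (b : K) ≠ 0 := fun h => hb (by
      rw [show b = 0 from Subtype.ext h]; exact zero_mem _)
    obtain ⟨k, hk⟩ := exists_pow_mul_mem_normalization D.f_ne_zero b
    have hμb : μ (b : K) = 0 :=
      le_antisymm (not_lt.1 fun h => hb ((hprime b).1 h)) (h₀ b)
    obtain ⟨v, hv, h₁⟩ := (hμ.exponents hΛ hι hk (mul_ne_zero (pow_ne_zero k hf) hb0)).1
    rw [μ.map_mul, μ.map_pow, hμf, hμb, add_zero, ← WithTop.coe_nsmul, WithTop.coe_eq_coe,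
      nsmul_eq_mul, realWeight_apply] at h₁
    obtain ⟨m, hm, hm1, hm2⟩ := bound ε μp hμp hp0 hpf b hb0 k hk
    obtain ⟨m', -, hm1', hm2'⟩ := bound (-ε) μm hμm hm0 hmf b hb0 k hk
    -- Adding the bounds for ε and -ε at v cancels η and leaves m + m' ≤ 0. Both are non-negative,
    -- so m = 0.
    have e₁ := hm2 v hv
    have e₂ := hm2' v hv
    rw [hm]
    refine WithTop.coe_eq_coe.2 (le_antisymm ?_ hm1)
    nlinarith
  have hX : ν (laurentMonomial K hΛ w) = 1 := by
    rw [val_laurentMonomial, hw, neg_zero, WithZero.exp_zero]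
  obtain ⟨a, s, hs, e⟩ := (hν.le_one_iff _).1 hX.le
  have hνs : ν (s : K) = 1 := le_antisymm (val_chart_le_one hν s)
    (not_lt.1 fun h => hs ((val_chart_lt_one_iff hν s).1 h))
  have ha : a ∉ D.prime := fun h => by
    have := (val_chart_lt_one_iff hν a).2 h
    rw [e, map_div₀, hνs, div_one] at hX
    exact this.ne hX
  have h := hμp.laurentMonomial hΛ w
  rw [e, μp.map_div, unit a ha, unit s hs] at h
  have h' : (0 : ℝ) = realWeight hΛ ν w + ε * η w := by
    have : ((0 - 0 : ℝ) : WithTop ℝ) = ((realWeight hΛ ν w + ε * η w : ℝ) : WithTop ℝ) := h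
    simpa using WithTop.coe_eq_coe.1 this
  rw [realWeight_apply, hw] at h'
  simpa [hε.ne'] using h'

end RayVector

/-! ### Newton polyhedra and their faces -/

section Polyhedron

variable {M : Type*} [AddCommGroup M] {Λ : AddSubmonoid M} {I : Set M}
  {η : Module.Dual ℝ (ℝ ⊗[ℤ] M)}

theorem dual_ext {η₁ η₂ : Module.Dual ℝ (ℝ ⊗[ℤ] M)}
    (h : ∀ u : M, η₁ (latticePoint u) = η₂ (latticePoint u)) : η₁ = η₂ := by
  refine TensorProduct.AlgebraTensorModule.ext fun x y => ?_
  have e : x ⊗ₜ[ℤ] y = x • latticePoint y := by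
    rw [latticePoint, TensorProduct.smul_tmul', smul_eq_mul, mul_one]
  rw [e, map_smul, map_smul, h]

theorem le_of_mem_newtonPolyhedron (hη : η ∈ dualConeRho Λ) {c : ℝ}
    (h : ∀ a ∈ I, c ≤ η (latticePoint a)) : ∀ v ∈ newtonPolyhedron Λ I, c ≤ η v := by
  intro v hv
  refine convexHull_min (t := {v | c ≤ η v}) ?_ (convex_halfSpace_ge η.isLinear c) hv
  simp only [Set.iUnion_subset_iff]
  rintro a ha _ ⟨v, hv, rfl⟩
  change c ≤ η (latticePoint a + v)
  rw [map_add]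
  exact le_add_of_le_of_nonneg (h a ha) (hη v hv)

theorem latticePoint_mem_newtonPolyhedron {a : M} (ha : a ∈ I) :
    latticePoint a ∈ newtonPolyhedron Λ I :=
  subset_convexHull _ _ (Set.mem_biUnion ha ⟨0, zero_mem _, add_zero _⟩)

/-- A form in ρ is non-negative on the recession cone, so a lower bound on the points of I persists
on the whole polyhedron and minimality need only be tested on I. -/
theorem latticePoint_mem_faceOf_iff (hη : η ∈ dualConeRho Λ) {a : M} (ha : a ∈ I) :
    latticePoint a ∈ faceOf (newtonPolyhedron Λ I) η ↔
      ∀ b ∈ I, η (latticePoint a) ≤ η (latticePoint b) :=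
  ⟨fun h _ hb => h.2 _ (latticePoint_mem_newtonPolyhedron hb),
    fun h => ⟨latticePoint_mem_newtonPolyhedron ha, le_of_mem_newtonPolyhedron hη h⟩⟩

/-- The restriction to the lattice of a linear form. -/
noncomputable def latticeForm (η : Module.Dual ℝ (ℝ ⊗[ℤ] M)) : M →+ ℝ where
  toFun w := η (latticePoint w)
  map_zero' := by rw [latticePoint_zero, map_zero]
  map_add' u v := by rw [latticePoint_add, map_add]

theorem baseChange_mem_dualConeRho_iff {n : Module.Dual ℤ M} :
    n.baseChange ℝ ∈ dualConeRho Λ ↔ ∀ u ∈ Λ, 0 ≤ n u := by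
  rw [mem_dualConeRho_iff]
  simp only [baseChange_latticePoint, Int.cast_nonneg_iff]

end Polyhedron

/-! ### Non-negativity of a ray vector on Λ -/

section PrimitiveRayVector

variable {M : Type*} [AddCommGroup M] {Λ : AddSubmonoid M}
variable {K : Type*} [Field K] [Algebra (AnalyticAlgebra Λ) K]
variable {D : ExceptionalComponent (AnalyticAlgebra Λ) K}

theorem IsPrimitiveRayVector.nonneg {n : Module.Dual ℤ M} (hn : IsPrimitiveRayVector Λ D n) :
    ∀ u ∈ Λ, 0 ≤ n u := by
  obtain ⟨η, -, h⟩ := hn.edge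
  have h₁ : n.baseChange ℝ ∈ ray n := ⟨1, zero_le_one, (one_smul _ _).symm⟩
  rw [h] at h₁
  exact baseChange_mem_dualConeRho_iff.1 h₁.1

end PrimitiveRayVector

/-! ### The coordinate ring of the toric chart inside K -/

section LaurentHom

open AddMonoidAlgebra

variable {M : Type*} [AddCommGroup M] [Module.Free ℤ M] {Λ : AddSubmonoid M}
variable (K : Type*) [Field K] [Algebra (AnalyticAlgebra Λ) K] [IsFractionRing (AnalyticAlgebra Λ) K]

/-- The embedding of the coordinate ring of the toric chart of a ray in the field of fractions. -/
noncomputable def laurentHom (hΛ : IsGermSemigroup Λ) (n : Module.Dual ℤ M) :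
    AddMonoidAlgebra ℂ (dualRaySemigroup n) →+* K :=
  liftNCRingHom ((algebraMap (AnalyticAlgebra Λ) K).comp (algebraMap ℂ (AnalyticAlgebra Λ)))
    { toFun := fun w => laurentMonomial K hΛ (w.toAdd : M)
      map_one' := laurentMonomial_zero K hΛ
      map_mul' := fun _ _ => laurentMonomial_add K hΛ _ _ } fun _ _ => Commute.all _ _

theorem laurentHom_single (hΛ : IsGermSemigroup Λ) {n : Module.Dual ℤ M} (w : dualRaySemigroup n)
    (z : ℂ) : laurentHom K hΛ n (single w z) =
      algebraMap (AnalyticAlgebra Λ) K (algebraMap ℂ _ z) * laurentMonomial K hΛ (w : M) :=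
  liftNCRingHom_single _ _ _ _ _

theorem laurentHom_single_of_mem (hΛ : IsGermSemigroup Λ) {n : Module.Dual ℤ M} (u : Λ)
    (hu : (u : M) ∈ dualRaySemigroup n) (z : ℂ) : laurentHom K hΛ n (single ⟨u, hu⟩ z) =
      algebraMap _ K (AdicCompletion.of (orbitMaximalIdeal Λ) _ (single u z)) := by
  rw [laurentHom_single, of_single_eq, map_mul, ← laurentMonomial_of_mem K hΛ]

theorem laurentHom_eq_sum (hΛ : IsGermSemigroup Λ) {n : Module.Dual ℤ M}
    (p : AddMonoidAlgebra ℂ (dualRaySemigroup n)) : laurentHom K hΛ n p =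
      ∑ w ∈ p.coeff.support, algebraMap (AnalyticAlgebra Λ) K (algebraMap ℂ _ (p.coeff w)) *
        laurentMonomial K hΛ (w : M) := by
  conv_lhs => rw [← sum_coeff_single p]
  rw [Finsupp.sum, map_sum]
  exact Finset.sum_congr rfl fun w _ => laurentHom_single K hΛ w _

/-- Laurent polynomials are quotients of elements of the analytic algebra by monomials. -/
theorem exists_laurentMonomial_mul_laurentHom (hΛ : IsGermSemigroup Λ) {n : Module.Dual ℤ M}
    (p : AddMonoidAlgebra ℂ (dualRaySemigroup n)) : ∃ (e : M) (φ : AnalyticAlgebra Λ),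
      algebraMap _ K φ = laurentMonomial K hΛ e * laurentHom K hΛ n p ∧
      ∀ w, p.coeff w ≠ 0 → ∃ u : Λ, (u : M) = e + w ∧ serCoeff φ u = p.coeff w := by
  classical
  obtain ⟨e, -, he⟩ := exists_add_mem hΛ (p.coeff.support.image Subtype.val)
  replace he : ∀ w : p.coeff.support, e + (w : dualRaySemigroup n) ∈ Λ := fun w =>
    he _ (Finset.mem_image_of_mem _ w.2)
  refine ⟨e, AdicCompletion.of (orbitMaximalIdeal Λ) _
    (∑ w : p.coeff.support, single ⟨_, he w⟩ (p.coeff w)), ?_, fun w hw => ?_⟩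
  · rw [laurentHom_eq_sum, Finset.mul_sum, ← Finset.sum_coe_sort p.coeff.support, map_sum, map_sum]
    refine Finset.sum_congr rfl fun w _ => ?_
    rw [of_single_eq, map_mul, ← laurentMonomial_of_mem K hΛ, laurentMonomial_add]
    ring
  · have hw' : w ∈ p.coeff.support := Finsupp.mem_support_iff.2 hw
    refine ⟨⟨_, he ⟨w, hw'⟩⟩, rfl, ?_⟩
    rw [serCoeff_of hΛ, coeff_sum, Finsupp.finsetSum_apply,
      Finset.sum_eq_single (⟨w, hw'⟩ : p.coeff.support)]
    · simp
    · intro v _ hv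
      rw [coeff_single, Finsupp.single_apply, if_neg]
      intro h
      exact hv (Subtype.ext (Subtype.ext (add_left_cancel (congrArg Subtype.val h))))
    · simp

variable {K} {D : ExceptionalComponent (AnalyticAlgebra Λ) K} {ν : Valuation K ℤᵐ⁰}

theorem val_laurentHom_single_le (hΛ : IsGermSemigroup Λ) (hν : D.IsDivisorialValuation ν)
    (w : M) (z : ℂ) : ν (algebraMap (AnalyticAlgebra Λ) K (algebraMap ℂ _ z) *
      laurentMonomial K hΛ w) ≤ WithZero.exp (-weight hΛ ν w) := by
  rw [map_mul, val_laurentMonomial]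
  exact mul_le_of_le_one_left' (hν.algebraMap_le_one _)

theorem val_laurentHom_le_one (hΛ : IsGermSemigroup Λ) (hν : D.IsDivisorialValuation ν)
    (p : AddMonoidAlgebra ℂ (dualRaySemigroup (weight hΛ ν))) :
    ν (laurentHom K hΛ _ p) ≤ 1 := by
  rw [laurentHom_eq_sum]
  refine ν.map_sum_le fun w _ => (val_laurentHom_single_le hΛ hν _ _).trans ?_
  rw [← WithZero.exp_zero, WithZero.exp_le_exp]
  have : 0 ≤ weight hΛ ν (w : M) := w.2
  omega

/-- The relation X^(u-v) X^v = X^u forces χ to send X^w to the Laurent monomial. If n(w) > 0, this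
monomial comes from the ideal of the orbit, hence lies in the maximal ideal of 𝒪_{B,D}. -/
theorem IsPrimitiveRayVector.weight_pos {n : Module.Dual ℤ M} (hn : IsPrimitiveRayVector Λ D n)
    (hΛ : IsGermSemigroup Λ) (hν : D.IsDivisorialValuation ν) {w : M} (hw : 0 < n w) :
    0 < weight hΛ ν w := by
  obtain ⟨χ, h₁, -, h₃⟩ := hn.generic_point
  obtain ⟨u, hu, v, hv, rfl⟩ := exists_sub_eq hΛ.closure_eq_top w
  have hu' : u ∈ dualRaySemigroup n := hn.nonneg u hu
  have hv' : v ∈ dualRaySemigroup n := hn.nonneg v hv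
  have hw' : u - v ∈ dualRaySemigroup n := hw.le
  have hχ : χ (single ⟨u - v, hw'⟩ 1) = laurentMonomial K hΛ (u - v) := by
    have e : χ (single ⟨u - v, hw'⟩ 1) * χ (single ⟨v, hv'⟩ 1) = χ (single ⟨u, hu'⟩ 1) := by
      rw [← map_mul, single_mul_single, one_mul]
      congr 2
      exact Subtype.ext (sub_add_cancel u v)
    rw [h₁ ⟨u, hu⟩ hu', h₁ ⟨v, hv⟩ hv'] at e
    rw [laurentMonomial_eq K hΛ ⟨u, hu⟩ ⟨v, hv⟩ rfl,
      eq_div_iff (algebraMap_monomial_ne_zero K hΛ _)]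
    exact e
  have h := (h₃ _).2 (Ideal.subset_span ⟨⟨u - v, hw'⟩, hw, rfl⟩)
  rw [hχ, mem_localMaximalIdeal_iff hν, val_laurentMonomial, ← WithZero.exp_zero,
    WithZero.exp_lt_exp] at h
  omega

end LaurentHom

/-! ### The weight is the unique primitive ray vector of D -/

section RayVector

open AddMonoidAlgebra

variable {M : Type*} [AddCommGroup M] [Module.Free ℤ M] [Module.Finite ℤ M] {Λ : AddSubmonoid M}
variable {K : Type*} [Field K] [Algebra (AnalyticAlgebra Λ) K] [IsFractionRing (AnalyticAlgebra Λ) K]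
variable {D : ExceptionalComponent (AnalyticAlgebra Λ) K} {ν : Valuation K ℤᵐ⁰}

theorem mem_filtration_iff (hΛ : IsGermSemigroup Λ) (hν : D.IsDivisorialValuation ν) {k : ℕ}
    {φ : AnalyticAlgebra Λ} : φ ∈ hν.filtration.ideal k ↔
      ∀ u, serCoeff φ u ≠ 0 → (k : ℤ) ≤ weight hΛ ν u := by
  rw [mem_filtration_iff_val]
  refine ⟨fun h v hv => ?_, val_le_of_forall_le_weight hΛ hν⟩
  have hφ : φ ≠ 0 := by
    rintro rfl
    exact hv (serCoeff_zero hΛ v)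
  obtain ⟨u, -, h₁, h₂⟩ := exists_weight_eq_val hΛ hν hφ
  rw [h₁, WithZero.exp_le_exp] at h
  have := h₂ v hv
  omega

/-- An element of order 1 is a quotient of two elements of R, whose orders are weights of lattice
points. The surjectivity of ν thus makes the weight primitive. -/
theorem exists_weight_eq_one (hΛ : IsGermSemigroup Λ) (hν : D.IsDivisorialValuation ν) :
    ∃ w, weight hΛ ν w = 1 := by
  obtain ⟨x, hx⟩ := hν.surjective (WithZero.exp (-1))
  obtain ⟨a, b, hb, rfl⟩ := IsFractionRing.div_surjective (AnalyticAlgebra Λ) x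
  have ha0 : a ≠ 0 := by
    rintro rfl
    rw [map_zero, zero_div, map_zero] at hx
    exact WithZero.exp_ne_zero hx.symm
  have hb0 : b ≠ 0 := by
    rintro rfl
    rw [map_zero, div_zero, map_zero] at hx
    exact WithZero.exp_ne_zero hx.symm
  obtain ⟨u, -, hu, -⟩ := exists_weight_eq_val hΛ hν ha0
  obtain ⟨v, -, hv, -⟩ := exists_weight_eq_val hΛ hν hb0
  rw [map_div₀, hu, hv, ← WithZero.exp_sub, WithZero.exp_inj] at hx
  exact ⟨u - v, by rw [map_sub]; omega⟩

/-- Multiplied by a suitable X^e, p becomes an element of R to which the minimum formula applies. So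
p has positive order exactly when all its exponents have positive weight. -/
theorem val_laurentHom_lt_one_iff (hΛ : IsGermSemigroup Λ) (hν : D.IsDivisorialValuation ν)
    (p : AddMonoidAlgebra ℂ (dualRaySemigroup (weight hΛ ν))) :
    ν (laurentHom K hΛ _ p) < 1 ↔ p ∈ rayOrbitIdeal (weight hΛ ν) := by
  constructor
  · intro h
    rw [← sum_coeff_single p]
    refine sum_mem fun w hw => ?_
    have hw0 : p.coeff w ≠ 0 := Finsupp.mem_support_iff.1 hw
    have hpos : 0 < weight hΛ ν (w : M) := by
      obtain ⟨e, φ, hφ, hc⟩ := exists_laurentMonomial_mul_laurentHom K hΛ p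
      obtain ⟨u, hu, hue⟩ := hc w hw0
      have hφ0 : φ ≠ 0 := by
        rintro rfl
        exact hw0 (hue ▸ serCoeff_zero hΛ u)
      obtain ⟨v, -, h₁, h₂⟩ := exists_weight_eq_val hΛ hν hφ0
      have h₃ := h₂ u (hue ▸ hw0)
      rw [hφ, map_mul, val_laurentMonomial] at h₁
      have h₄ : WithZero.exp (-weight hΛ ν (v : M)) < WithZero.exp (-weight hΛ ν e) := by
        rw [← h₁]
        exact mul_lt_of_lt_one_right (zero_lt_iff.2 WithZero.exp_ne_zero) h
      rw [WithZero.exp_lt_exp] at h₄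
      rw [hu, map_add] at h₃
      omega
    have e : single w (p.coeff w) = single 0 (p.coeff w) * single w 1 := by
      rw [single_mul_single, zero_add, mul_one]
    rw [e]
    exact Ideal.mul_mem_left _ _ (Ideal.subset_span ⟨w, hpos, rfl⟩)
  · intro h
    induction h using Submodule.span_induction with
    | mem x hx =>
      obtain ⟨w, hw, rfl⟩ := hx
      rw [laurentHom_single]
      refine (val_laurentHom_single_le hΛ hν _ _).trans_lt ?_
      rw [← WithZero.exp_zero, WithZero.exp_lt_exp]
      omega
    | zero => simp
    | add x y _ _ hx hy =>
      rw [map_add]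
      exact ν.map_add_lt hx hy
    | smul a x _ hx =>
      rw [smul_eq_mul, map_mul, map_mul]
      exact mul_lt_one_of_nonneg_of_lt_one_right (val_laurentHom_le_one hΛ hν a) zero_le hx

theorem ray_weight_mem_dualNewtonDiagram (hΛ : IsGermSemigroup Λ)
    (hν : D.IsDivisorialValuation ν) :
    ray (weight hΛ ν) ∈ dualNewtonDiagram Λ (saturation Λ \ {0}) := by
  have hρ : (weight hΛ ν).baseChange ℝ ∈ dualConeRho Λ :=
    baseChange_mem_dualConeRho_iff.2 fun u hu => weight_nonneg hΛ hν (mem_saturation_of_mem hu)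
  refine ⟨_, hρ, Set.Subset.antisymm ?_ ?_⟩
  · rintro _ ⟨t, ht, rfl⟩
    exact ⟨fun v hv => mul_nonneg ht (hρ v hv),
      fun v hv v' hv' => mul_le_mul_of_nonneg_left (hv.2 v' hv') ht⟩
  · rintro η ⟨hη, hmin⟩
    have hι := isPositiveEmbedding_weight hΛ hν
    obtain ⟨w₀, hsat, hne, -, -, hw₀⟩ := exists_exponent_of_equation hΛ hν hι
    obtain ⟨w₁, hw₁⟩ := exists_weight_eq_one hΛ hν
    have hface : ∀ u ∈ saturation Λ, u ≠ 0 →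
        (∀ w ∈ saturation Λ, w ≠ 0 → weight hΛ ν u ≤ weight hΛ ν w) → latticePoint u ∈
          faceOf (newtonPolyhedron Λ (saturation Λ \ {0})) ((weight hΛ ν).baseChange ℝ) := by
      intro u hu hu0 h
      rw [latticePoint_mem_faceOf_iff hρ (by exact ⟨hu, hu0⟩)]
      intro b hb
      rw [baseChange_latticePoint, baseChange_latticePoint]
      exact_mod_cast h b hb.1 hb.2
    -- Membership in the cone makes η constant on the minimal face of the weight, which is what the
    -- perturbation argument requires.
    have hker : ∀ w, weight hΛ ν w = 0 → latticeForm η w = 0 := fun w hw =>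
      eq_zero_of_weight_eq_zero hΛ hν (fun u hu hu0 h v hv hv0 huv => le_antisymm
        (hmin _ (hface v hv hv0 (huv ▸ h)) _ (hface u hu hu0 h).1)
        (hmin _ (hface u hu hu0 h) _ (hface v hv hv0 (huv ▸ h)).1)) hw
    -- M is the direct sum of the kernel of the weight and ℤ w₁, so η is its value at w₁ times the
    -- weight.
    have key : ∀ w, latticeForm η w = weight hΛ ν w * latticeForm η w₁ := by
      intro w
      have h := hker (w - weight hΛ ν w • w₁) (by
        rw [map_sub, map_zsmul, hw₁, smul_eq_mul, mul_one, sub_self])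
      rw [map_sub, map_zsmul, zsmul_eq_mul, sub_eq_zero] at h
      exact h
    refine ⟨latticeForm η w₁, ?_, dual_ext fun w => ?_⟩
    · have h₁ : 0 ≤ latticeForm η w₀ := hη _ hsat
      have h₂ : (0 : ℝ) < weight hΛ ν w₀ := by exact_mod_cast weight_pos hΛ hν hsat hne
      rw [key] at h₁
      exact nonneg_of_mul_nonneg_right h₁ h₂
    · rw [LinearMap.smul_apply, baseChange_latticePoint, smul_eq_mul, mul_comm]
      exact key w

theorem relInterior_ray_weight_subset (hΛ : IsGermSemigroup Λ) (hν : D.IsDivisorialValuation ν) :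
    relInterior (ray (weight hΛ ν)) ⊆ relInterior (dualConeRho Λ) := by
  rintro _ ⟨⟨t, ht, rfl⟩, hx⟩
  have hρ : ∀ u ∈ Λ, 0 ≤ weight hΛ ν u := fun u hu =>
    weight_nonneg hΛ hν (mem_saturation_of_mem hu)
  have ht0 : 0 < t := by
    -- The vertex of the ray is not in its relative interior: prolonging the segment from n to 0
    -- would put a negative multiple of n in the ray.
    refine ht.lt_of_ne fun h0 => ?_
    obtain ⟨w₁, hw₁⟩ := exists_weight_eq_one hΛ hν
    obtain ⟨ε, hε, s, hs, e⟩ := hx ((weight hΛ ν).baseChange ℝ) ⟨1, zero_le_one, (one_smul _ _).symm⟩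
    have h := LinearMap.congr_fun e (latticePoint w₁)
    simp only [← h0, LinearMap.add_apply, LinearMap.smul_apply, LinearMap.sub_apply,
      baseChange_latticePoint, hw₁, smul_eq_mul] at h
    push_cast at h
    linarith
  refine ⟨mem_dualConeRho_iff.2 fun u hu => ?_, fun y hy => ?_⟩
  · rw [LinearMap.smul_apply, baseChange_latticePoint]
    exact mul_nonneg ht (by exact_mod_cast hρ u hu)
  · obtain ⟨C, hC, h⟩ := exists_abs_le_mul hΛ
      (fun u hu hu0 => weight_pos hΛ hν (mem_saturation_of_mem hu) hu0) (latticeForm y)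
    -- Since y ≤ C n on Λ, subtracting (t/C) y from t n leaves a form that is non-negative on Λ.
    refine ⟨t / C, by positivity, mem_dualConeRho_iff.2 fun u hu => ?_⟩
    have h₁ : y (latticePoint u) ≤ C * weight hΛ ν u :=
      (abs_le.1 (h u (mem_saturation_of_mem hu))).2
    have h₂ : (0 : ℝ) ≤ weight hΛ ν u := by exact_mod_cast hρ u hu
    simp only [LinearMap.add_apply, LinearMap.smul_apply, LinearMap.sub_apply,
      baseChange_latticePoint, smul_eq_mul]
    have h₃ : t / C * y (latticePoint u) ≤ t * weight hΛ ν u := by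
      calc t / C * y (latticePoint u) ≤ t / C * (C * weight hΛ ν u) := by gcongr
        _ = t * weight hΛ ν u := by field_simp
    have h₄ : 0 ≤ t / C * (t * weight hΛ ν u) := by positivity
    rw [mul_sub]
    linarith

theorem isPrimitiveRayVector_weight (hΛ : IsGermSemigroup Λ) (hν : D.IsDivisorialValuation ν) :
    IsPrimitiveRayVector Λ D (weight hΛ ν) where
  primitive k m h := by
    obtain ⟨w, hw⟩ := exists_weight_eq_one hΛ hν
    rw [h] at hw
    exact IsUnit.of_mul_eq_one (m w) hw
  edge := ray_weight_mem_dualNewtonDiagram hΛ hν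
  interior := relInterior_ray_weight_subset hΛ hν
  generic_point := ⟨laurentHom K hΛ _, laurentHom_single_of_mem K hΛ,
    fun p => (hν.le_one_iff _).1 (val_laurentHom_le_one hΛ hν p), fun p => by
      rw [mem_localMaximalIdeal_iff hν, val_laurentHom_lt_one_iff hΛ hν]⟩

/-- Positivity of n(w) implies positivity of the weight of w. Applied to ±w, this shows that n
vanishes on the kernel of the weight, so n is an integral multiple of it. Primitivity leaves ±1, and
the sign is excluded by positivity. -/
theorem IsPrimitiveRayVector.eq_weight {n : Module.Dual ℤ M} (hn : IsPrimitiveRayVector Λ D n)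
    (hΛ : IsGermSemigroup Λ) (hν : D.IsDivisorialValuation ν) : n = weight hΛ ν := by
  obtain ⟨w₁, hw₁⟩ := exists_weight_eq_one hΛ hν
  have hker : ∀ w, weight hΛ ν w = 0 → n w = 0 := by
    intro w hw
    rcases lt_trichotomy (n w) 0 with h | h | h
    · have := hn.weight_pos hΛ hν (w := -w) (by rw [map_neg]; omega)
      rw [map_neg] at this
      omega
    · exact h
    · have := hn.weight_pos hΛ hν h
      omega
  have e : n = n w₁ • weight hΛ ν := by
    ext w
    have h := hker (w - weight hΛ ν w • w₁) (by
      rw [map_sub, map_zsmul, hw₁, smul_eq_mul, mul_one, sub_self])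
    rw [map_sub, map_zsmul, smul_eq_mul, sub_eq_zero] at h
    rw [LinearMap.smul_apply, smul_eq_mul, mul_comm]
    exact h
  rcases Int.isUnit_iff.1 (hn.primitive _ _ e) with h | h
  · rw [e, h, one_smul]
  · have := hn.weight_pos hΛ hν (w := -w₁) (by rw [map_neg]; omega)
    rw [map_neg] at this
    omega

end RayVector

/-! ### The grading of ℂ[Λ] by the weight -/

section WeightComponent

open AddMonoidAlgebra

variable {M : Type*} [AddCommGroup M] {Λ : AddSubmonoid M} {n : Module.Dual ℤ M}

theorem mem_weightComponent_iff {k : ℕ} {p : AddMonoidAlgebra ℂ Λ} :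
    p ∈ weightComponent Λ n k ↔ ∀ u, p.coeff u ≠ 0 → n u = k := by
  constructor
  · intro h
    induction h using Submodule.span_induction with
    | mem x hx =>
      obtain ⟨v, hv, rfl⟩ := hx
      intro u hu
      by_cases e : v = u
      · rw [← e, hv]
      · simp [e] at hu
    | zero => intro u hu; simp at hu
    | add x y _ _ hx hy =>
      intro u hu
      by_cases e : x.coeff u = 0
      · exact hy u fun e' => hu (by rw [coeff_add, Finsupp.add_apply, e, e', add_zero])
      · exact hx u e
    | smul z x _ hx =>
      intro u hu
      exact hx u fun e => hu (by rw [coeff_smul, Finsupp.smul_apply, e, smul_zero])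
  · intro h
    rw [← sum_coeff_single p]
    refine sum_mem fun u hu => ?_
    have e : single u (p.coeff u) = p.coeff u • single u (1 : ℂ) := by
      rw [smul_single, smul_eq_mul, mul_one]
    rw [e]
    exact Submodule.smul_mem _ _ (Submodule.subset_span ⟨u, h u (Finsupp.mem_support_iff.1 hu), rfl⟩)

theorem single_mem_weightComponent {k : ℕ} {u : Λ} (hu : n u = k) (z : ℂ) :
    single u z ∈ weightComponent Λ n k := by
  rw [mem_weightComponent_iff]
  intro v hv
  by_cases e : u = v
  · rw [← e, hu]
  · simp [e] at hv

theorem mul_mem_weightComponent {i j : ℕ} {p q : AddMonoidAlgebra ℂ Λ}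
    (hp : p ∈ weightComponent Λ n i) (hq : q ∈ weightComponent Λ n j) :
    p * q ∈ weightComponent Λ n (i + j) := by
  rw [mem_weightComponent_iff] at *
  intro w hw
  obtain ⟨u, v, rfl, hu, hv⟩ := exists_add_of_coeff_mul_ne_zero hw
  rw [AddSubmonoid.coe_add, map_add, hp u hu, hq v hv]
  push_cast
  rfl

/-- If the weight is positive on `Λ - {0}`, the components of positive degree generate the ideal of
the zero-dimensional orbit. -/
theorem weightPositiveIdeal_eq (hn : ∀ u ∈ Λ, u ≠ 0 → 0 < n u) :
    weightPositiveIdeal Λ n = orbitMaximalIdeal Λ := by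
  refine le_antisymm (Ideal.span_le.2 ?_) (Ideal.span_le.2 ?_)
  · rintro p ⟨k, hk, hp⟩
    rw [SetLike.mem_coe, ← sum_coeff_single p]
    refine sum_mem fun u hu => single_mem_orbitMaximalIdeal ?_ _
    rintro rfl
    have := mem_weightComponent_iff.1 hp 0 (Finsupp.mem_support_iff.1 hu)
    rw [ZeroMemClass.coe_zero, map_zero] at this
    omega
  · rintro _ ⟨u, hu, rfl⟩
    have := hn u u.2 fun h => hu (Subtype.ext h)
    exact Ideal.subset_span ⟨(n u).toNat, by omega,
      single_mem_weightComponent (Int.toNat_of_nonneg this.le).symm 1⟩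

/-- It is the kernel of the constant coefficient, which maps onto ℂ. -/
theorem isMaximal_orbitMaximalIdeal (hzero : ∀ u ∈ Λ, -u ∈ Λ → u = 0) :
    (orbitMaximalIdeal Λ).IsMaximal := by
  have h : orbitMaximalIdeal Λ = RingHom.ker (constantCoeff hzero) := by
    refine le_antisymm (orbitMaximalIdeal_le_ker hzero) fun p hp => ?_
    have e : p - single 0 (p.coeff 0) ∈ orbitMaximalIdeal Λ := by
      rw [← sum_coeff_single (p - single 0 (p.coeff 0))]
      refine sum_mem fun u hu => single_mem_orbitMaximalIdeal ?_ _
      rintro rfl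
      exact Finsupp.mem_support_iff.1 hu (by simp)
    have e' := orbitMaximalIdeal_le_ker hzero e
    rw [RingHom.mem_ker, map_sub, RingHom.mem_ker.1 hp, constantCoeff_single, if_pos rfl, zero_sub,
      neg_eq_zero] at e'
    rwa [e', single_zero, sub_zero] at e
  rw [h]
  exact RingHom.ker_isMaximal_of_surjective _ fun z => ⟨single 0 z, by simp [constantCoeff_single]⟩

end WeightComponent

/-! ### The isomorphism of the associated graded algebra with ℂ[Λ] -/

section GradedAlgebra

open AddMonoidAlgebra

variable {M : Type*} [AddCommGroup M] [Module.Free ℤ M] [Module.Finite ℤ M] {Λ : AddSubmonoid M}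
variable {K : Type*} [Field K] [Algebra (AnalyticAlgebra Λ) K] [IsFractionRing (AnalyticAlgebra Λ) K]
variable {D : ExceptionalComponent (AnalyticAlgebra Λ) K} {ν : Valuation K ℤᵐ⁰}

/-- A monomial in 𝔪^(k+1) has weight at least k + 1, so the exponents of weight k are among the
finitely many outside that power. -/
theorem finite_setOf_weight_eq (hΛ : IsGermSemigroup Λ) (hν : D.IsDivisorialValuation ν) (k : ℕ) :
    {u : Λ | weight hΛ ν u = k}.Finite := by
  refine (finite_setOf_single_notMem_pow hΛ.fg (k + 1)).subset fun u hu h => ?_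
  have h₁ := map_pow_le_filtration hΛ hν _ (Ideal.mem_map_of_mem _ h)
  rw [algebraMap_eq_of, mem_filtration_iff hΛ hν] at h₁
  have h₂ := h₁ u (by rw [serCoeff_of hΛ]; simp)
  have h₃ : weight hΛ ν (u : M) = k := hu
  push_cast at h₂
  omega

/-- The part of weight `k` of the expansion of an element of the analytic algebra. -/
noncomputable def weightPart (hΛ : IsGermSemigroup Λ) (hν : D.IsDivisorialValuation ν) (k : ℕ)
    (φ : AnalyticAlgebra Λ) : AddMonoidAlgebra ℂ Λ :=
  ∑ u ∈ (finite_setOf_weight_eq hΛ hν k).toFinset, single u (serCoeff φ u)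

theorem coeff_weightPart (hΛ : IsGermSemigroup Λ) (hν : D.IsDivisorialValuation ν) (k : ℕ)
    (φ : AnalyticAlgebra Λ) (u : Λ) :
    (weightPart hΛ hν k φ).coeff u = if weight hΛ ν u = k then serCoeff φ u else 0 := by
  rw [weightPart, coeff_sum_single]
  simp

theorem weightPart_mem (hΛ : IsGermSemigroup Λ) (hν : D.IsDivisorialValuation ν) (k : ℕ)
    (φ : AnalyticAlgebra Λ) : weightPart hΛ hν k φ ∈ weightComponent Λ (weight hΛ ν) k := by
  rw [mem_weightComponent_iff]
  intro u hu
  rw [coeff_weightPart] at hu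
  by_contra h
  exact hu (if_neg h)

/-- A homogeneous p of weight k is determined by its class modulo 𝔪-series of higher weight, that
is, modulo 𝔭ₖ₊₁. The compatibility with sums, scalars and products is checked through this
characterization. -/
theorem weightPart_eq (hΛ : IsGermSemigroup Λ) (hν : D.IsDivisorialValuation ν) {k : ℕ}
    {φ : AnalyticAlgebra Λ} {p : AddMonoidAlgebra ℂ Λ}
    (hp : p ∈ weightComponent Λ (weight hΛ ν) k)
    (h : φ - algebraMap _ (AnalyticAlgebra Λ) p ∈ hν.filtration.ideal (k + 1)) :
    weightPart hΛ hν k φ = p := by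
  ext u
  rw [coeff_weightPart]
  split_ifs with hu
  · rw [mem_filtration_iff hΛ hν] at h
    by_contra hne
    have := h u (by
      rw [serCoeff_sub hΛ, algebraMap_eq_of, serCoeff_of hΛ]
      exact sub_ne_zero.2 hne)
    push_cast at this
    omega
  · by_contra hne
    exact hu (mem_weightComponent_iff.1 hp u (Ne.symm hne))

theorem sub_weightPart_mem (hΛ : IsGermSemigroup Λ) (hν : D.IsDivisorialValuation ν) {k : ℕ}
    {φ : AnalyticAlgebra Λ} (hφ : φ ∈ hν.filtration.ideal k) :
    φ - algebraMap _ (AnalyticAlgebra Λ) (weightPart hΛ hν k φ) ∈ hν.filtration.ideal (k + 1) := by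
  rw [mem_filtration_iff hΛ hν] at hφ ⊢
  intro u hu
  rw [serCoeff_sub hΛ, algebraMap_eq_of, serCoeff_of hΛ, coeff_weightPart] at hu
  split_ifs at hu with h
  · simp at hu
  · rw [sub_zero] at hu
    have := hφ u hu
    push_cast
    omega

theorem algebraMap_mem_filtration (hΛ : IsGermSemigroup Λ) (hν : D.IsDivisorialValuation ν) {k : ℕ}
    {p : AddMonoidAlgebra ℂ Λ} (hp : p ∈ weightComponent Λ (weight hΛ ν) k) :
    algebraMap _ (AnalyticAlgebra Λ) p ∈ hν.filtration.ideal k := by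
  rw [mem_filtration_iff hΛ hν]
  intro u hu
  rw [algebraMap_eq_of, serCoeff_of hΛ] at hu
  exact (mem_weightComponent_iff.1 hp u hu).ge

theorem weightPart_congr (hΛ : IsGermSemigroup Λ) (hν : D.IsDivisorialValuation ν) {k : ℕ}
    {φ ψ : AnalyticAlgebra Λ} (hψ : ψ ∈ hν.filtration.ideal k)
    (h : φ - ψ ∈ hν.filtration.ideal (k + 1)) :
    weightPart hΛ hν k φ = weightPart hΛ hν k ψ := by
  refine weightPart_eq hΛ hν (weightPart_mem hΛ hν k ψ) ?_
  rw [← sub_add_sub_cancel]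
  exact add_mem h (sub_weightPart_mem hΛ hν hψ)

theorem weightPart_add (hΛ : IsGermSemigroup Λ) (hν : D.IsDivisorialValuation ν) {k : ℕ}
    {φ ψ : AnalyticAlgebra Λ} (hφ : φ ∈ hν.filtration.ideal k) (hψ : ψ ∈ hν.filtration.ideal k) :
    weightPart hΛ hν k (φ + ψ) = weightPart hΛ hν k φ + weightPart hΛ hν k ψ := by
  refine weightPart_eq hΛ hν (add_mem (weightPart_mem hΛ hν k φ) (weightPart_mem hΛ hν k ψ)) ?_
  rw [map_add, add_sub_add_comm]
  exact add_mem (sub_weightPart_mem hΛ hν hφ) (sub_weightPart_mem hΛ hν hψ)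

theorem weightPart_smul (hΛ : IsGermSemigroup Λ) (hν : D.IsDivisorialValuation ν) {k : ℕ} (z : ℂ)
    {φ : AnalyticAlgebra Λ} (hφ : φ ∈ hν.filtration.ideal k) :
    weightPart hΛ hν k (z • φ) = z • weightPart hΛ hν k φ := by
  refine weightPart_eq hΛ hν (Submodule.smul_mem _ z (weightPart_mem hΛ hν k φ)) ?_
  have e : algebraMap _ (AnalyticAlgebra Λ) (z • weightPart hΛ hν k φ) =
      z • algebraMap _ (AnalyticAlgebra Λ) (weightPart hΛ hν k φ) := by
    rw [Algebra.algebraMap_eq_smul_one, Algebra.algebraMap_eq_smul_one, smul_assoc]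
  rw [e, ← smul_sub]
  exact Submodule.smul_of_tower_mem _ z (sub_weightPart_mem hΛ hν hφ)

theorem weightPart_mul (hΛ : IsGermSemigroup Λ) (hν : D.IsDivisorialValuation ν) {i j : ℕ}
    {φ ψ : AnalyticAlgebra Λ} (hφ : φ ∈ hν.filtration.ideal i) (hψ : ψ ∈ hν.filtration.ideal j) :
    weightPart hΛ hν (i + j) (φ * ψ) = weightPart hΛ hν i φ * weightPart hΛ hν j ψ := by
  refine weightPart_eq hΛ hν
    (mul_mem_weightComponent (weightPart_mem hΛ hν i φ) (weightPart_mem hΛ hν j ψ)) ?_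
  set a := algebraMap _ (AnalyticAlgebra Λ) (weightPart hΛ hν i φ) with ha
  set b := algebraMap _ (AnalyticAlgebra Λ) (weightPart hΛ hν j ψ) with hb
  have e : φ * ψ - a * b = (φ - a) * ψ + a * (ψ - b) := by ring
  rw [map_mul, ← ha, ← hb, e]
  refine add_mem ?_ ?_
  · have := hν.filtration.mul_mem (sub_weightPart_mem hΛ hν hφ) hψ
    rwa [add_right_comm] at this
  · have := hν.filtration.mul_mem (algebraMap_mem_filtration hΛ hν (weightPart_mem hΛ hν i φ))
      (sub_weightPart_mem hΛ hν hψ)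
    rwa [← add_assoc] at this

theorem weightPart_algebraMap (hΛ : IsGermSemigroup Λ) (hν : D.IsDivisorialValuation ν) {k : ℕ}
    {p : AddMonoidAlgebra ℂ Λ} (hp : p ∈ weightComponent Λ (weight hΛ ν) k) :
    weightPart hΛ hν k (algebraMap _ _ p) = p :=
  weightPart_eq hΛ hν hp (by rw [sub_self]; exact zero_mem _)

theorem mem_filtration_succ_of_weightPart_eq_zero (hΛ : IsGermSemigroup Λ)
    (hν : D.IsDivisorialValuation ν) {k : ℕ} {φ : AnalyticAlgebra Λ}
    (hφ : φ ∈ hν.filtration.ideal k) (h : weightPart hΛ hν k φ = 0) :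
    φ ∈ hν.filtration.ideal (k + 1) := by
  simpa [h] using sub_weightPart_mem hΛ hν hφ

theorem weightPart_choose (hΛ : IsGermSemigroup Λ) (hν : D.IsDivisorialValuation ν) {k : ℕ}
    {φ : AnalyticAlgebra Λ} (hφ : φ ∈ hν.filtration.ideal k) :
    weightPart hΛ hν k (pieceMk_surj _ (pieceMk hν.filtration k φ hφ)).choose =
      weightPart hΛ hν k φ := by
  have h := (pieceMk_surj _ (pieceMk hν.filtration k φ hφ)).choose_spec
  exact weightPart_congr hΛ hν hφ ((pieceMk_eq_iff _ (ha := h.choose)).1 h.choose_spec.symm)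

/-- The map from a graded piece to the coordinate ring given by the part of least weight. -/
noncomputable def gradedPieceMap (hΛ : IsGermSemigroup Λ) (hν : D.IsDivisorialValuation ν) (k : ℕ) :
    GradedPiece hν.filtration k →ₗ[ℂ] AddMonoidAlgebra ℂ Λ where
  toFun x := weightPart hΛ hν k (pieceMk_surj hν.filtration x).choose
  map_add' x y := by
    obtain ⟨a, ha, rfl⟩ := pieceMk_surj _ x
    obtain ⟨b, hb, rfl⟩ := pieceMk_surj _ y
    rw [pieceMk_add, weightPart_choose, weightPart_choose, weightPart_choose,
      weightPart_add hΛ hν ha hb]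
  map_smul' z x := by
    obtain ⟨a, ha, rfl⟩ := pieceMk_surj _ x
    have e : z • pieceMk hν.filtration k a ha =
        pieceMk hν.filtration k (z • a) (Submodule.smul_of_tower_mem _ z ha) := rfl
    rw [e, weightPart_choose, weightPart_choose, weightPart_smul hΛ hν z ha, RingHom.id_apply]

theorem gradedPieceMap_pieceMk (hΛ : IsGermSemigroup Λ) (hν : D.IsDivisorialValuation ν) {k : ℕ}
    {φ : AnalyticAlgebra Λ} (hφ : φ ∈ hν.filtration.ideal k) :
    gradedPieceMap hΛ hν k (pieceMk hν.filtration k φ hφ) = weightPart hΛ hν k φ :=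
  weightPart_choose hΛ hν hφ

theorem gradedPieceMap_mul (hΛ : IsGermSemigroup Λ) (hν : D.IsDivisorialValuation ν) {i j : ℕ}
    (x : GradedPiece hν.filtration i) (y : GradedPiece hν.filtration j) :
    gradedPieceMap hΛ hν (i + j) (GradedMonoid.GMul.mul x y) =
      gradedPieceMap hΛ hν i x * gradedPieceMap hΛ hν j y := by
  obtain ⟨a, ha, rfl⟩ := pieceMk_surj _ x
  obtain ⟨b, hb, rfl⟩ := pieceMk_surj _ y
  rw [gmul_mk, gradedPieceMap_pieceMk, gradedPieceMap_pieceMk, gradedPieceMap_pieceMk,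
    weightPart_mul hΛ hν ha hb]

theorem gradedPieceMap_one (hΛ : IsGermSemigroup Λ) (hν : D.IsDivisorialValuation ν) :
    gradedPieceMap hΛ hν 0 GradedMonoid.GOne.one = 1 := by
  change gradedPieceMap hΛ hν 0 (pieceMk hν.filtration 0 1 hν.filtration.one_mem) = 1
  rw [gradedPieceMap_pieceMk, ← map_one (algebraMap (AddMonoidAlgebra ℂ Λ) _),
    weightPart_algebraMap]
  exact single_mem_weightComponent (by simp) 1

/-- The isomorphism of the graded algebra of the filtration with the coordinate ring, as a
homomorphism. -/
noncomputable def gradedHom (hΛ : IsGermSemigroup Λ) (hν : D.IsDivisorialValuation ν) :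
    AssociatedGraded hν.filtration →ₐ[ℂ] AddMonoidAlgebra ℂ Λ :=
  DirectSum.toAlgebra ℂ (GradedPiece hν.filtration) (gradedPieceMap hΛ hν)
    (gradedPieceMap_one hΛ hν) (gradedPieceMap_mul hΛ hν)

theorem gradedHom_of (hΛ : IsGermSemigroup Λ) (hν : D.IsDivisorialValuation ν) (k : ℕ)
    (x : GradedPiece hν.filtration k) :
    gradedHom hΛ hν (DirectSum.of _ k x) = gradedPieceMap hΛ hν k x := by
  have h := DirectSum.toAddMonoid_of (fun i => (gradedPieceMap hΛ hν i).toAddMonoidHom) k x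
  exact h

theorem gradedHom_initialForm (hΛ : IsGermSemigroup Λ) (hν : D.IsDivisorialValuation ν) {k : ℕ}
    {φ : AnalyticAlgebra Λ} (hφ : φ ∈ hν.filtration.ideal k) :
    gradedHom hΛ hν (initialForm hν.filtration k φ hφ) = weightPart hΛ hν k φ := by
  rw [initialForm, gradedHom_of, gradedPieceMap_pieceMk]

theorem gradedPieceMap_mem (hΛ : IsGermSemigroup Λ) (hν : D.IsDivisorialValuation ν) {k : ℕ}
    (x : GradedPiece hν.filtration k) :
    gradedPieceMap hΛ hν k x ∈ weightComponent Λ (weight hΛ ν) k := by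
  obtain ⟨a, ha, rfl⟩ := pieceMk_surj _ x
  rw [gradedPieceMap_pieceMk]
  exact weightPart_mem hΛ hν k a

/-- Distinct components map to polynomials with disjoint exponents, so only the component of degree
k contributes at an exponent of weight k. Injectivity then reduces to a single degree. -/
theorem coeff_gradedHom (hΛ : IsGermSemigroup Λ) (hν : D.IsDivisorialValuation ν)
    (x : AssociatedGraded hν.filtration) {k : ℕ} {u : Λ} (hu : weight hΛ ν u = k) :
    (gradedHom hΛ hν x).coeff u = (gradedPieceMap hΛ hν k (x k)).coeff u := by
  induction x using DirectSum.induction_on with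
  | zero => simp
  | of i y =>
    rw [gradedHom_of]
    by_cases h : i = k
    · subst h
      rw [DirectSum.of_eq_same]
    · rw [DirectSum.of_eq_of_ne _ _ _ (Ne.symm h), map_zero]
      by_contra hne
      have := mem_weightComponent_iff.1 (gradedPieceMap_mem hΛ hν y) u hne
      rw [hu] at this
      exact h (by exact_mod_cast this.symm)
  | add x y hx hy =>
    rw [map_add, coeff_add, Finsupp.add_apply, hx, hy, DirectSum.add_apply, map_add, coeff_add,
      Finsupp.add_apply]

theorem gradedHom_injective (hΛ : IsGermSemigroup Λ) (hν : D.IsDivisorialValuation ν) :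
    Function.Injective (gradedHom hΛ hν) := by
  rw [injective_iff_map_eq_zero]
  intro x hx
  refine DFinsupp.ext fun k => ?_
  obtain ⟨a, ha, e⟩ := pieceMk_surj _ (x k)
  rw [e]
  have h : weightPart hΛ hν k a = 0 := by
    ext u
    by_cases hu : weight hΛ ν u = k
    · rw [← gradedPieceMap_pieceMk hΛ hν ha, ← e, ← coeff_gradedHom hΛ hν x hu, hx]
    · rw [coeff_weightPart, if_neg hu]
      rfl
  rw [DirectSum.zero_apply, pieceMk_zero, pieceMk_eq_iff, sub_zero]
  exact mem_filtration_succ_of_weightPart_eq_zero hΛ hν ha h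

theorem image_gradedComponent (hΛ : IsGermSemigroup Λ) (hν : D.IsDivisorialValuation ν) (k : ℕ) :
    gradedHom hΛ hν '' (gradedComponent hν.filtration k) = weightComponent Λ (weight hΛ ν) k := by
  ext p
  constructor
  · rintro ⟨_, ⟨x, rfl⟩, rfl⟩
    rw [gradedHom_of]
    exact gradedPieceMap_mem hΛ hν x
  · intro hp
    refine ⟨initialForm hν.filtration k _ (algebraMap_mem_filtration hΛ hν hp), ⟨_, rfl⟩, ?_⟩
    rw [gradedHom_initialForm, weightPart_algebraMap hΛ hν hp]

theorem gradedHom_surjective (hΛ : IsGermSemigroup Λ) (hν : D.IsDivisorialValuation ν) :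
    Function.Surjective (gradedHom hΛ hν) := by
  intro p
  rw [← AlgHom.mem_range, ← sum_coeff_single p]
  refine sum_mem fun u _ => ?_
  have hu : weight hΛ ν u = ((weight hΛ ν u).toNat : ℤ) :=
    (Int.toNat_of_nonneg (weight_nonneg hΛ hν (mem_saturation_of_mem u.2))).symm
  obtain ⟨x, -, hx⟩ := (image_gradedComponent hΛ hν _).ge
    (single_mem_weightComponent hu (p.coeff u))
  exact ⟨x, hx⟩

/-- The graded algebra of the filtration by the order of vanishing along an exceptional component is
the coordinate ring graded by the weight. -/
noncomputable def gradedEquiv (hΛ : IsGermSemigroup Λ) (hν : D.IsDivisorialValuation ν) :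
    AssociatedGraded hν.filtration ≃ₐ[ℂ] AddMonoidAlgebra ℂ Λ :=
  AlgEquiv.ofBijective (gradedHom hΛ hν) ⟨gradedHom_injective hΛ hν, gradedHom_surjective hΛ hν⟩

theorem map_positiveIdeal (hΛ : IsGermSemigroup Λ) (hν : D.IsDivisorialValuation ν) :
    (positiveIdeal hν.filtration).map (gradedEquiv hΛ hν) =
      weightPositiveIdeal Λ (weight hΛ ν) := by
  rw [positiveIdeal, Ideal.map_span, weightPositiveIdeal]
  congr 1
  ext p
  constructor
  · rintro ⟨x, ⟨k, hk, hx⟩, rfl⟩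
    exact ⟨k, hk, (image_gradedComponent hΛ hν k).le ⟨x, hx, rfl⟩⟩
  · rintro ⟨k, hk, hp⟩
    obtain ⟨x, hx, rfl⟩ := (image_gradedComponent hΛ hν k).ge hp
    exact ⟨x, ⟨k, hk, hx⟩, rfl⟩

/-- Positivity of the weight off 0 identifies the ideal of positive degree in ℂ[Λ] with the maximal
ideal of the zero-dimensional orbit, which is pulled back through the isomorphism. -/
theorem isMaximal_positiveIdeal (hΛ : IsGermSemigroup Λ) (hν : D.IsDivisorialValuation ν) :
    (positiveIdeal hν.filtration).IsMaximal := by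
  have h := isMaximal_orbitMaximalIdeal hΛ.pointed
  rw [← weightPositiveIdeal_eq fun u hu hu0 => weight_pos hΛ hν (mem_saturation_of_mem hu) hu0,
    ← map_positiveIdeal hΛ hν] at h
  rw [← Ideal.comap_map_of_bijective _ (gradedEquiv hΛ hν).bijective
    (I := positiveIdeal hν.filtration)]
  exact Ideal.comap_isMaximal_of_surjective _ (gradedEquiv hΛ hν).surjective

/-- For φ ∈ 𝔭ₖ outside 𝔭ₖ₊₁ the least weight of an exponent is exactly k, so the exponents of weight
k are those on the face where the weight is minimal. -/
theorem coeff_weightPart_eq_symbolicRestriction (hΛ : IsGermSemigroup Λ)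
    (hν : D.IsDivisorialValuation ν) {k : ℕ} {φ : AnalyticAlgebra Λ}
    (hφ : φ ∈ hν.filtration.ideal k) (hφ' : φ ∉ hν.filtration.ideal (k + 1)) (u : Λ) :
    (weightPart hΛ hν k φ).coeff u =
      symbolicRestriction Λ (serCoeff φ) ((weight hΛ ν).baseChange ℝ) u := by
  rw [coeff_weightPart, symbolicRestriction]
  by_cases hu : serCoeff φ u = 0
  · simp [hu]
  have hρ : (weight hΛ ν).baseChange ℝ ∈ dualConeRho Λ :=
    baseChange_mem_dualConeRho_iff.2 fun u hu => weight_nonneg hΛ hν (mem_saturation_of_mem hu)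
  have hmin := (mem_filtration_iff hΛ hν).1 hφ
  have key : weight hΛ ν u = k ↔ latticePoint (u : M) ∈
      faceOf (newtonPolyhedron Λ {a | ∃ w : Λ, serCoeff φ w ≠ 0 ∧ a = (w : M)})
        ((weight hΛ ν).baseChange ℝ) := by
    rw [latticePoint_mem_faceOf_iff hρ (by exact ⟨u, hu, rfl⟩)]
    simp only [baseChange_latticePoint, Int.cast_le]
    constructor
    · rintro h _ ⟨w, hw, rfl⟩
      rw [h]
      exact hmin w hw
    · intro h
      rw [mem_filtration_iff hΛ hν] at hφ'
      push Not at hφ'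
      obtain ⟨w, hw, hwk⟩ := hφ'
      have h₁ := h w ⟨w, hw, rfl⟩
      have h₂ := hmin u hu
      push_cast at hwk
      omega
  by_cases h : weight hΛ ν u = k
  · rw [if_pos h, if_pos (key.1 h)]
  · rw [if_neg h, if_neg (mt key.2 h)]

end GradedAlgebra

end ToricGerm

theorem mainTheorem4 {M : Type*} [AddCommGroup M] [Module.Free ℤ M] [Module.Finite ℤ M]
    (Λ : AddSubmonoid M) (hfg : Λ.FG)
    (hgen : AddSubgroup.closure (Λ : Set M) = ⊤)
    (hzero : ∀ u ∈ Λ, -u ∈ Λ → u = 0)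
    {K : Type*} [Field K] [Algebra (ToricGerm.AnalyticAlgebra Λ) K]
    [IsFractionRing (ToricGerm.AnalyticAlgebra Λ) K] :
    (∀ φ : ToricGerm.AnalyticAlgebra Λ, ∃! c : Λ → ℂ, ToricGerm.HasExpansion Λ φ c) ∧
    ∀ (D : ToricGerm.ExceptionalComponent (ToricGerm.AnalyticAlgebra Λ) K)
      (ν : Valuation K ℤᵐ⁰) (hν : D.IsDivisorialValuation ν),
      (∃! n : Module.Dual ℤ M, ToricGerm.IsPrimitiveRayVector Λ D n) ∧
      ∀ n : Module.Dual ℤ M, ToricGerm.IsPrimitiveRayVector Λ D n →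
        (∀ u ∈ Λ, 0 ≤ n u) ∧
        (ToricGerm.positiveIdeal hν.filtration).IsMaximal ∧
        ∃ Φ : ToricGerm.AssociatedGraded hν.filtration ≃ₐ[ℂ] AddMonoidAlgebra ℂ Λ,
          (∀ k : ℕ, Φ '' (ToricGerm.gradedComponent hν.filtration k) =
            ToricGerm.weightComponent Λ n k) ∧
          (ToricGerm.positiveIdeal hν.filtration).map Φ = ToricGerm.weightPositiveIdeal Λ n ∧
          ∀ (k : ℕ) (φ : ToricGerm.AnalyticAlgebra Λ) (hφ : φ ∈ hν.filtration.ideal k),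
            φ ∉ hν.filtration.ideal (k + 1) →
            ∀ c : Λ → ℂ, ToricGerm.HasExpansion Λ φ c →
              ∀ u : Λ, (Φ (ToricGerm.initialForm hν.filtration k φ hφ)).coeff u =
                ToricGerm.symbolicRestriction Λ c (n.baseChange ℝ) u := by
  have hΛ : ToricGerm.IsGermSemigroup Λ := ⟨hfg, hgen, hzero⟩
  refine ⟨ToricGerm.existsUnique_hasExpansion hΛ, fun D ν hν =>
    ⟨⟨ToricGerm.weight hΛ ν, ToricGerm.isPrimitiveRayVector_weight hΛ hν,
      fun n hn => hn.eq_weight hΛ hν⟩, fun n hn => ?_⟩⟩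
  refine ⟨hn.nonneg, ToricGerm.isMaximal_positiveIdeal hΛ hν, ToricGerm.gradedEquiv hΛ hν, ?_⟩
  obtain rfl := hn.eq_weight hΛ hν
  refine ⟨ToricGerm.image_gradedComponent hΛ hν, ToricGerm.map_positiveIdeal hΛ hν,
    fun k φ hφ hφ' c hc u => ?_⟩
  rw [funext ((ToricGerm.hasExpansion_iff hΛ).1 hc),
    ← ToricGerm.coeff_weightPart_eq_symbolicRestriction hΛ hν hφ hφ',
    ← ToricGerm.gradedHom_initialForm hΛ hν hφ]
  rfl
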